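/- Let $n\ge 2$ and let $W\in C^3(\mathbb R)$ be an even, nonnegative double-well potential: its critical points are exactly $-1,0,1$, with $W(\pm1)=0$, $W''(\pm1)>0$, and $0$ is a local maximum. For a bounded open set $\Omega\subset\mathbb R^{n+1}$, $\varepsilon>0$ and $u\in H^1(\Omega)$ put $$E_\varepsilon(u)=\int_\Omega \frac{\varepsilon|\nabla u|^2}{2}+\frac{W(u)}{\varepsilon}\in[0,\infty].$$ For a symmetric set $A=-A\subset H^1(\Omega)$ let $\operatorname{ind}(A)$ be its cohomological $\mathbb Z/2$-index: $\operatorname{ind}(A)=\infty$ if $0\in A$, and otherwise $$\operatorname{ind}(A)=\sup\{k\ge1:\ \tilde f^*(w^{k-1})\ne0\in H^{k-1}(A/\{u\sim-u\};\mathbb Z/2)\}$$ (with $\operatorname{ind}(\emptyset)=0$), where $f:A\to S^\infty$ is an odd continuous map, $\tilde f: A/\{u\sim -u\}\to\mathbb{RP}^\infty$ is the induced map, $w$ is the generator of $H^1(\mathbb{RP}^\infty;\mathbb Z/2)$, and $H^*$ is Alexander–Spanier cohomology. For $p\in\mathbb N$ let $$c_\varepsilon(p,\Omega)=\inf\Big\{\sup_{u\in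 A}E_\varepsilon(u):\ A\subset H^1(\Omega)\text{ compact},\ A=-A,\ \operatorname{ind}(A)\ge p+1\Big\},$$ $$\ell_p(\Omega)=\frac1{2\sigma}\liminf_{\varepsilon\to0^+}c_\varepsilon(p,\Omega),\qquad \sigma=\int_{-1}^1\sqrt{W(t)/2}\,dt.$$ Then there is a constant $\tau=\tau(n,W)>0$ such that for every bounded Lipschitz domain $\Omega\subset\mathbb R^{n+1}$ (a bounded open set, connected or not, which near each of its boundary points is, in suitable Cartesian coordinates, the region above the graph of a Lipschitz function), and in particular for every bounded Lipschitz domain with piecewise smooth boundary, $$\lim_{p\to\infty}p^{-\frac1{n+1}}\,\ell_p(\Omega)=\tau(n,W)\,|\Omega|^{\frac n{n+1}}.$$ -/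

import Mathlib

open MeasureTheory Filter Topology Set
open scoped ENNReal NNReal ContDiff

namespace AllenCahn

noncomputable section

/-! ### Alexander-Spanier cohomology with coefficients in the field with two elements -/

/-- Alexander-Spanier `q`-cochains of `X` with coefficients in `ZMod 2`, before dividing by the
locally zero ones: arbitrary functions of `q + 1` points. -/
abbrev Cochain (X : Type*) (q : ℕ) : Type _ := (Fin (q + 1) → X) → ZMod 2

/-- The coboundary; the usual signs `(-1) ^ i` are trivial modulo two. -/
def coboundary (X : Type*) (q : ℕ) : Cochain X q →ₗ[ZMod 2] Cochain X (q + 1) where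
  toFun φ := fun x => ∑ i : Fin (q + 2), φ (fun j => x (i.succAbove j))
  map_add' φ ψ := by
    ext x
    simp [Finset.sum_add_distrib]
  map_smul' c φ := by
    ext x
    simp [Finset.mul_sum]

/-- Cochains that vanish on all tuples of points which are close to a common point. -/
def locallyZero (X : Type*) [TopologicalSpace X] (q : ℕ) : Submodule (ZMod 2) (Cochain X q) where
  carrier := {φ | ∀ a : X, ∃ U ∈ 𝓝 a, ∀ x : Fin (q + 1) → X, (∀ i, x i ∈ U) → φ x = 0}
  zero_mem' := fun _ => ⟨univ, univ_mem, fun _ _ => rfl⟩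
  add_mem' := by
    intro φ ψ hφ hψ a
    obtain ⟨U, hU, h1⟩ := hφ a
    obtain ⟨V, hV, h2⟩ := hψ a
    refine ⟨U ∩ V, inter_mem hU hV, fun x hx => ?_⟩
    simp [h1 x fun i => (hx i).1, h2 x fun i => (hx i).2]
  smul_mem' := by
    intro c φ hφ a
    obtain ⟨U, hU, h1⟩ := hφ a
    exact ⟨U, hU, fun x hx => by simp [h1 x hx]⟩

/-- Cochains whose coboundary is locally zero. -/
def cocycles (X : Type*) [TopologicalSpace X] (q : ℕ) : Submodule (ZMod 2) (Cochain X q) :=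
  (locallyZero X (q + 1)).comap (coboundary X q)

/-- Cochains that agree with a coboundary up to a locally zero cochain. -/
def coboundaries (X : Type*) [TopologicalSpace X] :
    (q : ℕ) → Submodule (ZMod 2) (Cochain X q)
  | 0 => locallyZero X 0
  | q + 1 => locallyZero X (q + 1) ⊔ LinearMap.range (coboundary X q)

/-- The Alexander-Spanier cohomology group `H^q(X; ℤ/2)`. -/
abbrev Cohomology (X : Type*) [TopologicalSpace X] (q : ℕ) : Type _ :=
  cocycles X q ⧸ (coboundaries X q).submoduleOf (cocycles X q)

theorem locallyZero_le_coboundaries {X : Type*} [TopologicalSpace X] (q : ℕ) : locallyZero X q ≤ coboundaries X q := by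
  cases q with
  | zero => exact le_rfl
  | succ q => exact le_sup_left

/-- Composition of cochains with a map of spaces. -/
def cochainPullback {X Y : Type*} (f : X → Y) (q : ℕ) : Cochain Y q →ₗ[ZMod 2] Cochain X q where
  toFun φ := fun x => φ (fun i => f (x i))
  map_add' _ _ := rfl
  map_smul' _ _ := rfl

theorem cochainPullback_locallyZero {X Y : Type*} [TopologicalSpace X]
    [TopologicalSpace Y] {f : X → Y} (hf : Continuous f) {q : ℕ} {φ : Cochain Y q}
    (hφ : φ ∈ locallyZero Y q) : cochainPullback f q φ ∈ locallyZero X q := by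
  intro a
  obtain ⟨U, hU, h⟩ := hφ (f a)
  exact ⟨f ⁻¹' U, hf.continuousAt.preimage_mem_nhds hU, fun x hx => h _ hx⟩

theorem cochainPullback_coboundary {X Y : Type*} (f : X → Y) (q : ℕ) (φ : Cochain Y q) :
    coboundary X q (cochainPullback f q φ) = cochainPullback f (q + 1) (coboundary Y q φ) := rfl

theorem cochainPullback_cocycles {X Y : Type*} [TopologicalSpace X]
    [TopologicalSpace Y] {f : X → Y} (hf : Continuous f) {q : ℕ} {φ : Cochain Y q}
    (hφ : φ ∈ cocycles Y q) : cochainPullback f q φ ∈ cocycles X q :=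
  cochainPullback_locallyZero hf (q := q + 1) hφ

theorem cochainPullback_coboundaries {X Y : Type*} [TopologicalSpace X]
    [TopologicalSpace Y] {f : X → Y} (hf : Continuous f) {q : ℕ} {φ : Cochain Y q}
    (hφ : φ ∈ coboundaries Y q) : cochainPullback f q φ ∈ coboundaries X q := by
  cases q with
  | zero => exact cochainPullback_locallyZero hf hφ
  | succ q =>
    obtain ⟨a, ha, b, ⟨ψ, rfl⟩, rfl⟩ := Submodule.mem_sup.1 hφ
    rw [map_add]
    exact Submodule.add_mem_sup (cochainPullback_locallyZero hf ha)
      ⟨cochainPullback f q ψ, cochainPullback_coboundary f q ψ⟩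

/-- The homomorphism `f^* : H^q(Y; ℤ/2) → H^q(X; ℤ/2)` induced by a continuous map. -/
def pullback {X Y : Type*} [TopologicalSpace X] [TopologicalSpace Y] (f : X → Y) (hf : Continuous f) (q : ℕ) :
    Cohomology Y q →ₗ[ZMod 2] Cohomology X q :=
  Submodule.mapQ _ _
    ((cochainPullback f q).restrict fun _ hφ => cochainPullback_cocycles hf hφ)
    fun _ hφ => cochainPullback_coboundaries hf hφ

/-- The cup product with a `1`-cochain:
`(φ ∪ ψ)(x₀, …, x_{q+1}) = φ(x₀, …, x_q) ψ(x_q, x_{q+1})`. -/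
def cochainCup {X : Type*} {q : ℕ} (φ : Cochain X q) (ψ : Cochain X 1) : Cochain X (q + 1) :=
  fun x => φ (fun i => x i.castSucc) * ψ ![x (Fin.last q).castSucc, x (Fin.last (q + 1))]

theorem coboundary_cochainCup {X : Type*} {q : ℕ} (φ : Cochain X q) (ψ : Cochain X 1) :
    coboundary X (q + 1) (cochainCup φ ψ) =
      cochainCup (coboundary X q φ) ψ +
        fun x => φ (fun i => x i.castSucc.castSucc) *
          coboundary X 1 ψ ![x (Fin.last q).castSucc.castSucc, x (Fin.last (q + 1)).castSucc,
            x (Fin.last (q + 2))] := by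
  ext x
  have h2 : ∀ (m : ℕ) (k : Fin (m + 1)), k.castSucc.succAbove (Fin.last m) = Fin.last (m + 1) := by
    intro m k
    rw [Fin.succAbove_of_le_castSucc _ _ (Fin.castSucc_le_castSucc_iff.2 (Fin.le_last k)),
      Fin.succ_last]
  have e : ∀ a b c : Fin (q + 3),
      (fun j : Fin 2 => x (![a, b, c] (Fin.succAbove 0 j))) = ![x b, x c] ∧
      (fun j : Fin 2 => x (![a, b, c] (Fin.succAbove 1 j))) = ![x a, x c] ∧
      (fun j : Fin 2 => x (![a, b, c] (Fin.succAbove 2 j))) = ![x a, x b] := by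
    intro a b c
    refine ⟨?_, ?_, ?_⟩ <;> ext j <;> fin_cases j <;> rfl
  have e' : ∀ a b c : Fin (q + 3), coboundary X 1 ψ ![x a, x b, x c] =
      ψ ![x b, x c] + ψ ![x a, x c] + ψ ![x a, x b] := by
    intro a b c
    have : ![x a, x b, x c] = fun j => x (![a, b, c] j) := by
      ext j
      fin_cases j <;> rfl
    rw [this]
    refine (Fin.sum_univ_three fun i : Fin 3 => ψ fun j => x (![a, b, c] (i.succAbove j))).trans ?_
    rw [(e a b c).1, (e a b c).2.1, (e a b c).2.2]
  rw [Pi.add_apply, e']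
  simp only [coboundary, cochainCup, LinearMap.coe_mk, AddHom.coe_mk]
  rw [Fin.sum_univ_castSucc, Fin.sum_univ_castSucc, Fin.sum_univ_castSucc
    (f := fun i : Fin (q + 2) => φ fun j => x (i.succAbove j).castSucc)]
  simp only [Fin.castSucc_succAbove_castSucc, h2, Fin.succAbove_last, add_mul, Finset.sum_mul, mul_add]
  have h3 : ∀ a b c d : ZMod 2, a + b + c = a + d + (d + b + c) := by decide
  apply h3

theorem cochainCup_add_left {X : Type*} {q : ℕ} (φ φ' : Cochain X q) (ψ : Cochain X 1) :
    cochainCup (φ + φ') ψ = cochainCup φ ψ + cochainCup φ' ψ := by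
  ext x
  simp [cochainCup, add_mul]

theorem cochainCup_add_right {X : Type*} {q : ℕ} (φ : Cochain X q) (ψ ψ' : Cochain X 1) :
    cochainCup φ (ψ + ψ') = cochainCup φ ψ + cochainCup φ ψ' := by
  ext x
  simp [cochainCup, mul_add]

theorem cochainCup_locallyZero_left {X : Type*} [TopologicalSpace X] {q : ℕ} {φ : Cochain X q} (hφ : φ ∈ locallyZero X q)
    (ψ : Cochain X 1) : cochainCup φ ψ ∈ locallyZero X (q + 1) := by
  intro a
  obtain ⟨U, hU, h⟩ := hφ a
  exact ⟨U, hU, fun x hx => by simp [cochainCup, h _ fun i => hx i.castSucc]⟩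

theorem cochainCup_locallyZero_right {X : Type*} [TopologicalSpace X] {q : ℕ} (φ : Cochain X q) {ψ : Cochain X 1}
    (hψ : ψ ∈ locallyZero X 1) : cochainCup φ ψ ∈ locallyZero X (q + 1) := by
  intro a
  obtain ⟨U, hU, h⟩ := hψ a
  refine ⟨U, hU, fun x hx => ?_⟩
  have : ψ ![x (Fin.last q).castSucc, x (Fin.last (q + 1))] = 0 := by
    apply h
    intro i
    fin_cases i
    · exact hx _
    · exact hx _
  simp [cochainCup, this]

theorem cochainCup_coboundary_locallyZero {X : Type*} [TopologicalSpace X] {q : ℕ} (φ : Cochain X q) {ψ : Cochain X 1}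
    (hψ : ψ ∈ cocycles X 1) :
    (fun x : Fin (q + 3) → X => φ (fun i => x i.castSucc.castSucc) *
      coboundary X 1 ψ ![x (Fin.last q).castSucc.castSucc, x (Fin.last (q + 1)).castSucc,
        x (Fin.last (q + 2))]) ∈ locallyZero X (q + 2) := by
  intro a
  obtain ⟨U, hU, h⟩ := hψ a
  refine ⟨U, hU, fun x hx => ?_⟩
  have : coboundary X 1 ψ ![x (Fin.last q).castSucc.castSucc, x (Fin.last (q + 1)).castSucc,
        x (Fin.last (q + 2))] = 0 := by
    apply h
    intro i
    fin_cases i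
    · exact hx _
    · exact hx _
    · exact hx _
  simp [this]

theorem cochainCup_cocycles {X : Type*} [TopologicalSpace X] {q : ℕ} {φ : Cochain X q} {ψ : Cochain X 1}
    (hφ : φ ∈ cocycles X q) (hψ : ψ ∈ cocycles X 1) : cochainCup φ ψ ∈ cocycles X (q + 1) := by
  change coboundary X (q + 1) (cochainCup φ ψ) ∈ locallyZero X (q + 2)
  rw [coboundary_cochainCup]
  exact add_mem (cochainCup_locallyZero_left (q := q + 1) hφ ψ)
    (cochainCup_coboundary_locallyZero φ hψ)

theorem cochainCup_coboundaries_left {X : Type*} [TopologicalSpace X] {q : ℕ} {φ : Cochain X q} {ψ : Cochain X 1}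
    (hφ : φ ∈ coboundaries X q) (hψ : ψ ∈ cocycles X 1) :
    cochainCup φ ψ ∈ coboundaries X (q + 1) := by
  cases q with
  | zero => exact locallyZero_le_coboundaries _ (cochainCup_locallyZero_left hφ ψ)
  | succ q =>
    obtain ⟨a, ha, b, ⟨χ, rfl⟩, rfl⟩ := Submodule.mem_sup.1 hφ
    rw [cochainCup_add_left]
    refine add_mem (locallyZero_le_coboundaries _ (cochainCup_locallyZero_left ha ψ)) ?_
    rw [← add_sub_cancel_right (cochainCup (coboundary X q χ) ψ) _,
      ← coboundary_cochainCup χ ψ]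
    exact sub_mem (Submodule.mem_sup_right ⟨_, rfl⟩)
      (locallyZero_le_coboundaries _ (cochainCup_coboundary_locallyZero χ hψ))

theorem cochainCup_coboundaries_right {X : Type*} [TopologicalSpace X] {q : ℕ} {φ : Cochain X q} {ψ : Cochain X 1}
    (hφ : φ ∈ cocycles X q) (hψ : ψ ∈ coboundaries X 1) :
    cochainCup φ ψ ∈ coboundaries X (q + 1) := by
  obtain ⟨a, ha, b, ⟨χ, rfl⟩, rfl⟩ := Submodule.mem_sup.1 hψ
  rw [cochainCup_add_right]
  refine add_mem (locallyZero_le_coboundaries _ (cochainCup_locallyZero_right φ ha)) ?_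
  have key : cochainCup φ (coboundary X 0 χ) =
      coboundary X q (fun x => φ x * χ ![x (Fin.last q)]) +
        fun x => coboundary X q φ x * χ ![x (Fin.last (q + 1))] := by
    ext x
    have e1 : ∀ a b : X, coboundary X 0 χ ![a, b] = χ ![b] + χ ![a] := by
      intro a b
      refine (Fin.sum_univ_two fun i : Fin 2 => χ fun j => ![a, b] (i.succAbove j)).trans ?_
      congr 2
      funext j
      fin_cases j
      rfl
    have h2 : ∀ k : Fin (q + 1), k.castSucc.succAbove (Fin.last q) = Fin.last (q + 1) := by
      intro k
      rw [Fin.succAbove_of_le_castSucc _ _ (Fin.castSucc_le_castSucc_iff.2 (Fin.le_last k)),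
        Fin.succ_last]
    rw [Pi.add_apply, cochainCup, e1]
    simp only [coboundary, LinearMap.coe_mk, AddHom.coe_mk]
    rw [Fin.sum_univ_castSucc, Fin.sum_univ_castSucc
      (f := fun i : Fin (q + 2) => φ fun j => x (i.succAbove j))]
    simp only [h2, Fin.succAbove_last, add_mul, Finset.sum_mul, mul_add]
    have h3 : ∀ a b c : ZMod 2, a + b = c + b + (c + a) := by decide
    apply h3
  rw [key]
  refine add_mem (Submodule.mem_sup_right ⟨_, rfl⟩) (locallyZero_le_coboundaries _ ?_)
  intro a
  obtain ⟨U, hU, h⟩ := hφ a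
  exact ⟨U, hU, fun x hx => by simp [h x hx]⟩

/-- The cup product `H^q(X; ℤ/2) × H^1(X; ℤ/2) → H^{q+1}(X; ℤ/2)`. -/
def cup {X : Type*} [TopologicalSpace X] {q : ℕ} (a : Cohomology X q) (b : Cohomology X 1) : Cohomology X (q + 1) :=
  Quotient.map₂
    (fun (φ : cocycles X q) (ψ : cocycles X 1) =>
      (⟨cochainCup φ.1 ψ.1, cochainCup_cocycles φ.2 ψ.2⟩ : cocycles X (q + 1)))
    (by
      intro φ φ' hφ ψ ψ' hψ
      have h1 := (Submodule.quotientRel_def _).1 hφ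
      have h2 := (Submodule.quotientRel_def _).1 hψ
      refine (Submodule.quotientRel_def _).2 ?_
      change φ.1 - φ'.1 ∈ coboundaries X q at h1
      change ψ.1 - ψ'.1 ∈ coboundaries X 1 at h2
      change cochainCup φ.1 ψ.1 - cochainCup φ'.1 ψ'.1 ∈ coboundaries X (q + 1)
      have key := add_mem (cochainCup_coboundaries_left h1 ψ.2)
        (cochainCup_coboundaries_right φ'.2 h2)
      convert key using 1
      ext x
      simp only [cochainCup, Pi.sub_apply, Pi.add_apply]
      ring)
    a b

/-- The unit class in `H^0(X; ℤ/2)`. -/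
def unitClass (X : Type*) [TopologicalSpace X] : Cohomology X 0 :=
  Submodule.Quotient.mk ⟨fun _ => 1, fun _ => ⟨univ, univ_mem, fun _ _ => by
    simp [coboundary]; decide⟩⟩

/-- The cup powers `w ^ k ∈ H^k(X; ℤ/2)` of a class `w ∈ H^1(X; ℤ/2)`, with `w ^ 0 = 1`. -/
def cupPow {X : Type*} [TopologicalSpace X] (w : Cohomology X 1) : (k : ℕ) → Cohomology X k
  | 0 => unitClass X
  | k + 1 => cup (cupPow w k) w

/-! ### The cohomological index of symmetric sets -/

/-- For a subset `X` of a vector space `V` (through the inclusion `ι`): the relation identifying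
antipodal points. -/
def antipodal {X V : Type*} [InvolutiveNeg V] (ι : X → V) : Setoid X where
  r x y := ι y = ι x ∨ ι y = -ι x
  iseqv :=
    { refl := fun _ => Or.inl rfl
      symm := by
        rintro x y (h | h)
        · exact Or.inl h.symm
        · exact Or.inr (by rw [h, neg_neg])
      trans := by
        rintro x y z (h | h) (h' | h')
        · exact Or.inl (h'.trans h)
        · exact Or.inr (by rw [h', h])
        · exact Or.inr (by rw [h', h])
        · exact Or.inl (by rw [h', h, neg_neg]) }

/-- The orbit space `X / {x ∼ -x}`, with the quotient topology. -/
abbrev OrbitSpace {X V : Type*} [InvolutiveNeg V] (ι : X → V) : Type _ := Quotient (antipodal ι)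

/-- The infinite dimensional sphere `S^∞ = ⋃ₖ S^k`: finitely supported unit vectors. -/
def SphereInf : Type := {x : ℕ →₀ ℝ // x.sum (fun _ t => t ^ 2) = 1}

/-- The finitely supported sequence underlying a point of `S^∞`. -/
def SphereInf.coord (x : SphereInf) : ℕ →₀ ℝ := x.1

/-- The sphere `S^k ⊆ S^∞` of the vectors supported in the coordinates `0, …, k`. -/
def SphereInf.sphere (k : ℕ) : Set SphereInf := {x | ∀ i, k < i → x.coord i = 0}

/-- The direct limit topology: a set is open if and only if its trace on each `S^k` is open for
the usual topology of `S^k`, which is the one of coordinatewise convergence. -/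
instance : TopologicalSpace SphereInf :=
  ⨆ k : ℕ, TopologicalSpace.coinduced (Subtype.val : SphereInf.sphere k → SphereInf)
    (TopologicalSpace.induced (fun x i => x.1.coord i)
      (inferInstance : TopologicalSpace (ℕ → ℝ)))

/-- The infinite dimensional real projective space. -/
abbrev RPInf : Type := OrbitSpace SphereInf.coord

/-- The map of orbit spaces induced by an odd map `f : A → S^∞`. -/
def orbitMap {V : Type*} [InvolutiveNeg V] {A : Set V} (f : A → SphereInf)
    (hodd : ∀ x y : A, (y : V) = -(x : V) → (f y).coord = -(f x).coord) :
    OrbitSpace (Subtype.val : A → V) → RPInf :=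
  Quotient.map' f (by
    rintro x y (h | h)
    · exact Or.inl (congrArg (fun z => (f z).coord) (Subtype.ext h))
    · exact Or.inr (hodd x y h))

theorem continuous_orbitMap {V : Type*} [InvolutiveNeg V] [TopologicalSpace V] {A : Set V}
    (f : A → SphereInf) (hf : Continuous f)
    (hodd : ∀ x y : A, (y : V) = -(x : V) → (f y).coord = -(f x).coord) :
    Continuous (orbitMap f hodd) :=
  hf.quotient_map' _

open Classical in
/-- The cohomological index of a symmetric set `A`. If `0 ∈ A` it is infinite. Otherwise it is the
supremum of all `k + 1` such that the pullback to the orbit space of `A` of the `k`-th power of the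
generator `w` of `H^1(ℝP^∞; ℤ/2) = {0, w}` under an odd continuous map `A → S^∞` does not vanish
(these maps are all homotopic through odd maps, so the choice is immaterial). -/
def index {V : Type*} [AddCommGroup V] [TopologicalSpace V] (A : Set V) : ℕ∞ :=
  if (0 : V) ∈ A then ⊤ else
    ⨆ (k : ℕ) (_ : ∃ (f : A → SphereInf) (hf : Continuous f)
      (hodd : ∀ x y : A, (y : V) = -(x : V) → (f y).coord = -(f x).coord)
      (w : Cohomology RPInf 1), w ≠ 0 ∧
        pullback (orbitMap f hodd) (continuous_orbitMap f hf hodd) k (cupPow w k) ≠ 0),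
      ((k + 1 : ℕ) : ℕ∞)

/-! ### The Sobolev space `H^1` and the Allen-Cahn energy -/

/-- The Euclidean space `ℝ^d`. -/
abbrev Euc (d : ℕ) : Type := EuclideanSpace ℝ (Fin d)

theorem integrable_mul_test {d : ℕ} {Ω : Set (Euc d)} (u : Lp ℝ 2 (volume.restrict Ω))
    {ψ : Euc d → ℝ} (hψ : Continuous ψ) (hc : HasCompactSupport ψ) :
    Integrable (fun x => u x * ψ x) (volume.restrict Ω) :=
  (Lp.memLp u).integrable_mul (q := 2)
    (hψ.memLp_of_hasCompactSupport hc)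

theorem integrable_coord_mul_test {d : ℕ} {Ω : Set (Euc d)} (g : Lp (Euc d) 2 (volume.restrict Ω))
    (i : Fin d) {ψ : Euc d → ℝ} (hψ : Continuous ψ) (hc : HasCompactSupport ψ) :
    Integrable (fun x => g x i * ψ x) (volume.restrict Ω) :=
  ((EuclideanSpace.proj (𝕜 := ℝ) i).comp_memLp' (Lp.memLp g)).integrable_mul
    (q := 2)
    (hψ.memLp_of_hasCompactSupport hc)

/-- The Hilbert space `H^1(Ω)`, realised as the space of all pairs `(u, g)` of `u ∈ L²(Ω)` and
`g ∈ L²(Ω; ℝ^d)` such that `g` is the weak gradient of `u`. Its topology is the one induced by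
`L²(Ω) × L²(Ω; ℝ^d)`, that is, the topology of the norm of `H^1(Ω)`. -/
def H1 {d : ℕ} (Ω : Set (Euc d)) :
    Submodule ℝ (Lp ℝ 2 (volume.restrict Ω) × Lp (Euc d) 2 (volume.restrict Ω)) where
  carrier := {v | ∀ φ : Euc d → ℝ, ContDiff ℝ ∞ φ → HasCompactSupport φ → tsupport φ ⊆ Ω →
    ∀ i : Fin d, ∫ x in Ω, v.1 x * fderiv ℝ φ x (EuclideanSpace.single i 1) =
      -∫ x in Ω, v.2 x i * φ x}
  zero_mem' := by
    intro φ _ _ _ i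
    have h1 : (fun x => (0 : Lp ℝ 2 (volume.restrict Ω)) x *
        fderiv ℝ φ x (EuclideanSpace.single i 1)) =ᵐ[volume.restrict Ω] fun _ => 0 := by
      filter_upwards [Lp.coeFn_zero ℝ 2 (volume.restrict Ω)] with x hx
      rw [hx, Pi.zero_apply, zero_mul]
    have h2 : (fun x => (0 : Lp (Euc d) 2 (volume.restrict Ω)) x i * φ x)
        =ᵐ[volume.restrict Ω] fun _ => 0 := by
      filter_upwards [Lp.coeFn_zero (Euc d) 2 (volume.restrict Ω)] with x hx
      rw [hx, Pi.zero_apply, PiLp.zero_apply, zero_mul]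
    exact (integral_congr_ae h1).trans
      (by rw [Prod.snd_zero, integral_congr_ae h2, integral_zero, neg_zero])
  add_mem' := by
    intro v v' hv hv' φ h1 h2 h3 i
    have c1 : Continuous fun x => fderiv ℝ φ x (EuclideanSpace.single i 1) :=
      (h1.continuous_fderiv (by simp)).clm_apply continuous_const
    have s1 : HasCompactSupport fun x => fderiv ℝ φ x (EuclideanSpace.single i 1) :=
      h2.fderiv_apply ℝ _
    have e1 : (fun x => (v + v').1 x * fderiv ℝ φ x (EuclideanSpace.single i 1))
        =ᵐ[volume.restrict Ω] fun x => v.1 x * fderiv ℝ φ x (EuclideanSpace.single i 1) +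
          v'.1 x * fderiv ℝ φ x (EuclideanSpace.single i 1) := by
      filter_upwards [Lp.coeFn_add v.1 v'.1] with x hx
      rw [Prod.fst_add, hx, Pi.add_apply, add_mul]
    have e2 : (fun x => (v + v').2 x i * φ x) =ᵐ[volume.restrict Ω]
        fun x => v.2 x i * φ x + v'.2 x i * φ x := by
      filter_upwards [Lp.coeFn_add v.2 v'.2] with x hx
      rw [Prod.snd_add, hx, Pi.add_apply, PiLp.add_apply, add_mul]
    rw [integral_congr_ae e1, integral_congr_ae e2,
      integral_add (integrable_mul_test v.1 c1 s1) (integrable_mul_test v'.1 c1 s1),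
      integral_add (integrable_coord_mul_test v.2 i h1.continuous h2)
        (integrable_coord_mul_test v'.2 i h1.continuous h2),
      hv φ h1 h2 h3 i, hv' φ h1 h2 h3 i]
    ring
  smul_mem' := by
    intro c v hv φ h1 h2 h3 i
    have e1 : (fun x => (c • v).1 x * fderiv ℝ φ x (EuclideanSpace.single i 1))
        =ᵐ[volume.restrict Ω]
          fun x => c * (v.1 x * fderiv ℝ φ x (EuclideanSpace.single i 1)) := by
      filter_upwards [Lp.coeFn_smul c v.1] with x hx
      rw [Prod.smul_fst, hx, Pi.smul_apply, smul_eq_mul, mul_assoc]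
    have e2 : (fun x => (c • v).2 x i * φ x) =ᵐ[volume.restrict Ω]
        fun x => c * (v.2 x i * φ x) := by
      filter_upwards [Lp.coeFn_smul c v.2] with x hx
      rw [Prod.smul_snd, hx, Pi.smul_apply, PiLp.smul_apply, smul_eq_mul, mul_assoc]
    rw [integral_congr_ae e1, integral_congr_ae e2, integral_const_mul, integral_const_mul,
      hv φ h1 h2 h3 i]
    ring

/-- The energy `E_ε(u) = ∫_Ω ε |∇u|² / 2 + W(u) / ε`, which may be infinite. -/
def energy {d : ℕ} (W : ℝ → ℝ) (ε : ℝ) (Ω : Set (Euc d)) (v : H1 Ω) : ℝ≥0∞ :=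
  ∫⁻ x in Ω, ENNReal.ofReal (ε * ‖v.1.2 x‖ ^ 2 / 2 + W (v.1.1 x) / ε)

/-- The family `F_p(Ω)` of all compact symmetric subsets of `H^1(Ω)` of index at least `p + 1`. -/
def sweepouts {d : ℕ} (Ω : Set (Euc d)) (p : ℕ) : Set (Set (H1 Ω)) :=
  {A | IsCompact A ∧ (∀ v ∈ A, -v ∈ A) ∧ ((p + 1 : ℕ) : ℕ∞) ≤ index A}

/-- The min-max value `c_ε(p, Ω)`. -/
def minmax {d : ℕ} (W : ℝ → ℝ) (ε : ℝ) (p : ℕ) (Ω : Set (Euc d)) : ℝ≥0∞ :=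
  ⨅ A ∈ sweepouts Ω p, ⨆ v ∈ A, energy W ε Ω v

/-- The constant `σ = ∫_{-1}^1 √(W(t) / 2) dt`. -/
def sigma (W : ℝ → ℝ) : ℝ := ∫ t in (-1 : ℝ)..1, Real.sqrt (W t / 2)

/-- The phase transition spectrum `ℓ_p(Ω) = (2σ)⁻¹ liminf_{ε → 0⁺} c_ε(p, Ω)`. -/
def spectrum {d : ℕ} (W : ℝ → ℝ) (p : ℕ) (Ω : Set (Euc d)) : ℝ≥0∞ :=
  liminf (fun ε : ℝ => minmax W ε p Ω) (𝓝[>] 0) / ENNReal.ofReal (2 * sigma W)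

/-- Even nonnegative double-well potentials of class `C³` with wells at `±1`. -/
structure IsDoubleWell (W : ℝ → ℝ) : Prop where
  contDiff : ContDiff ℝ 3 W
  even : ∀ t, W (-t) = W t
  nonneg : ∀ t, 0 ≤ W t
  critical : ∀ t, deriv W t = 0 ↔ t = -1 ∨ t = 0 ∨ t = 1
  zero_left : W (-1) = 0
  zero_right : W 1 = 0
  nondegenerate_left : 0 < deriv (deriv W) (-1)
  nondegenerate_right : 0 < deriv (deriv W) 1
  isLocalMax : IsLocalMax W 0

/-- `Ω` is a bounded Lipschitz domain (not necessarily connected): a bounded open set which near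
each boundary point is, in suitable Cartesian coordinates, the region strictly above the graph of a
Lipschitz function. Here `v` is the unit vector in the vertical direction, and
`y - ⟪v, y⟫ v` is the horizontal part of `y`. -/
structure IsLipschitzDomain {d : ℕ} (Ω : Set (Euc d)) : Prop where
  isOpen : IsOpen Ω
  isBounded : Bornology.IsBounded Ω
  boundary : ∀ x ∈ frontier Ω, ∃ (v : Euc d) (K : ℝ≥0) (h : Euc d → ℝ),
    ‖v‖ = 1 ∧ LipschitzWith K h ∧
      ∀ᶠ y in 𝓝 x, y ∈ Ω ↔ h (y - inner ℝ v y • v) < inner ℝ v y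

end

end AllenCahn

/-!
# The Weyl law for the phase transition spectrum

The proof compares a domain with cubes. Two properties of the min-max values `minmax W ε p Ω` are
behind it: they are superadditive, and on the unit cube they are of order `p ^ (1 / (n + 1))`.

*The index.* All that is used about the cohomological index is `succ_le_index_iff`: a compact
symmetric set `A` without the origin has index at least `m + 1` if and only if the `m`-th power of
the characteristic class of the double covering of `A / {x ∼ -x}` does not vanish. The vanishing is
expressed by `PowVanishes` in terms of cochains on `A` itself: with a function `s` such that
`s (-x) = s x + 1`, the power `(δs)ᵐ` is, on small simplices, the coboundary of an invariant
cochain. In the infinite projective space this requires that the nonzero classes of degree one are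
exactly those of the covering by the sphere, which is shown by contracting the infinite sphere. The
three facts needed are then elementary: naturality `PowVanishes.of_map`; subadditivity
`PowVanishes.union`, where the cup product of primitives on `A` and on `B` is a primitive on
`A ∪ B`; and the Borsuk-Ulam property `not_powVanishes_of_l1Sphere`, where `(δs)ᵐ` is evaluated on a
hemisphere.

*Superadditivity.* If disjoint similar copies of domains `Ω' i` lie in `Ω`, then restriction of
functions gives odd maps of Sobolev spaces, and the energies of the restrictions add up to at most
the energy in `Ω`. A sweepout of index `∑ p i + 1` is not covered by the closed sets, of index at
most `p i`, of functions whose `i`-th restriction has energy below its min-max value. So it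
contains a function of energy at least the sum of the min-max values (`sum_minmax_le`). Scaling by
`t` multiplies the energy by `t ^ n` and changes `ε`; the latter disappears in the lower limit
`limMinmax`.

*Growth on the cube.* For an upper bound, cut the unit cube into `k ^ n` columns, place them one
after the other along the real line, and take the signs of all nonzero polynomials of degree at most
`k ^ (n + 1)` of the position along this line. A mollification at scale `ε` makes them an odd
continuous family over a sphere of dimension `k ^ (n + 1)`, of energy `O(k)`: the roots contribute
`k ^ (n + 1)` interfaces of area `k ^ (-n)`, and the walls of the columns contribute `O(k)`
(`exists_minmax_unitCube_le`). For a positive lower bound, every sweepout of index at least two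
contains a function whose truncation has mean value zero on a ball. Either its values are far from
the wells on a large part of the ball, or a Poincaré inequality bounds its energy from below
(`exists_le_minmax_unitCube`).

*Conclusion.* Dividing the cube into `k ^ (n + 1)` cubes, superadditivity implies as for Fekete's
lemma that `p ^ (-1 / (n + 1)) * limMinmax W p` converges on the unit cube to its supremum, which is
positive and finite (`exists_tendsto_of_mul_le`). Filling `Ω` with small cubes gives the lower bound
for the lower limit on `Ω`. For the upper limit, fill the complement of a similar copy of `Ω` in the
unit cube with small cubes: the values on `Ω` are at most what the cubes leave over from the values
on the unit cube. Nothing is lost since the boundary of `Ω` is a null set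
(`IsLipschitzDomain.volume_frontier`).
-/

namespace AllenCahn

noncomputable section

/-! ### Cochains as functions of lists of points -/

/-- The coboundary of a mod-two cochain which is given as a function of finite lists of points:
the sum of the values on all lists with one entry removed. The recursion splits off the first
entry. -/
def listCobd {E : Type*} : (List E → ZMod 2) → List E → ZMod 2
  | _, [] => 0
  | φ, x :: l => φ l + listCobd (fun m => φ (x :: m)) l

/-- The `k`-th cup power, on lists of length `k + 1`, of the coboundary of a `0`-cochain `s`. -/
def cobdPow {E : Type*} (s : E → ZMod 2) : List E → ZMod 2
  | x :: y :: l => (s x + s y) * cobdPow s (y :: l)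
  | _ => 1

section ListCochains

variable {E F : Type*}

theorem zmod_two_add_self (a : ZMod 2) : a + a = 0 := CharTwo.add_self_eq_zero a

theorem listCobd_add (φ ψ : List E → ZMod 2) (l : List E) :
    listCobd (fun m => φ m + ψ m) l = listCobd φ l + listCobd ψ l := by
  induction l generalizing φ ψ with
  | nil => simp [listCobd]
  | cons x l ih => simp only [listCobd, ih]; ring

theorem listCobd_const_mul (c : ZMod 2) (φ : List E → ZMod 2) (l : List E) :
    listCobd (fun m => c * φ m) l = c * listCobd φ l := by
  induction l generalizing φ with
  | nil => simp [listCobd]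
  | cons x l ih => simp only [listCobd, ih]; ring

theorem listCobd_zero (l : List E) : listCobd (fun _ => 0) l = 0 := by
  induction l with
  | nil => rfl
  | cons x l ih => simpa [listCobd] using ih

theorem listCobd_sum {ι : Type*} (t : Finset ι) (φ : ι → List E → ZMod 2) (l : List E) :
    listCobd (fun m => ∑ i ∈ t, φ i m) l = ∑ i ∈ t, listCobd (φ i) l := by
  classical
  induction t using Finset.induction_on with
  | empty => simpa using listCobd_zero l
  | insert a t ha ih =>
    simp only [Finset.sum_insert ha]
    rw [listCobd_add, ih]

theorem listCobd_listCobd (φ : List E → ZMod 2) (l : List E) : listCobd (listCobd φ) l = 0 := by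
  induction l generalizing φ with
  | nil => rfl
  | cons x l ih =>
    simp only [listCobd]
    rw [listCobd_add, ih, add_zero, zmod_two_add_self]

theorem listCobd_map (f : E → F) (φ : List F → ZMod 2) (l : List E) :
    listCobd φ (l.map f) = listCobd (fun m => φ (m.map f)) l := by
  induction l generalizing φ with
  | nil => rfl
  | cons x l ih => simp only [List.map_cons, listCobd, ih]

/-- The coboundary of `φ` at `l` only involves the values of `φ` on shorter sublists of `l`. -/
theorem listCobd_congr {φ ψ : List E → ZMod 2} {l : List E}
    (h : ∀ m, m.length + 1 = l.length → (∀ x ∈ m, x ∈ l) → φ m = ψ m) :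
    listCobd φ l = listCobd ψ l := by
  induction l generalizing φ ψ with
  | nil => rfl
  | cons x l ih =>
    simp only [listCobd]
    rw [h l (by simp) fun y hy => List.mem_cons_of_mem _ hy, ih]
    intro m hm hm'
    refine h _ (by simp [hm]) ?_
    intro y hy
    rcases List.mem_cons.1 hy with rfl | hy
    · exact List.mem_cons_self
    · exact List.mem_cons_of_mem _ (hm' y hy)

theorem cobdPow_map (f : E → F) (s : F → ZMod 2) (l : List E) :
    cobdPow s (l.map f) = cobdPow (s ∘ f) l := by
  match l with
  | [] => rfl
  | [x] => rfl
  | x :: y :: l =>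
    have := cobdPow_map f s (y :: l)
    simp only [List.map_cons, cobdPow, Function.comp] at this ⊢
    rw [this]

theorem cobdPow_congr {s t : E → ZMod 2} {l : List E} {c : ZMod 2}
    (h : ∀ x ∈ l, s x = t x + c) : cobdPow s l = cobdPow t l := by
  match l with
  | [] => rfl
  | [x] => rfl
  | x :: y :: l =>
    have := cobdPow_congr (l := y :: l) (s := s) (t := t) fun z hz =>
      h z (List.mem_cons_of_mem _ hz)
    simp only [cobdPow, this]
    rw [h x (by simp), h y (by simp)]
    have : ∀ a b c d : ZMod 2, (a + c + (b + c)) * d = (a + b) * d := by decide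
    apply this

theorem listCobd_cobdPow (s : E → ZMod 2) (x y : E) (l : List E) :
    listCobd (cobdPow s) (x :: y :: l) = 0 := by
  induction l generalizing x y with
  | nil => simp [listCobd, cobdPow, zmod_two_add_self]
  | cons z l ih =>
    have h1 := ih y z
    simp only [listCobd, cobdPow] at h1 ⊢
    rw [listCobd_const_mul] at h1
    simp only [listCobd_const_mul]
    generalize cobdPow s (z :: l) = A at *
    generalize cobdPow s (y :: l) = D at *
    generalize listCobd (fun m => cobdPow s (z :: m)) l = B at *
    generalize s x = a at *
    generalize s y = b at *
    generalize s z = c at *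
    revert h1
    clear ih
    revert A B D a b c
    decide

/-- The power `(δs) ^ (k + 1)` is the coboundary of `s ∪ (δs) ^ k`. -/
theorem cobdPow_eq_listCobd (s : E → ZMod 2) (x y : E) (l : List E) :
    cobdPow s (x :: y :: l) =
      listCobd (fun m => (m.head?.elim 0 s) * cobdPow s m) (x :: y :: l) := by
  have h := listCobd_cobdPow s x y l
  rw [listCobd] at h ⊢
  simp only [List.head?_cons, Option.elim_some, listCobd_const_mul, cobdPow]
  generalize cobdPow s (y :: l) = A at *
  generalize listCobd (fun m => cobdPow s (x :: m)) (y :: l) = B at *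
  generalize s x = a at *
  generalize s y = b at *
  revert h
  revert A B a b
  decide

/-- The cup product `φ ∪ χ` of an `a`-cochain `φ` with `χ`. -/
def listCup : ℕ → (List E → ZMod 2) → (List E → ZMod 2) → List E → ZMod 2
  | 0, φ, χ, l => φ (l.take 1) * χ l
  | _ + 1, _, _, [] => 0
  | a + 1, φ, χ, x :: l => listCup a (fun m => φ (x :: m)) χ l

theorem listCup_add_left (a : ℕ) (φ φ' χ : List E → ZMod 2) (l : List E) :
    listCup a (fun m => φ m + φ' m) χ l = listCup a φ χ l + listCup a φ' χ l := by
  induction a generalizing φ φ' l with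
  | zero => simp only [listCup]; ring
  | succ a ih =>
    cases l with
    | nil => simp [listCup]
    | cons x l => simp only [listCup, ih]

/-- The cup product as a product of values on a front and a back list. -/
theorem listCup_eq (a : ℕ) (φ χ : List E → ZMod 2) {l : List E} (hl : a < l.length) :
    listCup a φ χ l = φ (l.take (a + 1)) * χ (l.drop a) := by
  induction a generalizing φ l with
  | zero => rfl
  | succ a ih =>
    cases l with
    | nil => simp at hl
    | cons x l =>
      have : a < l.length := by simpa using hl
      simp only [listCup, ih _ this, List.take_succ_cons, List.drop_succ_cons]

/-- The Leibniz rule. -/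
theorem listCobd_listCup (a : ℕ) (φ χ : List E → ZMod 2) {l : List E} (hl : a + 2 ≤ l.length) :
    listCobd (listCup a φ χ) l =
      listCup (a + 1) (listCobd φ) χ l + listCup a φ (listCobd χ) l := by
  induction a generalizing φ l with
  | zero =>
    match l, hl with
    | x :: y :: l, _ =>
      simp only [listCup, listCobd, List.take_succ_cons, List.take_zero]
      simp only [listCobd_const_mul]
      generalize φ [x] = a
      generalize φ [y] = b
      generalize χ (y :: l) = c
      generalize χ (x :: l) = d
      generalize listCobd (fun m => χ (x :: y :: m)) l = e
      revert a b c d e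
      decide
  | succ a ih =>
    match l, hl with
    | x :: l, hl =>
      have hl' : a + 2 ≤ l.length := by simpa using hl
      simp only [listCobd, listCup]
      rw [ih _ hl']
      have : ∀ χ, listCup (a + 1) φ χ l + listCup (a + 1) (listCobd fun m => φ (x :: m)) χ l =
        listCup (a + 1) (fun m => φ m + listCobd (fun m => φ (x :: m)) m) χ l := fun χ => by
          rw [listCup_add_left]
      rw [← add_assoc, this]

theorem listCup_cobdPow (s : E → ZMod 2) (a : ℕ) {l : List E} (hl : a < l.length) :
    listCup a (cobdPow s) (cobdPow s) l = cobdPow s l := by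
  rw [listCup_eq a _ _ hl]
  induction a generalizing l with
  | zero =>
    match l, hl with
    | x :: l, _ => simp [cobdPow]
  | succ a ih =>
    match l, hl with
    | x :: y :: l, hl =>
      have := @ih (y :: l) (by simpa using hl)
      simp only [List.take_succ_cons, List.drop_succ_cons, cobdPow] at this ⊢
      rw [mul_assoc, this]

/-- The prism operator of two maps `f` and `g`. -/
def prism (f g : E → F) : (List F → ZMod 2) → List E → ZMod 2
  | _, [] => 0
  | φ, x :: l => φ (f x :: g x :: l.map g) + prism f g (fun m => φ (f x :: m)) l

theorem prism_add (f g : E → F) (φ ψ : List F → ZMod 2) (l : List E) :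
    prism f g (fun m => φ m + ψ m) l = prism f g φ l + prism f g ψ l := by
  induction l generalizing φ ψ with
  | nil => simp [prism]
  | cons x l ih => simp only [prism, ih]; ring

/-- The prism operator is a chain homotopy between the pull-backs by `f` and `g`. -/
theorem listCobd_prism (f g : E → F) (φ : List F → ZMod 2) (l : List E) :
    listCobd (prism f g φ) l + prism f g (listCobd φ) l = φ (l.map f) + φ (l.map g) := by
  induction l generalizing φ with
  | nil => simp [prism, listCobd, zmod_two_add_self]
  | cons x l ih =>
    have h := ih fun m => φ (f x :: m)
    simp only [prism, listCobd, List.map_cons, listCobd_add, prism_add, listCobd_map] at h ⊢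
    generalize prism f g φ l = A at *
    generalize listCobd (fun m => φ (f x :: g x :: m.map g)) l = B at *
    generalize listCobd (prism f g fun m => φ (f x :: m)) l = C at *
    generalize prism f g (listCobd fun m => φ (f x :: m)) l = D at *
    generalize φ (f x :: l.map g) = G at *
    generalize φ (f x :: l.map f) = H at *
    generalize φ (g x :: l.map g) = I at *
    clear ih
    have h' : C = H + G + D := by
      rw [← h, add_assoc, zmod_two_add_self, add_zero]
    subst h'
    clear h
    have e : A + (B + (H + G + D)) + (I + (G + B) + (A + D)) =
      (A + A) + (B + B) + (G + G) + (D + D) + (H + I) := by ring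
    rw [e]
    simp only [zmod_two_add_self, zero_add]

theorem prism_congr {f g : E → F} {φ : List F → ZMod 2} {l : List E}
    (h : ∀ m, m.length = l.length + 1 → (∀ y ∈ m, ∃ x ∈ l, y = f x ∨ y = g x) → φ m = 0) :
    prism f g φ l = 0 := by
  induction l generalizing φ with
  | nil => rfl
  | cons x l ih =>
    rw [prism, ih, h _ (by simp), add_zero]
    · intro y hy
      simp only [List.mem_cons, List.mem_map] at hy
      rcases hy with rfl | rfl | ⟨z, hz, rfl⟩
      · exact ⟨x, by simp, Or.inl rfl⟩
      · exact ⟨x, by simp, Or.inr rfl⟩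
      · exact ⟨z, by simp [hz], Or.inr rfl⟩
    · intro m hm hm'
      refine h _ (by simp [hm]) fun y hy => ?_
      rcases List.mem_cons.1 hy with rfl | hy
      · exact ⟨x, by simp, Or.inl rfl⟩
      · obtain ⟨z, hz, hz'⟩ := hm' y hy
        exact ⟨z, by simp [hz], hz'⟩

end ListCochains

/-! ### Vanishing of the powers of the characteristic class of a symmetric set -/

/-- The statement that the `k`-th power of the characteristic class of the double covering
`A → A / {x ∼ -x}` vanishes, in terms of cochains on `A` itself: a function `s` with
`s (-x) = s x + 1` is a (discontinuous) section, `δs` descends to the orbit space and represents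
the class, and `ψ` is a primitive of its power which is invariant under `x ↦ -x`. The identity is
only required on small lists, with a uniform smallness `δ`. For `k = 0` the class is the unit. -/
def PowVanishes {E : Type*} [NormedAddCommGroup E] (A : Set E) : ℕ → Prop
  | 0 => A = ∅
  | k + 1 => ∃ δ > 0, ∃ (s : E → ZMod 2) (ψ : List E → ZMod 2), (∀ x ∈ A, s (-x) = s x + 1) ∧
      (∀ l : List E, l.length = k + 1 → (∀ x ∈ l, x ∈ A) → ψ (l.map (-·)) = ψ l) ∧
      ∀ l : List E, l.length = k + 2 → (∀ x ∈ l, x ∈ A) → (∀ x ∈ l, ∀ y ∈ l, dist x y < δ) →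
        cobdPow s l = listCobd ψ l

section Vanishing

variable {E F : Type*} [NormedAddCommGroup E] [NormedAddCommGroup F]

theorem zmod_two_eq_of_add_eq_zero {a b : ZMod 2} (h : a + b = 0) : a = b := by
  revert a b; decide

theorem cobdPow_map_neg {A : Set E} {s : E → ZMod 2} (hs : ∀ x ∈ A, s (-x) = s x + 1)
    {l : List E} (hl : ∀ x ∈ l, x ∈ A) : cobdPow s (l.map (-·)) = cobdPow s l := by
  rw [cobdPow_map]
  exact cobdPow_congr (c := 1) fun x hx => hs x (hl x hx)

/-- Monotonicity in the exponent: multiply the primitive by `δs`. -/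
theorem PowVanishes.succ {A : Set E} {k : ℕ} (h : PowVanishes A k) : PowVanishes A (k + 1) := by
  cases k with
  | zero =>
    refine ⟨1, one_pos, fun _ => 0, fun _ => 0, ?_, fun _ _ _ => rfl, ?_⟩
    · intro x hx
      rw [show A = ∅ from h] at hx
      exact hx.elim
    · intro l hl hA
      match l, hl with
      | x :: l, _ =>
        have := hA x List.mem_cons_self
        rw [show A = ∅ from h] at this
        exact this.elim
  | succ k =>
    obtain ⟨δ, hδ, s, ψ, hs, hψ, h⟩ := h
    refine ⟨δ, hδ, s, listCup k ψ (cobdPow s), hs, ?_, ?_⟩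
    · intro l hl hA
      rw [listCup_eq _ _ _ (by simp [hl]), listCup_eq _ _ _ (by omega), ← List.map_take,
        ← List.map_drop, hψ, cobdPow_map_neg hs]
      · exact fun x hx => hA x (List.mem_of_mem_drop hx)
      · simp [hl]
      · exact fun x hx => hA x (List.mem_of_mem_take hx)
    · intro l hl hA hd
      rw [listCobd_listCup _ _ _ (by omega), listCup_eq (k + 1) _ _ (by omega),
        listCup_eq k _ _ (by omega), ← h]
      · have : listCobd (cobdPow s) (l.drop k) = 0 := by
          have h3 : (l.drop k).length = 3 := by simp; omega
          match l.drop k, h3 with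
          | [x, y, z], _ => exact listCobd_cobdPow s x y [z]
        rw [this, mul_zero, add_zero, ← listCup_cobdPow s (k + 1) (by omega),
          listCup_eq _ _ _ (by omega)]
      · simp; omega
      · exact fun x hx => hA x (List.mem_of_mem_take hx)
      · exact fun x hx y hy => hd x (List.mem_of_mem_take hx) y (List.mem_of_mem_take hy)

theorem PowVanishes.mono {A : Set E} {j k : ℕ} (hjk : j ≤ k) (h : PowVanishes A j) :
    PowVanishes A k := by
  induction k, hjk using Nat.le_induction with
  | base => exact h
  | succ k _ ih => exact ih.succ

/-- The powers of `δs` and `δt` for two sections `s` and `t` are cohomologous as invariant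
cochains. -/
theorem exists_cobdPow_add_eq_listCobd {A : Set E} {s t : E → ZMod 2}
    (hs : ∀ x ∈ A, s (-x) = s x + 1) (ht : ∀ x ∈ A, t (-x) = t x + 1) (k : ℕ) :
    ∃ β : List E → ZMod 2,
      (∀ l : List E, l.length = k + 1 → (∀ x ∈ l, x ∈ A) → β (l.map (-·)) = β l) ∧
      ∀ l : List E, l.length = k + 2 → (∀ x ∈ l, x ∈ A) →
        cobdPow s l + cobdPow t l = listCobd β l := by
  induction k with
  | zero =>
    refine ⟨fun l => l.head?.elim 0 fun x => s x + t x, ?_, ?_⟩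
    · intro l hl h
      match l, hl with
      | [x], _ =>
        simp only [List.map_cons, List.head?_cons, Option.elim_some]
        rw [hs x (h x (by simp)), ht x (h x (by simp))]
        generalize s x = a
        generalize t x = b
        revert a b; decide
    · intro l hl h
      match l, hl with
      | [x, y], _ =>
        simp only [cobdPow, listCobd, List.head?_cons, Option.elim_some]
        ring
  | succ k ih =>
    obtain ⟨β, hβ, h⟩ := ih
    -- if `(δs)ᵏ⁺¹ + (δt)ᵏ⁺¹ = δβ`, the primitive of the next power is
    -- `(s + t) ∪ (δs)ᵏ⁺¹ + δt ∪ β`; the sum `s + t` is invariant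
    refine ⟨fun l => listCup 0 (fun l => l.head?.elim 0 fun x => s x + t x) (cobdPow s) l +
      listCup 1 (cobdPow t) β l, ?_, ?_⟩
    · intro l hl hlA
      match l, hl with
      | x :: y :: l, hl =>
        have hxy : ∀ z ∈ y :: l, z ∈ A := fun z hz => hlA z (List.mem_cons_of_mem _ hz)
        have e1 := cobdPow_map_neg hs hlA
        have e2 := hβ (y :: l) (by simpa using hl) hxy
        have e3 := hs x (hlA x (by simp))
        have e4 := ht x (hlA x (by simp))
        have e5 := ht y (hlA y (by simp))
        rw [List.map_cons, List.map_cons] at e1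
        rw [List.map_cons] at e2
        simp only [listCup, List.map_cons, List.take_succ_cons, List.take_zero, List.head?_cons,
          Option.elim_some]
        rw [e1, e2, e3, e4]
        simp only [cobdPow]
        rw [e4, e5]
        generalize s x = a
        generalize t x = b
        generalize t y = c
        generalize β (y :: l) = d
        generalize cobdPow s (y :: l) = e
        generalize s y = f
        revert a b c d e f; decide
    · intro l hl hlA
      rw [listCobd_add, listCobd_listCup _ _ _ (by omega), listCobd_listCup _ _ _ (by omega)]
      match l, hl with
      | x :: y :: z :: l, hl =>
        have hxy : ∀ z' ∈ y :: z :: l, z' ∈ A := fun z hz => hlA z (List.mem_cons_of_mem _ hz)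
        have e2 := h (y :: z :: l) (by simpa using hl) hxy
        have e3 := listCobd_cobdPow t x y [z]
        have e4 := listCobd_cobdPow s x y (z :: l)
        rw [listCup_eq 2 _ _ (by simp)]
        simp only [listCup, List.take_succ_cons, List.take_zero,
          e3, e4, ← e2]
        have e5 : listCobd (fun l => l.head?.elim 0 fun x => s x + t x) [x, y] =
          s x + t x + (s y + t y) := by
          simp only [listCobd, List.head?_cons, Option.elim_some]
          ring
        rw [e5]
        simp only [cobdPow]
        generalize s x = a1
        generalize t x = a2
        generalize s y = a3
        generalize t y = a4
        generalize s z = a5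
        generalize t z = a6
        generalize cobdPow s (z :: l) = a7
        generalize cobdPow t (z :: l) = a8
        have : ∀ u v u' v' p q : ZMod 2, (u + v) * p + (u' + v') * q =
          (u + u' + (v + v')) * p + 0 + (0 + ((u' + v') * 1) * (p + q)) := by decide
        rw [zero_mul, mul_zero]
        apply this

/-- In the definition of `PowVanishes` every section is as good as any other. -/
theorem PowVanishes.exists_primitive {A : Set E} {k : ℕ}
    (h : PowVanishes A (k + 1)) {s : E → ZMod 2} (hs : ∀ x ∈ A, s (-x) = s x + 1) :
    ∃ δ > 0, ∃ ψ : List E → ZMod 2,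
      (∀ l : List E, l.length = k + 1 → (∀ x ∈ l, x ∈ A) → ψ (l.map (-·)) = ψ l) ∧
      ∀ l : List E, l.length = k + 2 → (∀ x ∈ l, x ∈ A) → (∀ x ∈ l, ∀ y ∈ l, dist x y < δ) →
        cobdPow s l = listCobd ψ l := by
  obtain ⟨δ, hδ, t, ψ, ht, hψ, h⟩ := h
  obtain ⟨β, hβ, h'⟩ := exists_cobdPow_add_eq_listCobd hs ht k
  refine ⟨δ, hδ, fun l => β l + ψ l, fun l hl hlA => by
    simp only [hβ l hl hlA, hψ l hl hlA], ?_⟩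
  intro l hl hlA hd
  rw [listCobd_add, ← h l hl hlA hd, ← h' l hl hlA, add_assoc, zmod_two_add_self, add_zero]

open Classical in
theorem exists_odd_section (E : Type*) [NormedAddCommGroup E] [NormedSpace ℝ E] :
    ∃ s : E → ZMod 2, ∀ x, x ≠ 0 → s (-x) = s x + 1 := by
  refine ⟨fun x => if WellOrderingRel x (-x) then 1 else 0, fun x hx => ?_⟩
  have hne : x ≠ -x := fun h => by
    have h2 : (2 : ℝ) • x = 0 := by
      rw [two_smul]
      nth_rewrite 2 [h]
      exact add_neg_cancel x
    exact hx ((smul_eq_zero.1 h2).resolve_left two_ne_zero)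
  simp only [neg_neg]
  rcases trichotomous_of WellOrderingRel x (-x) with h | h | h
  · rw [if_pos h, if_neg (asymm h)]
    decide
  · exact (hne h).elim
  · rw [if_pos h, if_neg (asymm h)]
    decide

/-- Naturality: the index does not decrease under odd continuous maps. -/
theorem PowVanishes.of_map {A : Set E} {B : Set F} (hA : IsCompact A) {g : E → F}
    (hg : ContinuousOn g A) (hodd : ∀ x ∈ A, g (-x) = -g x) (hAB : MapsTo g A B) {k : ℕ}
    (h : PowVanishes B k) : PowVanishes A k := by
  cases k with
  | zero =>
    refine eq_empty_of_forall_notMem fun x hx => ?_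
    have := hAB hx
    rw [show B = ∅ from h] at this
    exact this
  | succ k =>
    obtain ⟨δ, hδ, s, ψ, hs, hψ, h⟩ := h
    obtain ⟨η, hη, hgη⟩ := Metric.uniformContinuousOn_iff.1
      (hA.uniformContinuousOn_of_continuous hg) δ hδ
    refine ⟨η, hη, s ∘ g, fun l => ψ (l.map g), ?_, ?_, ?_⟩
    · intro x hx
      simp only [Function.comp, hodd x hx, hs _ (hAB hx)]
    · intro l hl hlA
      have : (l.map (-·)).map g = (l.map g).map (-·) := by
        rw [List.map_map, List.map_map]
        exact List.map_congr_left fun x hx => hodd x (hlA x hx)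
      simp only [this]
      rw [hψ _ (by simpa using hl)]
      intro y hy
      obtain ⟨x, hx, rfl⟩ := List.mem_map.1 hy
      exact hAB (hlA x hx)
    · intro l hl hlA hd
      rw [← listCobd_map, ← cobdPow_map]
      refine h _ (by simpa using hl) ?_ ?_
      · intro y hy
        obtain ⟨x, hx, rfl⟩ := List.mem_map.1 hy
        exact hAB (hlA x hx)
      · intro y hy y' hy'
        obtain ⟨x, hx, rfl⟩ := List.mem_map.1 hy
        obtain ⟨x', hx', rfl⟩ := List.mem_map.1 hy'
        exact hgη x (hlA x hx) x' (hlA x' hx') (hd x hx x' hx')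

/-- Tautness: the power also vanishes on a neighbourhood. A discontinuous odd retraction which
moves points by a small amount only is enough to transport cochains. -/
theorem PowVanishes.thickening [NormedSpace ℝ E] {A : Set E} (hA : ∀ x ∈ A, -x ∈ A)
    (hc : IsClosed A) (h0 : (0 : E) ∉ A) {k : ℕ} (h : PowVanishes A (k + 1)) :
    ∃ η > 0, (0 : E) ∉ Metric.thickening η A ∧ PowVanishes (Metric.thickening η A) (k + 1) := by
  obtain ⟨δ, hδ, s, ψ, hs, hψ, h⟩ := h
  obtain ⟨r, hr, hr'⟩ := Metric.isOpen_iff.1 hc.isOpen_compl 0 h0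
  set η := min r (δ / 3)
  have hη : 0 < η := lt_min hr (by positivity)
  have h0η : (0 : E) ∉ Metric.thickening η A := by
    intro h
    obtain ⟨z, hz, hz'⟩ := Metric.mem_thickening_iff.1 h
    refine hr' (Metric.mem_ball.2 ?_) hz
    rw [dist_comm]
    exact hz'.trans_le (min_le_left _ _)
  refine ⟨η, hη, h0η, ?_⟩
  obtain ⟨t, ht⟩ := exists_odd_section E
  have hsel : ∀ x : E, ∃ y : E, x ∈ Metric.thickening η A → y ∈ A ∧ dist x y < η := by
    intro x
    by_cases hx : x ∈ Metric.thickening η A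
    · obtain ⟨y, hy, hy'⟩ := Metric.mem_thickening_iff.1 hx
      exact ⟨y, fun _ => ⟨hy, hy'⟩⟩
    · exact ⟨0, fun h => (hx h).elim⟩
  choose q hq using hsel
  have hneg : ∀ x ∈ Metric.thickening η A, -x ∈ Metric.thickening η A := by
    intro x hx
    obtain ⟨y, hy, hy'⟩ := Metric.mem_thickening_iff.1 hx
    exact Metric.mem_thickening_iff.2 ⟨-y, hA y hy, by rwa [dist_neg_neg]⟩
  -- choosing a nearby point on one point of each antipodal pair only makes the retraction odd
  let ρ : E → E := fun x => if t x = 0 then q x else -q (-x)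
  have hρ : ∀ x ∈ Metric.thickening η A, ρ x ∈ A ∧ dist x (ρ x) < η := by
    intro x hx
    simp only [ρ]
    split_ifs
    · exact hq x hx
    · have := hq (-x) (hneg x hx)
      refine ⟨hA _ this.1, ?_⟩
      rw [← dist_neg_neg, neg_neg]
      exact this.2
  have hρodd : ∀ x ∈ Metric.thickening η A, ρ (-x) = -ρ x := by
    intro x hx
    have hx0 : x ≠ 0 := fun h => h0η (h ▸ hx)
    simp only [ρ, ht x hx0, neg_neg]
    have : ∀ a : ZMod 2, (a + 1 = 0) ↔ ¬ (a = 0) := by decide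
    by_cases h : t x = 0
    · rw [if_pos h, if_neg (by rw [this]; exact not_not.2 h)]
    · rw [if_neg h, if_pos ((this _).2 h), neg_neg]
  refine ⟨η, hη, s ∘ ρ, fun l => ψ (l.map ρ), ?_, ?_, ?_⟩
  · intro x hx
    simp only [Function.comp, hρodd x hx, hs _ (hρ x hx).1]
  · intro l hl hlA
    have : (l.map (-·)).map ρ = (l.map ρ).map (-·) := by
      rw [List.map_map, List.map_map]
      exact List.map_congr_left fun x hx => hρodd x (hlA x hx)
    simp only [this]
    rw [hψ _ (by simpa using hl)]
    intro y hy
    obtain ⟨x, hx, rfl⟩ := List.mem_map.1 hy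
    exact (hρ x (hlA x hx)).1
  · intro l hl hlA hd
    rw [← listCobd_map, ← cobdPow_map]
    refine h _ (by simpa using hl) ?_ ?_
    · intro y hy
      obtain ⟨x, hx, rfl⟩ := List.mem_map.1 hy
      exact (hρ x (hlA x hx)).1
    · intro y hy y' hy'
      obtain ⟨x, hx, rfl⟩ := List.mem_map.1 hy
      obtain ⟨x', hx', rfl⟩ := List.mem_map.1 hy'
      have h1 := (hρ x (hlA x hx)).2
      have h2 := (hρ x' (hlA x' hx')).2
      have h3 := hd x hx x' hx'
      have h4 : η ≤ δ / 3 := min_le_right _ _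
      have h5 := dist_triangle4 (ρ x) x x' (ρ x')
      rw [dist_comm (ρ x) x] at h5
      linarith

/-- Subadditivity of the index: the product of two classes which vanish on `A` and on `B`
vanishes on `A ∪ B`. -/
theorem PowVanishes.union [NormedSpace ℝ E] {A B : Set E} (hA : ∀ x ∈ A, -x ∈ A)
    (hB : ∀ x ∈ B, -x ∈ B) (hAc : IsClosed A) (hBc : IsClosed B) (hA0 : (0 : E) ∉ A)
    (hB0 : (0 : E) ∉ B) {p q : ℕ} (hp : PowVanishes A p) (hq : PowVanishes B q) :
    PowVanishes (A ∪ B) (p + q) := by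
  rcases p with _ | p
  · rw [show A = ∅ from hp, empty_union, zero_add]
    exact hq
  rcases q with _ | q
  · rw [show B = ∅ from hq, union_empty, add_zero]
    exact hp
  obtain ⟨s, hs⟩ := exists_odd_section E
  obtain ⟨η₁, hη₁, h01, h1⟩ := hp.thickening hA hAc hA0
  obtain ⟨η₂, hη₂, h02, h2⟩ := hq.thickening hB hBc hB0
  have hneg : ∀ (η : ℝ) (A : Set E), (∀ x ∈ A, -x ∈ A) →
      ∀ x ∈ Metric.thickening η A, -x ∈ Metric.thickening η A := by
    intro η A hA x hx
    obtain ⟨y, hy, hy'⟩ := Metric.mem_thickening_iff.1 hx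
    exact Metric.mem_thickening_iff.2 ⟨-y, hA y hy, by rwa [dist_neg_neg]⟩
  obtain ⟨δ₁, hδ₁, ψ₁, hψ₁, h1⟩ := h1.exists_primitive
    (fun x hx => hs x fun h => h01 (h ▸ hx))
  obtain ⟨δ₂, hδ₂, ψ₂, hψ₂, h2⟩ := h2.exists_primitive
    (fun x hx => hs x fun h => h02 (h ▸ hx))
  -- outside the thickenings the primitives are irrelevant, so they may be made invariant there
  classical
  let χ₁ : List E → ZMod 2 := fun l => if ∀ x ∈ l, x ∈ Metric.thickening η₁ A then ψ₁ l else 0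
  let χ₂ : List E → ZMod 2 := fun l => if ∀ x ∈ l, x ∈ Metric.thickening η₂ B then ψ₂ l else 0
  have hmap : ∀ (η : ℝ) (A : Set E), (∀ x ∈ A, -x ∈ A) → ∀ l : List E,
      (∀ x ∈ l.map (-·), x ∈ Metric.thickening η A) ↔ ∀ x ∈ l, x ∈ Metric.thickening η A := by
    intro η A hA l
    simp only [List.forall_mem_map]
    refine ⟨fun h x hx => ?_, fun h x hx => hneg η A hA x (h x hx)⟩
    have := hneg η A hA _ (h x hx)
    rwa [neg_neg] at this
  have hχ₁ : ∀ l : List E, l.length = p + 1 → χ₁ (l.map (-·)) = χ₁ l := by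
    intro l hl
    simp only [χ₁, hmap η₁ A hA]
    split_ifs with h
    · exact hψ₁ l hl h
    · rfl
  have hχ₂ : ∀ l : List E, l.length = q + 1 → χ₂ (l.map (-·)) = χ₂ l := by
    intro l hl
    simp only [χ₂, hmap η₂ B hB]
    split_ifs with h
    · exact hψ₂ l hl h
    · rfl
  have hcobd : ∀ l : List E, (∀ x ∈ l, x ∈ Metric.thickening η₁ A) →
      listCobd χ₁ l = listCobd ψ₁ l := fun l hl => listCobd_congr fun m _ hm =>
        if_pos fun x hx => hl x (hm x hx)
  have hcobd' : ∀ l : List E, (∀ x ∈ l, x ∈ Metric.thickening η₂ B) →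
      listCobd χ₂ l = listCobd ψ₂ l := fun l hl => listCobd_congr fun m _ hm =>
        if_pos fun x hx => hl x (hm x hx)
  have hs' : ∀ x ∈ A ∪ B, s (-x) = s x + 1 := by
    rintro x (hx | hx)
    · exact hs x fun h => hA0 (h ▸ hx)
    · exact hs x fun h => hB0 (h ▸ hx)
  rw [show p + 1 + (q + 1) = (p + q + 1) + 1 by ring]
  have hcm : ∀ (φ : List E → ZMod 2) (l : List E),
      listCobd φ (l.map (-·)) = listCobd (fun m => φ (m.map (-·))) l :=
    fun φ l => listCobd_map _ φ l
  -- with `P = (δs) ^ (p + 1)` and `Q = (δs) ^ (q + 1)`, the coboundary of the primitive below is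
  -- `P ∪ δχ₂ + δχ₁ ∪ Q + δχ₁ ∪ δχ₂`, which equals `P ∪ Q` wherever `P = δχ₁` or `Q = δχ₂`
  refine ⟨min (min δ₁ δ₂) (min η₁ η₂), by positivity, s,
    fun l => listCup (p + 1) (cobdPow s) χ₂ l + listCup p χ₁ (cobdPow s) l +
      listCup p χ₁ (listCobd χ₂) l, hs', ?_, ?_⟩
  · intro l hl hlA
    simp only
    rw [listCup_eq _ _ _ (by simp; omega), listCup_eq _ _ _ (by simp; omega),
      listCup_eq _ _ _ (by simp; omega), listCup_eq _ _ _ (by omega), listCup_eq _ _ _ (by omega),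
      listCup_eq _ _ _ (by omega), ← List.map_take, ← List.map_take, ← List.map_drop,
      ← List.map_drop, hχ₁ _ (by simp; omega), hχ₂ _ (by simp; omega),
      cobdPow_map_neg hs' fun x hx => hlA x (List.mem_of_mem_take hx),
      cobdPow_map_neg hs' fun x hx => hlA x (List.mem_of_mem_drop hx), hcm]
    congr 2
    refine listCobd_congr fun m hm _ => hχ₂ m ?_
    simp at hm
    omega
  · intro l hl hlA hd
    rw [listCobd_add, listCobd_add, listCobd_listCup _ _ _ (by omega),
      listCobd_listCup _ _ _ (by omega), listCobd_listCup _ _ _ (by omega)]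
    have z1 : listCup (p + 1 + 1) (listCobd (cobdPow s)) χ₂ l = 0 := by
      rw [listCup_eq _ _ _ (by omega)]
      have : listCobd (cobdPow s) (l.take (p + 1 + 1 + 1)) = 0 := by
        match l, hl with
        | x :: y :: l, _ => exact listCobd_cobdPow s x y _
      rw [this, zero_mul]
    have z2 : listCup p χ₁ (listCobd (cobdPow s)) l = 0 := by
      rw [listCup_eq _ _ _ (by omega)]
      have : listCobd (cobdPow s) (l.drop p) = 0 := by
        have h3 : 2 ≤ (l.drop p).length := by simp; omega
        match l.drop p, h3 with
        | x :: y :: l, _ => exact listCobd_cobdPow s x y _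
      rw [this, mul_zero]
    have z3 : listCup p χ₁ (listCobd (listCobd χ₂)) l = 0 := by
      rw [listCup_eq _ _ _ (by omega), listCobd_listCobd, mul_zero]
    rw [z1, z2, z3, zero_add, add_zero, add_zero, ← listCup_cobdPow s (p + 1) (by omega),
      listCup_eq _ _ _ (by omega), listCup_eq _ _ _ (by omega), listCup_eq _ _ _ (by omega),
      listCup_eq _ _ _ (by omega)]
    have hsub1 : ∀ x ∈ l.take (p + 1 + 1), x ∈ l := fun x hx => List.mem_of_mem_take hx
    have hsub2 : ∀ x ∈ l.drop (p + 1), x ∈ l := fun x hx => List.mem_of_mem_drop hx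
    have hd1 : ∀ x ∈ l, ∀ y ∈ l, dist x y < δ₁ := fun x hx y hy =>
      (hd x hx y hy).trans_le ((min_le_left _ _).trans (min_le_left _ _))
    have hd2 : ∀ x ∈ l, ∀ y ∈ l, dist x y < δ₂ := fun x hx y hy =>
      (hd x hx y hy).trans_le ((min_le_left _ _).trans (min_le_right _ _))
    have hd3 : ∀ x ∈ l, ∀ y ∈ l, dist x y < η₁ := fun x hx y hy =>
      (hd x hx y hy).trans_le ((min_le_right _ _).trans (min_le_left _ _))
    have hd4 : ∀ x ∈ l, ∀ y ∈ l, dist x y < η₂ := fun x hx y hy =>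
      (hd x hx y hy).trans_le ((min_le_right _ _).trans (min_le_right _ _))
    -- the list is contained in one of the two neighbourhoods
    obtain ⟨z, hz⟩ : ∃ z, z ∈ l := List.exists_mem_of_length_pos (by omega)
    rcases hlA z hz with hzA | hzB
    · have key : cobdPow s (l.take (p + 1 + 1)) = listCobd χ₁ (l.take (p + 1 + 1)) := by
        have hin : ∀ x ∈ l.take (p + 1 + 1), x ∈ Metric.thickening η₁ A := fun x hx =>
          Metric.mem_thickening_iff.2 ⟨z, hzA, hd3 x (hsub1 x hx) z hz⟩
        rw [hcobd _ hin]
        exact h1 _ (by simp; omega) hin fun x hx y hy => hd1 x (hsub1 x hx) y (hsub1 y hy)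
      rw [key]
      have : ∀ a b c : ZMod 2, a * b = a * c + a * b + a * c := by decide
      apply this
    · have key : cobdPow s (l.drop (p + 1)) = listCobd χ₂ (l.drop (p + 1)) := by
        have hin : ∀ x ∈ l.drop (p + 1), x ∈ Metric.thickening η₂ B := fun x hx =>
          Metric.mem_thickening_iff.2 ⟨z, hzB, hd4 x (hsub2 x hx) z hz⟩
        rw [hcobd' _ hin]
        exact h2 _ (by simp; omega) hin fun x hx y hy => hd2 x (hsub2 x hx) y (hsub2 y hy)
      rw [key]
      have : ∀ a b c : ZMod 2, a * b = a * b + c * b + c * b := by decide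
      apply this

end Vanishing

/-! ### Non-vanishing on images of spheres -/

section Spheres

variable {V : Type*} [AddCommGroup V] [Module ℝ V]

/-- The contraction to the point `p` along straight segments. -/
def segmentMap (p : V) (t : ℝ) (x : V) : V := (1 - t) • x + t • p

/-- The operator on cochains dual to the one which sweeps out the cone with vertex `p` over a chain,
in `M` steps so that small simplices stay small. -/
def coneOp (M : ℕ) (p : V) (φ : List V → ZMod 2) (l : List V) : ZMod 2 :=
  ∑ i ∈ Finset.range M, prism (segmentMap p (i / M)) (segmentMap p ((i + 1 : ℕ) / M)) φ l

/-- Evaluation on a `j`-chain `c j` (a hemisphere of dimension `j`), defined by recursion: `c 0` is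
the point `e 0`, and `c (j + 1)` is the cone with vertex `e (j + 1)` over the cycle
`c j + (-1)_* c j`. Hence `∂ (c (j + 1)) = c j + (-1)_* c j`. -/
def hemisphereEval (M : ℕ) (e : ℕ → V) : ℕ → (List V → ZMod 2) → ZMod 2
  | 0, φ => φ [e 0]
  | j + 1, φ => hemisphereEval M e j (coneOp M (e (j + 1)) φ) +
      hemisphereEval M e j fun l => coneOp M (e (j + 1)) φ (l.map (-·))

theorem listCobd_coneOp {M : ℕ} (hM : M ≠ 0) (p : V) (φ : List V → ZMod 2) (l : List V) :
    listCobd (coneOp M p φ) l + coneOp M p (listCobd φ) l = φ l + φ (l.map fun _ => p) := by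
  have key : ∀ m : ℕ, listCobd (fun l => ∑ i ∈ Finset.range m,
      prism (segmentMap p (i / M)) (segmentMap p ((i + 1 : ℕ) / M)) φ l) l +
      ∑ i ∈ Finset.range m,
        prism (segmentMap p (i / M)) (segmentMap p ((i + 1 : ℕ) / M)) (listCobd φ) l =
      φ (l.map (segmentMap p ((0 : ℕ) / M))) + φ (l.map (segmentMap p (m / M))) := by
    intro m
    rw [listCobd_sum, ← Finset.sum_add_distrib]
    simp only [listCobd_prism]
    induction m with
    | zero => simp [zmod_two_add_self]
    | succ m ih =>
      rw [Finset.sum_range_succ, ih]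
      generalize φ (l.map (segmentMap p (m / M))) = a
      generalize φ (l.map (segmentMap p ((m + 1 : ℕ) / M))) = b
      generalize φ (l.map (segmentMap p ((0 : ℕ) / M))) = c
      revert a b c; decide
  have h0 : segmentMap p ((0 : ℕ) / (M : ℝ)) = id := by
    funext x
    simp [segmentMap]
  have h1 : segmentMap p ((M : ℝ) / (M : ℝ)) = fun _ => p := by
    funext x
    rw [div_self (by exact_mod_cast hM)]
    simp [segmentMap]
  have := key M
  rw [h0, h1, List.map_id] at this
  exact this

theorem coneOp_add (M : ℕ) (p : V) (φ ψ : List V → ZMod 2) (l : List V) :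
    coneOp M p (fun m => φ m + ψ m) l = coneOp M p φ l + coneOp M p ψ l := by
  simp only [coneOp, prism_add, Finset.sum_add_distrib]

theorem hemisphereEval_add (M : ℕ) (e : ℕ → V) (j : ℕ) (φ ψ : List V → ZMod 2) :
    hemisphereEval M e j (fun l => φ l + ψ l) =
      hemisphereEval M e j φ + hemisphereEval M e j ψ := by
  induction j generalizing φ ψ with
  | zero => rfl
  | succ j ih =>
    have : coneOp M (e (j + 1)) (fun l => φ l + ψ l) = fun l =>
      coneOp M (e (j + 1)) φ l + coneOp M (e (j + 1)) ψ l := funext fun l => coneOp_add _ _ _ _ _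
    simp only [hemisphereEval]
    rw [this]
    simp only [ih]
    ring

/-- The boundary of a hemisphere consists of two antipodal hemispheres. -/
theorem hemisphereEval_listCobd {M : ℕ} (hM : M ≠ 0) (e : ℕ → V) (j : ℕ) (ψ : List V → ZMod 2) :
    hemisphereEval M e (j + 1) (listCobd ψ) =
      hemisphereEval M e j ψ + hemisphereEval M e j fun l => ψ (l.map (-·)) := by
  have hz : ∀ χ : List V → ZMod 2, hemisphereEval M e j (listCobd χ) +
      hemisphereEval M e j (fun l => listCobd χ (l.map (-·))) = 0 := by
    intro χ
    have h2 : (fun l : List V => listCobd χ (l.map (-·))) =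
        listCobd fun l => χ (l.map (-·)) := funext fun l => listCobd_map _ _ _
    rw [h2]
    cases j with
    | zero => simp [hemisphereEval, listCobd, zmod_two_add_self]
    | succ j =>
      rw [hemisphereEval_listCobd hM, hemisphereEval_listCobd hM]
      have h3 : (fun l : List V => χ ((l.map (-·)).map (-·))) = χ := by
        funext l
        simp
      rw [h3, add_comm (hemisphereEval M e j fun l => χ (l.map (-·))), zmod_two_add_self]
  set p := e (j + 1) with hp
  have hc : coneOp M p (listCobd ψ) = fun l =>
      listCobd (coneOp M p ψ) l + (ψ l + ψ (l.map fun _ => p)) := by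
    funext l
    rw [← listCobd_coneOp hM p ψ l, ← add_assoc, zmod_two_add_self, zero_add]
  rw [hemisphereEval, ← hp, hc]
  simp only [hemisphereEval_add]
  have h1 := hz (coneOp M p ψ)
  have hmm : ∀ l : List V, (l.map (-·)).map (fun _ => p) = l.map fun _ => p := fun l => by
    rw [List.map_map]
    rfl
  simp only [hmm]
  generalize hemisphereEval M e j (listCobd (coneOp M p ψ)) = a at *
  generalize hemisphereEval M e j (fun l => listCobd (coneOp M p ψ) (l.map (-·))) = b at *
  generalize (hemisphereEval M e j fun l => ψ (l.map fun _ => p)) = c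
  generalize hemisphereEval M e j ψ = d
  generalize (hemisphereEval M e j fun l => ψ (l.map (-·))) = f
  revert h1
  clear * -
  revert a b c d f
  decide

end Spheres

/-- The unit sphere of the `ℓ¹` norm. -/
def l1Sphere (N : ℕ) : Set (Fin (N + 1) → ℝ) := {x | ∑ i, |x i| = 1}

theorem isCompact_l1Sphere (N : ℕ) : IsCompact (l1Sphere N) := by
  refine Metric.isCompact_of_isClosed_isBounded ?_ ?_
  · exact isClosed_eq (by fun_prop) continuous_const
  · refine (Metric.isBounded_closedBall (x := (0 : Fin (N + 1) → ℝ)) (r := 1)).subset ?_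
    intro x hx
    rw [mem_closedBall_zero_iff, pi_norm_le_iff_of_nonneg zero_le_one]
    intro i
    rw [Real.norm_eq_abs, ← show ∑ i, |x i| = 1 from hx]
    exact Finset.single_le_sum (f := fun i => |x i|) (fun i _ => abs_nonneg _) (Finset.mem_univ i)

theorem neg_mem_l1Sphere {N : ℕ} {x : Fin (N + 1) → ℝ} (hx : x ∈ l1Sphere N) : -x ∈ l1Sphere N := by
  simpa [l1Sphere] using hx

theorem zero_notMem_l1Sphere (N : ℕ) : (0 : Fin (N + 1) → ℝ) ∉ l1Sphere N := by
  simp [l1Sphere]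

theorem norm_le_one_of_mem_l1Sphere {N : ℕ} {x : Fin (N + 1) → ℝ} (hx : x ∈ l1Sphere N) :
    ‖x‖ ≤ 1 := by
  rw [pi_norm_le_iff_of_nonneg zero_le_one]
  intro i
  rw [Real.norm_eq_abs, ← show ∑ i, |x i| = 1 from hx]
  exact Finset.single_le_sum (f := fun i => |x i|) (fun i _ => abs_nonneg _) (Finset.mem_univ i)

/-- The `j`-th unit vector (zero if `j > N`). -/
def l1Vertex (N : ℕ) (j : ℕ) : Fin (N + 1) → ℝ := fun i => if (i : ℕ) = j then 1 else 0

/-- The `j`-dimensional great subsphere. -/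
def l1Subsphere (N j : ℕ) : Set (Fin (N + 1) → ℝ) :=
  {x | x ∈ l1Sphere N ∧ ∀ i : Fin (N + 1), j < i → x i = 0}

theorem l1Vertex_mem {N j : ℕ} (hj : j ≤ N) : l1Vertex N j ∈ l1Subsphere N j := by
  refine ⟨?_, fun i hi => if_neg hi.ne'⟩
  have : ∀ i : Fin (N + 1), |l1Vertex N j i| = if i = ⟨j, by omega⟩ then 1 else 0 := by
    intro i
    simp only [l1Vertex, Fin.ext_iff]
    split_ifs <;> simp
  simp [l1Sphere, this]

theorem segmentMap_mem {N j : ℕ} (hj : j + 1 ≤ N) {t : ℝ} (h0 : 0 ≤ t) (h1 : t ≤ 1)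
    {x : Fin (N + 1) → ℝ} (hx : x ∈ l1Subsphere N j) :
    segmentMap (l1Vertex N (j + 1)) t x ∈ l1Subsphere N (j + 1) := by
  have hv := l1Vertex_mem hj
  constructor
  · have hx1 : ∑ i, |x i| = 1 := hx.1
    have hv1 : ∑ i, |l1Vertex N (j + 1) i| = 1 := hv.1
    have : ∀ i, |segmentMap (l1Vertex N (j + 1)) t x i| =
        (1 - t) * |x i| + t * |l1Vertex N (j + 1) i| := by
      intro i
      simp only [segmentMap, Pi.add_apply, Pi.smul_apply, smul_eq_mul]
      rcases Nat.lt_or_ge j i with h | h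
      · rw [hx.2 i h]
        simp [abs_mul, abs_of_nonneg h0]
      · have : l1Vertex N (j + 1) i = 0 := if_neg (by omega)
        rw [this]
        simp [abs_mul, abs_of_nonneg (sub_nonneg.2 h1)]
    change ∑ i, |_| = 1
    simp only [this, Finset.sum_add_distrib, ← Finset.mul_sum, hx1, hv1]
    ring
  · intro i hi
    simp [segmentMap, hx.2 i (by omega), hv.2 i hi]

theorem dist_segmentMap_le {N j : ℕ} (hj : j + 1 ≤ N) {t t' : ℝ} (h0 : 0 ≤ t) (h1 : t ≤ 1)
    {x y : Fin (N + 1) → ℝ} (hy : y ∈ l1Subsphere N j) :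
    dist (segmentMap (l1Vertex N (j + 1)) t x) (segmentMap (l1Vertex N (j + 1)) t' y) ≤
      dist x y + 2 * |t - t'| := by
  have hv := norm_le_one_of_mem_l1Sphere (l1Vertex_mem hj).1
  have hy' := norm_le_one_of_mem_l1Sphere hy.1
  set v := l1Vertex N (j + 1)
  have : segmentMap v t x - segmentMap v t' y =
      (1 - t) • (x - y) + ((t' - t) • y + (t - t') • v) := by
    simp only [segmentMap]
    module
  rw [dist_eq_norm, dist_eq_norm, this]
  refine (norm_add_le _ _).trans (add_le_add ?_ ((norm_add_le _ _).trans ?_))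
  · rw [norm_smul, Real.norm_eq_abs, abs_of_nonneg (sub_nonneg.2 h1)]
    exact mul_le_of_le_one_left (norm_nonneg _) (by linarith)
  · rw [norm_smul, norm_smul, Real.norm_eq_abs, Real.norm_eq_abs, abs_sub_comm t' t]
    nlinarith [abs_nonneg (t - t')]

/-- The simplices of the hemispheres have small diameter. -/
theorem hemisphereEval_eq_zero {N M : ℕ} (hM : M ≠ 0) {j : ℕ} (hj : j ≤ N)
    {φ : List (Fin (N + 1) → ℝ) → ZMod 2}
    (h : ∀ l : List (Fin (N + 1) → ℝ), l.length = j + 1 → (∀ x ∈ l, x ∈ l1Subsphere N j) →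
      (∀ x ∈ l, ∀ y ∈ l, dist x y ≤ j * (2 / M)) → φ l = 0) :
    hemisphereEval M (l1Vertex N) j φ = 0 := by
  have hM' : (0 : ℝ) < M := by positivity
  induction j generalizing φ with
  | zero =>
    refine h _ rfl ?_ ?_
    · intro x hx
      rw [List.mem_singleton.1 hx]
      exact l1Vertex_mem hj
    · intro x hx y hy
      rw [List.mem_singleton.1 hx, List.mem_singleton.1 hy]
      simp
  | succ j ih =>
    have key : ∀ l : List (Fin (N + 1) → ℝ), l.length = j + 1 → (∀ x ∈ l, x ∈ l1Subsphere N j) →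
        (∀ x ∈ l, ∀ y ∈ l, dist x y ≤ j * (2 / M)) → coneOp M (l1Vertex N (j + 1)) φ l = 0 := by
      intro l hl hlA hd
      refine Finset.sum_eq_zero fun i hi => prism_congr fun m hm hm' => ?_
      have hi' : (i : ℝ) + 1 ≤ M := by exact_mod_cast Finset.mem_range.1 hi
      have hsel : ∀ y ∈ m, ∃ x ∈ l, ∃ t : ℝ, (0 ≤ t ∧ t ≤ 1) ∧ (i / M ≤ t ∧ t ≤ (i + 1) / M) ∧
          y = segmentMap (l1Vertex N (j + 1)) t x := by
        intro y hy
        have a1 : (0 : ℝ) ≤ i / M := by positivity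
        have a2 : ((i : ℝ) + 1) / M ≤ 1 := (div_le_one hM').2 hi'
        have a3 : (i : ℝ) / M ≤ (i + 1) / M := by gcongr; linarith
        obtain ⟨x, hx, hxy | hxy⟩ := hm' y hy
        · exact ⟨x, hx, _, ⟨a1, a3.trans a2⟩, ⟨le_rfl, a3⟩, hxy⟩
        · push_cast at hxy
          exact ⟨x, hx, _, ⟨a1.trans a3, a2⟩, ⟨a3, le_rfl⟩, hxy⟩
      refine h m (by omega) ?_ ?_
      · intro y hy
        obtain ⟨x, hx, t, ht, _, rfl⟩ := hsel y hy
        exact segmentMap_mem hj ht.1 ht.2 (hlA x hx)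
      · intro y hy y' hy'
        obtain ⟨x, hx, t, ht, hti, rfl⟩ := hsel y hy
        obtain ⟨x', hx', t', ht', hti', rfl⟩ := hsel y' hy'
        refine (dist_segmentMap_le hj ht.1 ht.2 (hlA x' hx')).trans ?_
        have h1 := hd x hx x' hx'
        have h2 : |t - t'| ≤ 1 / M := by
          have : ((i : ℝ) + 1) / M = i / M + 1 / M := add_div _ _ _
          rw [abs_le]
          constructor <;> linarith [hti.1, hti.2, hti'.1, hti'.2]
        push_cast
        have : ((j : ℝ) + 1) * (2 / M) = j * (2 / M) + 2 * (1 / M) := by ring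
        linarith
    rw [hemisphereEval, ih (by omega) key, zero_add]
    refine ih (by omega) fun l hl hlA hd => key _ (by simpa using hl) ?_ ?_
    · intro y hy
      obtain ⟨x, hx, rfl⟩ := List.mem_map.1 hy
      refine ⟨neg_mem_l1Sphere (hlA x hx).1, fun i hi => ?_⟩
      rw [Pi.neg_apply, (hlA x hx).2 i hi, neg_zero]
    · intro y hy y' hy'
      obtain ⟨x, hx, rfl⟩ := List.mem_map.1 hy
      obtain ⟨x', hx', rfl⟩ := List.mem_map.1 hy'
      rw [dist_neg_neg]
      exact hd x hx x' hx'

/-- The Borsuk-Ulam theorem in cohomological form: a symmetric set which receives an odd map from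
the `N`-sphere has non-vanishing `N`-th power of its characteristic class. The power `(δs) ^ N`
takes the value `1` on the `N`-dimensional hemisphere, while coboundaries of invariant cochains
vanish on it. -/
theorem not_powVanishes_of_l1Sphere {E : Type*} [NormedAddCommGroup E] {A : Set E} {N : ℕ}
    {g : (Fin (N + 1) → ℝ) → E} (hg : ContinuousOn g (l1Sphere N))
    (hodd : ∀ x ∈ l1Sphere N, g (-x) = -g x) (hgA : MapsTo g (l1Sphere N) A) :
    ¬ PowVanishes A N := by
  intro hA
  have hX : PowVanishes (l1Sphere N) N := hA.of_map (isCompact_l1Sphere N) hg hodd hgA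
  rcases N with _ | N
  · have := (l1Vertex_mem (le_refl 0)).1
    rw [show l1Sphere 0 = ∅ from hX] at this
    exact this
  obtain ⟨δ, hδ, s, ψ, hs, hψ, h⟩ := hX
  obtain ⟨M, hM⟩ := exists_nat_gt (((N + 1 : ℕ) : ℝ) * 2 / δ)
  have hM0 : (0 : ℝ) < M := lt_of_le_of_lt (by positivity) hM
  have hM' : M ≠ 0 := by
    rintro rfl
    simp at hM0
  have hsmall : ((N + 1 : ℕ) : ℝ) * (2 / M) < δ := by
    rw [div_lt_iff₀ hδ] at hM
    rw [← mul_div_assoc, div_lt_iff₀ hM0]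
    linarith
  have hcongr : ∀ {j : ℕ}, j ≤ N + 1 → ∀ {φ χ : List (Fin (N + 1 + 1) → ℝ) → ZMod 2},
      (∀ l : List (Fin (N + 1 + 1) → ℝ), l.length = j + 1 → (∀ x ∈ l, x ∈ l1Sphere (N + 1)) →
      (∀ x ∈ l, ∀ y ∈ l, dist x y ≤ j * (2 / M)) → φ l = χ l) →
      hemisphereEval M (l1Vertex (N + 1)) j φ = hemisphereEval M (l1Vertex (N + 1)) j χ := by
    intro j hj φ χ hφχ
    refine zmod_two_eq_of_add_eq_zero ?_
    rw [← hemisphereEval_add]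
    refine hemisphereEval_eq_zero hM' hj fun l hl hlA hd => ?_
    rw [hφχ l hl (fun x hx => (hlA x hx).1) hd, zmod_two_add_self]
  -- by induction on the dimension: `(δs) ^ (j + 1) = δ (s ∪ (δs) ^ j)`, and on the boundary of the
  -- hemisphere, which consists of two antipodal ones, the two values of `s` differ by one
  have hone : ∀ j ≤ N + 1, hemisphereEval M (l1Vertex (N + 1)) j (cobdPow s) = 1 := by
    intro j
    induction j with
    | zero => exact fun _ => rfl
    | succ j ih =>
      intro hj
      have e1 : hemisphereEval M (l1Vertex (N + 1)) (j + 1) (cobdPow s) =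
          hemisphereEval M (l1Vertex (N + 1)) (j + 1)
            (listCobd fun m => (m.head?.elim 0 s) * cobdPow s m) := by
        refine hcongr hj fun l hl _ _ => ?_
        match l, hl with
        | x :: y :: l, _ => exact cobdPow_eq_listCobd s x y l
      rw [e1, hemisphereEval_listCobd hM', ← hemisphereEval_add, ← ih (by omega)]
      refine hcongr (by omega) fun l hl hlA _ => ?_
      rw [cobdPow_map_neg hs hlA]
      match l, hl with
      | x :: l, _ =>
        simp only [List.map_cons, List.head?_cons, Option.elim_some]
        rw [hs x (hlA x (by simp))]
        generalize s x = a
        generalize cobdPow s (x :: l) = b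
        revert a b; decide
  have hzero : hemisphereEval M (l1Vertex (N + 1)) (N + 1) (cobdPow s) = 0 := by
    have e1 : hemisphereEval M (l1Vertex (N + 1)) (N + 1) (cobdPow s) =
        hemisphereEval M (l1Vertex (N + 1)) (N + 1) (listCobd ψ) :=
      hcongr le_rfl fun l hl hlA hd =>
        h l hl hlA fun x hx y hy => (hd x hx y hy).trans_lt hsmall
    rw [e1, hemisphereEval_listCobd hM', hcongr (by omega) fun l hl hlA _ => hψ l hl hlA,
      zmod_two_add_self]
  rw [hone _ le_rfl] at hzero
  exact one_ne_zero hzero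

/-! ### The infinite dimensional sphere -/

namespace SphereInf

/-- The sphere `S^k`, with the topology of coordinatewise convergence. -/
def FinSphere (k : ℕ) : Type := SphereInf.sphere k

instance (k : ℕ) : TopologicalSpace (FinSphere k) :=
  TopologicalSpace.induced (fun x i => x.1.coord i) (inferInstance : TopologicalSpace (ℕ → ℝ))

/-- The inclusion `S^k → S^∞`. -/
def FinSphere.incl (k : ℕ) (x : FinSphere k) : SphereInf := x.1

theorem FinSphere.continuous_incl (k : ℕ) : Continuous (FinSphere.incl k) :=
  continuous_iSup_rng (i := k) continuous_coinduced_rng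

theorem FinSphere.continuous_coord (k i : ℕ) :
    Continuous fun x : FinSphere k => (FinSphere.incl k x).coord i :=
  (continuous_apply i).comp (continuous_induced_dom (f := fun (x : FinSphere k) i => x.1.coord i))

theorem continuous_dom_iff {Z : Type*} [TopologicalSpace Z] {f : SphereInf → Z} :
    Continuous f ↔ ∀ k, Continuous (f ∘ FinSphere.incl k) := by
  refine ⟨fun h k => h.comp (FinSphere.continuous_incl k), fun h => ?_⟩
  exact continuous_iSup_dom.2 fun k => continuous_coinduced_dom.2 (h k)

theorem continuous_coord (i : ℕ) : Continuous fun x : SphereInf => x.coord i :=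
  continuous_dom_iff.2 fun k => FinSphere.continuous_coord k i

/-- A map into a fixed `S^m ⊆ S^∞` is continuous if its coordinates are. -/
theorem continuous_of_coord {X : Type*} [TopologicalSpace X] {f : X → SphereInf} (m : ℕ)
    (hm : ∀ x i, m < i → (f x).coord i = 0) (hc : ∀ i, Continuous fun x => (f x).coord i) :
    Continuous f := by
  let g : X → FinSphere m := fun x => ⟨f x, hm x⟩
  have hg : Continuous g := continuous_induced_rng.2 (continuous_pi hc)
  exact (FinSphere.continuous_incl m).comp hg

theorem exists_sphere (x : SphereInf) : ∃ k, x ∈ SphereInf.sphere k := by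
  refine ⟨x.coord.support.sup id, fun i hi => ?_⟩
  by_contra h
  exact absurd (Finset.le_sup (f := id) (Finsupp.mem_support_iff.2 h)) (not_le.2 hi)

theorem isQuotientMap_incl :
    IsQuotientMap fun p : Σ k, FinSphere k => FinSphere.incl p.1 p.2 := by
  refine ⟨⟨?_⟩, ?_⟩
  rotate_left
  · intro x
    obtain ⟨k, hk⟩ := exists_sphere x
    exact ⟨⟨k, x, hk⟩, rfl⟩
  · change (⨆ k : ℕ, TopologicalSpace.coinduced (FinSphere.incl k) _) =
      TopologicalSpace.coinduced _ (⨆ k, TopologicalSpace.coinduced (Sigma.mk k) _)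
    rw [coinduced_iSup]
    rfl

theorem sum_sq (x : SphereInf) : x.coord.sum (fun _ t => t ^ 2) = 1 := x.2

theorem sum_sq_of_subset (y : ℕ →₀ ℝ) {S : Finset ℕ} (h : y.support ⊆ S) :
    y.sum (fun _ t => t ^ 2) = ∑ i ∈ S, y i ^ 2 :=
  Finsupp.sum_of_support_subset _ h _ (by simp)

theorem sum_sq_pos {y : ℕ →₀ ℝ} (hy : y ≠ 0) : 0 < y.sum (fun _ t => t ^ 2) := by
  refine Finset.sum_pos (fun i hi => ?_) (Finsupp.support_nonempty_iff.2 hy)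
  exact pow_pos_of_ne_zero_sq (Finsupp.mem_support_iff.1 hi)
where pow_pos_of_ne_zero_sq {t : ℝ} (h : t ≠ 0) : 0 < t ^ 2 := by positivity

/-- Radial projection to the sphere. -/
def normalize (y : ℕ →₀ ℝ) (hy : y ≠ 0) : SphereInf :=
  ⟨(Real.sqrt (y.sum fun _ t => t ^ 2))⁻¹ • y, by
    have h := sum_sq_pos hy
    rw [Finsupp.sum_smul_index (by simp)]
    simp only [mul_pow]
    rw [← Finsupp.mul_sum, inv_pow, Real.sq_sqrt h.le, inv_mul_cancel₀ h.ne']⟩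

theorem normalize_coord (y : ℕ →₀ ℝ) (hy : y ≠ 0) (i : ℕ) :
    (normalize y hy).coord i = (Real.sqrt (y.sum fun _ t => t ^ 2))⁻¹ * y i := rfl

theorem continuous_normalize {X : Type*} [TopologicalSpace X] {y : X → ℕ →₀ ℝ}
    (hy : ∀ x, y x ≠ 0) (m : ℕ) (hm : ∀ x i, m < i → y x i = 0)
    (hc : ∀ i, Continuous fun x => y x i) : Continuous fun x => normalize (y x) (hy x) := by
  have hsub : ∀ x, (y x).support ⊆ Finset.range (m + 1) := by
    intro x i hi
    rw [Finset.mem_range]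
    by_contra h
    exact Finsupp.mem_support_iff.1 hi (hm x i (by omega))
  refine continuous_of_coord m (fun x i hi => ?_) fun i => ?_
  · rw [normalize_coord, hm x i hi, mul_zero]
  · simp only [normalize_coord]
    refine Continuous.mul (Continuous.inv₀ (Real.continuous_sqrt.comp ?_) ?_) (hc i)
    · have : (fun x => (y x).sum fun _ t => t ^ 2) =
          fun x => ∑ i ∈ Finset.range (m + 1), y x i ^ 2 :=
        funext fun x => sum_sq_of_subset _ (hsub x)
      rw [this]
      exact continuous_finsetSum _ fun i _ => (hc i).pow 2
    · intro x
      exact (Real.sqrt_pos.2 (sum_sq_pos (hy x))).ne'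

theorem normalize_self (x : SphereInf) (h : x.coord ≠ 0) : normalize x.coord h = x := by
  apply Subtype.ext
  change (Real.sqrt (x.coord.sum fun _ t => t ^ 2))⁻¹ • x.coord = x.coord
  rw [sum_sq]
  simp

instance : Neg SphereInf :=
  ⟨fun x => ⟨-x.coord, by
    rw [Finsupp.sum_neg_index (by simp)]
    simpa using x.sum_sq⟩⟩

theorem coord_neg (x : SphereInf) : (-x).coord = -x.coord := rfl

theorem coord_injective {x y : SphereInf} (h : x.coord = y.coord) : x = y := Subtype.ext h

theorem coord_ne_zero (x : SphereInf) : x.coord ≠ 0 := by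
  intro h
  have := x.sum_sq
  rw [h] at this
  simp at this

theorem continuous_neg : Continuous fun x : SphereInf => -x := by
  refine continuous_dom_iff.2 fun k => continuous_of_coord k ?_ ?_
  · intro x i hi
    simp only [Function.comp, coord_neg, Finsupp.neg_apply]
    rw [FinSphere.incl, x.2 i hi, neg_zero]
  · intro i
    simp only [Function.comp, coord_neg, Finsupp.neg_apply]
    exact (FinSphere.continuous_coord k i).neg

/-- The shift `(x₀, x₁, …) ↦ (0, x₀, x₁, …)`. -/
def shift (x : ℕ →₀ ℝ) : ℕ →₀ ℝ := x.mapDomain Nat.succ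

theorem shift_zero (x : ℕ →₀ ℝ) : shift x 0 = 0 :=
  Finsupp.mapDomain_of_notMem_range _ _ (by simp)

theorem shift_succ (x : ℕ →₀ ℝ) (i : ℕ) : shift x (i + 1) = x i :=
  Finsupp.mapDomain_apply Nat.succ_injective _ _

/-- The path from `x` to the first basis vector before normalization. -/
def contractionVec (x : ℕ →₀ ℝ) (t : ℝ) : ℕ →₀ ℝ :=
  (1 - t) • x + (t * (1 - t)) • shift x + t • Finsupp.single 0 1

theorem contractionVec_apply_zero (x : ℕ →₀ ℝ) (t : ℝ) :
    contractionVec x t 0 = (1 - t) * x 0 + t := by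
  simp [contractionVec, shift_zero]

theorem contractionVec_apply_succ (x : ℕ →₀ ℝ) (t : ℝ) (i : ℕ) :
    contractionVec x t (i + 1) = (1 - t) * x (i + 1) + t * (1 - t) * x i := by
  simp [contractionVec, shift_succ]

/-- The last nonzero coordinate of `x` shows up in the coordinate after it, thanks to the shift. -/
theorem contractionVec_ne_zero {x : ℕ →₀ ℝ} (hx : x ≠ 0) (t : unitInterval) :
    contractionVec x t ≠ 0 := by
  intro h
  obtain ⟨t, h0, h1⟩ := t
  rcases h0.eq_or_lt with rfl | h0
  · refine hx ?_
    simpa [contractionVec] using h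
  rcases h1.eq_or_lt with rfl | h1
  · have := DFunLike.congr_fun h 0
    rw [contractionVec_apply_zero] at this
    simp at this
  have hne := Finsupp.support_nonempty_iff.2 hx
  set m := x.support.max' hne
  have hm : x m ≠ 0 := Finsupp.mem_support_iff.1 (x.support.max'_mem hne)
  have hm1 : x (m + 1) = 0 := by
    by_contra h
    have := x.support.le_max' _ (Finsupp.mem_support_iff.2 h)
    omega
  have := DFunLike.congr_fun h (m + 1)
  rw [contractionVec_apply_succ, hm1, mul_zero, zero_add, Finsupp.zero_apply] at this
  exact mul_ne_zero (mul_pos h0 (sub_pos.2 h1)).ne' hm this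

/-- A contraction of `S^∞` to a point. -/
def contraction (p : SphereInf × unitInterval) : SphereInf :=
  normalize (contractionVec p.1.coord p.2) (contractionVec_ne_zero p.1.coord_ne_zero p.2)

theorem contraction_zero (x : SphereInf) : contraction (x, 0) = x := by
  have : contractionVec x.coord ((0 : unitInterval) : ℝ) = x.coord := by simp [contractionVec]
  simp only [contraction, this]
  exact normalize_self _ _

theorem contraction_one (x y : SphereInf) : contraction (x, 1) = contraction (y, 1) := by
  have : ∀ x : SphereInf, contractionVec x.coord ((1 : unitInterval) : ℝ) = Finsupp.single 0 1 := by
    intro x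
    simp [contractionVec]
  simp only [contraction, this]

theorem continuous_contraction : Continuous contraction := by
  refine isQuotientMap_incl.continuous_lift_prod_left ?_
  let e : (Σ k, FinSphere k) × unitInterval ≃ₜ Σ k, FinSphere k × unitInterval :=
    Homeomorph.sigmaProdDistrib
  have h2 : Continuous fun q : Σ k, FinSphere k × unitInterval =>
      contraction (FinSphere.incl q.1 q.2.1, q.2.2) := by
    refine continuous_sigma fun k => ?_
    change Continuous fun p : FinSphere k × unitInterval => contraction (FinSphere.incl k p.1, p.2)
    unfold contraction
    refine continuous_normalize (y := fun p : FinSphere k × unitInterval =>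
      contractionVec (FinSphere.incl k p.1).coord p.2)
      (fun p => contractionVec_ne_zero (coord_ne_zero _) p.2) (k + 1) ?_ ?_
    · intro p i hi
      obtain ⟨i, rfl⟩ : ∃ j, i = j + 1 := ⟨i - 1, by omega⟩
      have h0 : ∀ j, k < j → (FinSphere.incl k p.1).coord j = 0 := fun j hj => p.1.2 j hj
      rw [contractionVec_apply_succ, h0 _ (by omega), h0 _ (by omega)]
      simp
    · have hc := fun i => (FinSphere.continuous_coord k i).comp
        (continuous_fst : Continuous fun p : FinSphere k × unitInterval => p.1)
      have ht : Continuous fun p : FinSphere k × unitInterval => (p.2 : ℝ) :=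
        continuous_subtype_val.comp continuous_snd
      intro i
      cases i with
      | zero =>
        simp only [contractionVec_apply_zero]
        exact ((continuous_const.sub ht).mul (hc 0)).add ht
      | succ i =>
        simp only [contractionVec_apply_succ]
        exact ((continuous_const.sub ht).mul (hc (i + 1))).add
          ((ht.mul (continuous_const.sub ht)).mul (hc i))
  have h3 := h2.comp e.continuous
  have h4 : (fun q : Σ k, FinSphere k × unitInterval =>
      contraction (FinSphere.incl q.1 q.2.1, q.2.2)) ∘ e =
      fun p : (Σ k, FinSphere k) × unitInterval =>
        contraction (FinSphere.incl p.1.1 p.1.2, p.2) := by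
    funext p
    rfl
  rwa [h4] at h3

theorem eq_of_isLocallyConstant {Y : Type*} {f : SphereInf → Y} (hf : IsLocallyConstant f)
    (x y : SphereInf) : f x = f y := by
  have key : ∀ x, f x = f (contraction (x, 1)) := by
    intro x
    have h : IsLocallyConstant fun t : unitInterval => f (contraction (x, t)) :=
      hf.comp_continuous (continuous_contraction.comp (by fun_prop : Continuous fun t => (x, t)))
    have := h.apply_eq_of_preconnectedSpace 0 1
    simpa only [contraction_zero] using this
  rw [key x, key y, contraction_one x y]

end SphereInf

/-! ### The first cohomology of a contractible space -/

/-- The sum of a `1`-cochain along a path subdivided into `2 ^ n` parts. -/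
def pathSum {X : Type*} (Φ : X → X → ZMod 2) (γ : ℝ → X) (n : ℕ) : ZMod 2 :=
  ∑ j ∈ Finset.range (2 ^ n), Φ (γ ((j : ℝ) / 2 ^ n)) (γ (((j : ℝ) + 1) / 2 ^ n))

theorem sum_range_two_mul {M : Type*} [AddCommMonoid M] (f : ℕ → M) (m : ℕ) :
    ∑ j ∈ Finset.range (2 * m), f j = ∑ j ∈ Finset.range m, (f (2 * j) + f (2 * j + 1)) := by
  induction m with
  | zero => simp
  | succ m ih =>
    rw [show 2 * (m + 1) = 2 * m + 1 + 1 by ring, Finset.sum_range_succ, Finset.sum_range_succ, ih,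
      Finset.sum_range_succ, add_assoc]

/-- A `1`-cocycle on a contractible space is locally a coboundary `δθ` of a global `θ`: sum it up
along the paths of the contraction. -/
theorem exists_primitive_of_contraction {X : Type*} [TopologicalSpace X]
    {h : X × unitInterval → X} (hc : Continuous h) (h0 : ∀ x, h (x, 0) = x)
    (h1 : ∀ x y, h (x, 1) = h (y, 1)) {Φ : X → X → ZMod 2}
    (hΦ : ∀ a, ∃ U ∈ 𝓝 a, ∀ x ∈ U, ∀ y ∈ U, ∀ z ∈ U, Φ y z + Φ x z + Φ x y = 0) :
    ∃ θ : X → ZMod 2, ∀ a, ∃ U ∈ 𝓝 a, ∀ x ∈ U, ∀ y ∈ U, Φ x y = θ x + θ y := by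
  let γ : X → ℝ → X := fun x t => h (x, projIcc 0 1 zero_le_one t)
  -- near `a`, sufficiently fine subdivisions of all paths have their corresponding parts in a
  -- common set where the cocycle condition holds, by a Lebesgue number argument
  have claim : ∀ a, ∃ U ∈ 𝓝 a, ∃ n₀ : ℕ, ∀ n ≥ n₀, ∀ j : ℕ, j < 2 ^ n → ∃ W : Set X,
      (∀ x ∈ W, ∀ y ∈ W, ∀ z ∈ W, Φ y z + Φ x z + Φ x y = 0) ∧
      ∀ x ∈ U, ∀ t : ℝ, (j : ℝ) / 2 ^ n ≤ t → t ≤ ((j : ℝ) + 1) / 2 ^ n → γ x t ∈ W := by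
    intro a
    have hloc : ∀ t : unitInterval, ∃ U ∈ 𝓝 a, ∃ J : Set unitInterval, IsOpen J ∧ t ∈ J ∧
        ∃ W : Set X, (∀ x ∈ W, ∀ y ∈ W, ∀ z ∈ W, Φ y z + Φ x z + Φ x y = 0) ∧
          ∀ x ∈ U, ∀ s ∈ J, h (x, s) ∈ W := by
      intro t
      obtain ⟨W, hW, hW'⟩ := hΦ (h (a, t))
      have := hc.continuousAt.preimage_mem_nhds hW
      rw [nhds_prod_eq] at this
      obtain ⟨U, hU, J, hJ, hUJ⟩ := Filter.mem_prod_iff.1 this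
      obtain ⟨J', hJ'J, hJ'o, htJ'⟩ := mem_nhds_iff.1 hJ
      exact ⟨U, hU, J', hJ'o, htJ', W, hW', fun x hx s hs => hUJ (mk_mem_prod hx (hJ'J hs))⟩
    choose U hU J hJo hJ W hW hUW using hloc
    obtain ⟨T, -, hT⟩ := (isCompact_univ : IsCompact (univ : Set unitInterval)).elim_nhds_subcover J
      fun t _ => (hJo t).mem_nhds (hJ t)
    obtain ⟨δ, hδ, hδT⟩ := lebesgue_number_lemma_of_metric (s := (univ : Set unitInterval))
      (c := fun t : T => J t) isCompact_univ (fun t => hJo _) (by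
        intro s hs
        obtain ⟨t, ht, hst⟩ := mem_iUnion₂.1 (hT hs)
        exact mem_iUnion.2 ⟨⟨t, ht⟩, hst⟩)
    refine ⟨⋂ t ∈ T, U t, (Filter.biInter_finset_mem T).2 fun t _ => hU t, ?_⟩
    obtain ⟨n₀, hn₀⟩ := exists_pow_lt_of_lt_one hδ (by norm_num : (1 / 2 : ℝ) < 1)
    refine ⟨n₀, fun n hn j hj => ?_⟩
    have hp : (0 : ℝ) < 2 ^ n := by positivity
    have hj0 : (0 : ℝ) ≤ j / 2 ^ n := by positivity
    have hj1 : ((j : ℝ) + 1) / 2 ^ n ≤ 1 := by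
      rw [div_le_one hp]
      exact_mod_cast hj
    have hlen : ((j : ℝ) + 1) / 2 ^ n < j / 2 ^ n + δ := by
      rw [add_div]
      have : (1 : ℝ) / 2 ^ n ≤ (1 / 2) ^ n₀ := by
        rw [← one_div_pow]
        exact pow_le_pow_of_le_one (by norm_num) (by norm_num) hn
      linarith
    have hmid : (j : ℝ) / 2 ^ n ≤ ((j : ℝ) + 1) / 2 ^ n := by
      gcongr
      linarith
    obtain ⟨t, ht⟩ := hδT ⟨j / 2 ^ n, hj0, hmid.trans hj1⟩ (mem_univ _)
    refine ⟨W t, hW t, fun x hx s hs hs' => hUW t x (mem_iInter₂.1 hx t t.2) _ (ht ?_)⟩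
    have hsI : s ∈ Icc (0 : ℝ) 1 := ⟨hj0.trans hs, hs'.trans hj1⟩
    rw [projIcc_of_mem _ hsI, Metric.mem_ball, Subtype.dist_eq, Real.dist_eq, abs_lt]
    constructor <;> simp only <;> linarith
  choose U hU n₀ hn₀ using claim
  -- refining the subdivision does not change the sum
  have hstable : ∀ a, ∀ x ∈ U a, ∀ n ≥ n₀ a, pathSum Φ (γ x) n = pathSum Φ (γ x) (n₀ a) := by
    intro a x hx n hn
    induction n, hn using Nat.le_induction with
    | base => rfl
    | succ n hn ih =>
      rw [← ih, pathSum, pathSum, pow_succ', sum_range_two_mul]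
      refine Finset.sum_congr rfl fun j hj => ?_
      obtain ⟨W, hW, hW'⟩ := hn₀ a n hn j (Finset.mem_range.1 hj)
      have hp : (0 : ℝ) < 2 ^ n := by positivity
      have e1 : ((2 * j : ℕ) : ℝ) / 2 ^ (n + 1) = j / 2 ^ n := by
        rw [pow_succ']; push_cast; field_simp
      have e2 : (((2 * j : ℕ) : ℝ) + 1) / 2 ^ (n + 1) = (j + 1 / 2) / 2 ^ n := by
        rw [pow_succ']; push_cast; field_simp
      have e3 : (((2 * j + 1 : ℕ) : ℝ)) / 2 ^ (n + 1) = (j + 1 / 2) / 2 ^ n := by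
        rw [pow_succ']; push_cast; field_simp
      have e4 : (((2 * j + 1 : ℕ) : ℝ) + 1) / 2 ^ (n + 1) = (j + 1) / 2 ^ n := by
        rw [pow_succ']; push_cast; field_simp; ring
      rw [e1, e2, e3, e4]
      have i1 : (j : ℝ) / 2 ^ n ≤ (j + 1 / 2) / 2 ^ n := by gcongr; linarith
      have i2 : ((j : ℝ) + 1 / 2) / 2 ^ n ≤ (j + 1) / 2 ^ n := by gcongr; linarith
      have := hW _ (hW' x hx _ le_rfl (i1.trans i2)) _ (hW' x hx _ i1 i2) _
        (hW' x hx _ (i1.trans i2) le_rfl)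
      revert this
      generalize Φ (γ x (j / 2 ^ n)) (γ x ((j + 1 / 2) / 2 ^ n)) = a
      generalize Φ (γ x ((j + 1 / 2) / 2 ^ n)) (γ x ((j + 1) / 2 ^ n)) = b
      generalize Φ (γ x (j / 2 ^ n)) (γ x ((j + 1) / 2 ^ n)) = c
      clear * -
      revert a b c
      decide
  refine ⟨fun x => pathSum Φ (γ x) (n₀ x), fun a => ⟨U a, hU a, ?_⟩⟩
  have hθ : ∀ x ∈ U a, pathSum Φ (γ x) (n₀ x) = pathSum Φ (γ x) (n₀ a) := by
    intro x hx
    rw [← hstable x x (mem_of_mem_nhds (hU x)) (max (n₀ x) (n₀ a)) (le_max_left _ _),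
      ← hstable a x hx (max (n₀ x) (n₀ a)) (le_max_right _ _)]
  intro x hx y hy
  simp only [hθ x hx, hθ y hy]
  -- compare the sums along the two paths by a telescoping argument
  set n := n₀ a with hn
  have htel : ∀ m ≤ 2 ^ n, ∑ j ∈ Finset.range m,
      (Φ (γ x ((j : ℝ) / 2 ^ n)) (γ x (((j : ℝ) + 1) / 2 ^ n)) +
        Φ (γ y ((j : ℝ) / 2 ^ n)) (γ y (((j : ℝ) + 1) / 2 ^ n))) =
      Φ (γ x 0) (γ y 0) + Φ (γ x ((m : ℝ) / 2 ^ n)) (γ y ((m : ℝ) / 2 ^ n)) := by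
    intro m
    induction m with
    | zero => simp [zmod_two_add_self]
    | succ m ih =>
      intro hm
      rw [Finset.sum_range_succ, ih (by omega)]
      obtain ⟨W, hW, hW'⟩ := hn₀ a n le_rfl m hm
      have i1 : (m : ℝ) / 2 ^ n ≤ (m + 1) / 2 ^ n := by gcongr; linarith
      have x0 := hW' x hx _ le_rfl i1
      have x1 := hW' x hx _ i1 le_rfl
      have y0 := hW' y hy _ le_rfl i1
      have y1 := hW' y hy _ i1 le_rfl
      have r1 := hW _ x0 _ x1 _ y1
      have r2 := hW _ x0 _ y0 _ y1
      push_cast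
      generalize γ x ((m : ℝ) / 2 ^ n) = p at *
      generalize γ x (((m : ℝ) + 1) / 2 ^ n) = p' at *
      generalize γ y ((m : ℝ) / 2 ^ n) = q at *
      generalize γ y (((m : ℝ) + 1) / 2 ^ n) = q' at *
      generalize Φ p p' = z1 at *
      generalize Φ p q' = z2 at *
      generalize Φ p' q' = z3 at *
      generalize Φ p q = z4 at *
      generalize Φ q q' = z5 at *
      generalize Φ (γ x 0) (γ y 0) = z6 at *
      revert r1 r2
      clear * -
      revert z1 z2 z3 z4 z5 z6
      decide
  have := htel _ le_rfl
  rw [Finset.sum_add_distrib] at this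
  have hcast : ((2 ^ n : ℕ) : ℝ) / 2 ^ n = 1 := by
    push_cast
    exact div_self (by positivity)
  rw [hcast] at this
  have g0 : ∀ x, γ x 0 = x := fun x => by
    simp only [γ, projIcc_left]
    exact h0 x
  have g1 : γ x 1 = γ y 1 := by
    simp only [γ, projIcc_right]
    exact h1 x y
  have hdiag : ∀ z, Φ z z = 0 := by
    intro z
    obtain ⟨U, hU, hU'⟩ := hΦ z
    have hz := mem_of_mem_nhds hU
    have := hU' z hz z hz z hz
    generalize Φ z z = b at *
    revert this
    clear * -
    revert b
    decide
  rw [g0, g0, g1, hdiag, add_zero] at this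
  exact this.symm

/-! ### The first cohomology of the infinite projective space -/

theorem coboundary_one_apply {X : Type*} (φ : Cochain X 1) (x : Fin 3 → X) :
    coboundary X 1 φ x = φ ![x 1, x 2] + φ ![x 0, x 2] + φ ![x 0, x 1] := by
  refine (Fin.sum_univ_three fun i : Fin 3 => φ fun j => x (i.succAbove j)).trans ?_
  congr 1
  · congr 1
    · congr 1
      funext j
      fin_cases j <;> rfl
    · congr 1
      funext j
      fin_cases j <;> rfl
  · congr 1
    funext j
    fin_cases j <;> rfl

theorem coboundary_zero_apply {X : Type*} (φ : Cochain X 0) (x : Fin 2 → X) :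
    coboundary X 0 φ x = φ ![x 1] + φ ![x 0] := by
  refine (Fin.sum_univ_two fun i : Fin 2 => φ fun j => x (i.succAbove j)).trans ?_
  congr 1
  · congr 1
    funext j
    fin_cases j
    rfl
  · congr 1
    funext j
    fin_cases j
    rfl

/-- The point of the projective space represented by a point of the sphere. -/
def toRP (x : SphereInf) : RPInf := Quotient.mk _ x

theorem toRP_neg (x : SphereInf) : toRP (-x) = toRP x :=
  Quotient.sound (s := antipodal SphereInf.coord) (Or.inr (by rw [SphereInf.coord_neg, neg_neg]))

theorem eq_or_eq_neg_of_toRP_eq {x y : SphereInf} (h : toRP x = toRP y) : y = x ∨ y = -x := by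
  rcases Quotient.exact h with h | h
  · exact Or.inl (SphereInf.coord_injective h)
  · exact Or.inr (SphereInf.coord_injective h)

theorem continuous_toRP : Continuous toRP := continuous_quotient_mk'

theorem isOpenMap_toRP : IsOpenMap toRP := by
  intro U hU
  refine isOpen_coinduced.2 ?_
  have : Quotient.mk (antipodal SphereInf.coord) ⁻¹' (toRP '' U) =
      U ∪ (fun x => -x) ⁻¹' U := by
    ext x
    constructor
    · rintro ⟨y, hy, hxy⟩
      rcases eq_or_eq_neg_of_toRP_eq (x := y) (y := x) hxy with rfl | rfl
      · exact Or.inl hy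
      · refine Or.inr ?_
        have : -(-y) = y := SphereInf.coord_injective (by simp [SphereInf.coord_neg])
        rwa [mem_preimage, this]
    · rintro (h | h)
      · exact ⟨x, h, rfl⟩
      · exact ⟨-x, h, toRP_neg x⟩
  change IsOpen (Quotient.mk (antipodal SphereInf.coord) ⁻¹' (toRP '' U))
  rw [this]
  exact hU.union (hU.preimage SphereInf.continuous_neg)

/-- A `1`-cochain on the projective space which represents the characteristic class of the
covering by the sphere: it is locally the coboundary of a section `θ`. -/
def IsCharacteristic (φ : Cochain RPInf 1) (θ : SphereInf → ZMod 2) : Prop :=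
  (∀ x, θ (-x) = θ x + 1) ∧
    ∀ a, ∃ U ∈ 𝓝 a, ∀ x ∈ U, ∀ y ∈ U, φ ![toRP x, toRP y] = θ x + θ y

/-- Every nonzero class in `H^1(ℝP^∞; ℤ/2)` is the characteristic class. -/
theorem exists_isCharacteristic {φ : Cochain RPInf 1} (hφ : φ ∈ cocycles RPInf 1)
    (hne : φ ∉ coboundaries RPInf 1) : ∃ θ, IsCharacteristic φ θ := by
  obtain ⟨θ, hθ⟩ := exists_primitive_of_contraction SphereInf.continuous_contraction
    SphereInf.contraction_zero SphereInf.contraction_one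
    (Φ := fun x y => φ ![toRP x, toRP y]) (by
      intro a
      obtain ⟨U, hU, h⟩ := hφ (toRP a)
      refine ⟨toRP ⁻¹' U, continuous_toRP.continuousAt.preimage_mem_nhds hU, ?_⟩
      intro x hx y hy z hz
      have := h ![toRP x, toRP y, toRP z] (by
        intro i
        fin_cases i
        · exact hx
        · exact hy
        · exact hz)
      rw [coboundary_one_apply] at this
      exact this)
  have hloc : IsLocallyConstant fun x => θ (-x) + θ x := by
    rw [IsLocallyConstant.iff_eventually_eq]
    intro a
    obtain ⟨U, hU, h⟩ := hθ a
    obtain ⟨V, hV, h'⟩ := hθ (-a)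
    filter_upwards [hU, SphereInf.continuous_neg.continuousAt.preimage_mem_nhds hV] with x hx hx'
    have e1 := h x hx a (mem_of_mem_nhds hU)
    have e2 := h' (-x) hx' (-a) (mem_of_mem_nhds hV)
    simp only [toRP_neg] at e1 e2
    rw [e1] at e2
    revert e2
    generalize θ x = p
    generalize θ a = q
    generalize θ (-x) = r
    generalize θ (-a) = s
    clear * -
    revert p q r s
    decide
  -- `θ (-x) + θ x` is constant as the sphere is connected; if it is `0`, then `θ` is invariant and
  -- `φ` a coboundary
  have hconst := fun x y => SphereInf.eq_of_isLocallyConstant hloc x y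
  by_cases hc : ∃ x, θ (-x) + θ x = 1
  · obtain ⟨x₀, hx₀⟩ := hc
    refine ⟨θ, fun x => ?_, hθ⟩
    have := hconst x x₀
    simp only [hx₀] at this
    revert this
    generalize θ x = p
    generalize θ (-x) = q
    clear * -
    revert p q
    decide
  · exfalso
    have hinv : ∀ x, θ (-x) = θ x := by
      intro x
      have : ¬ (θ (-x) + θ x = 1) := fun h => hc ⟨x, h⟩
      revert this
      generalize θ x = p
      generalize θ (-x) = q
      clear * -
      revert p q
      decide
    -- the primitive descends to the projective space
    let χ : Cochain RPInf 0 := fun ξ => θ (ξ 0).out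
    have hχ : ∀ x, χ ![toRP x] = θ x := by
      intro x
      have : toRP (toRP x).out = toRP x := Quotient.out_eq _
      rcases eq_or_eq_neg_of_toRP_eq this with h | h
      · change θ (toRP x).out = θ x
        rw [← h]
      · change θ (toRP x).out = θ x
        nth_rewrite 2 [h]
        rw [hinv]
    refine hne ?_
    rw [← sub_add_cancel φ (coboundary RPInf 0 χ)]
    refine Submodule.add_mem_sup ?_ ⟨χ, rfl⟩
    intro α
    obtain ⟨a, rfl⟩ : ∃ a, toRP a = α := Quotient.exists_rep α
    obtain ⟨U, hU, h⟩ := hθ a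
    obtain ⟨V, hVU, hV, haV⟩ := mem_nhds_iff.1 hU
    refine ⟨toRP '' V, (isOpenMap_toRP V hV).mem_nhds ⟨a, haV, rfl⟩, fun ξ hξ => ?_⟩
    obtain ⟨x, hx, hx'⟩ := hξ 0
    obtain ⟨y, hy, hy'⟩ := hξ 1
    have e : ξ = ![toRP x, toRP y] := by
      funext i
      fin_cases i
      · exact hx'.symm
      · exact hy'.symm
    rw [e, Pi.sub_apply, coboundary_zero_apply, h x (hVU hx) y (hVU hy)]
    change θ x + θ y - (χ ![toRP y] + χ ![toRP x]) = 0
    rw [hχ, hχ]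
    ring

/-- The scalar product of finitely supported sequences. -/
def finsuppInner (x y : ℕ →₀ ℝ) : ℝ := x.sum fun i t => t * y i

theorem finsuppInner_eq_sum (x y : ℕ →₀ ℝ) {S : Finset ℕ} (h : x.support ⊆ S) :
    finsuppInner x y = ∑ i ∈ S, x i * y i :=
  Finsupp.sum_of_support_subset _ h _ (by simp)

theorem finsuppInner_neg_left (x y : ℕ →₀ ℝ) : finsuppInner (-x) y = -finsuppInner x y := by
  rw [finsuppInner_eq_sum (-x) y (S := x.support) (by simp),
    finsuppInner_eq_sum x y subset_rfl, ← Finset.sum_neg_distrib]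
  simp

theorem finsuppInner_neg_right (x y : ℕ →₀ ℝ) : finsuppInner x (-y) = -finsuppInner x y := by
  rw [finsuppInner_eq_sum x _ subset_rfl, finsuppInner_eq_sum x y subset_rfl,
    ← Finset.sum_neg_distrib]
  simp

/-- Unit vectors which are close to a common unit vector have positive scalar product. -/
theorem finsuppInner_pos {a x y : SphereInf} (hx : 9 / 10 < finsuppInner a.coord x.coord)
    (hy : 9 / 10 < finsuppInner a.coord y.coord) : 0 < finsuppInner x.coord y.coord := by
  set S := a.coord.support ∪ x.coord.support ∪ y.coord.support
  have ha' : a.coord.support ⊆ S :=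
    Finset.subset_union_left.trans Finset.subset_union_left
  have hx' : x.coord.support ⊆ S :=
    Finset.subset_union_right.trans Finset.subset_union_left
  have hy' : y.coord.support ⊆ S := Finset.subset_union_right
  have na := a.sum_sq
  have nx := x.sum_sq
  have ny := y.sum_sq
  rw [SphereInf.sum_sq_of_subset _ ha'] at na
  rw [SphereInf.sum_sq_of_subset _ hx'] at nx
  rw [SphereInf.sum_sq_of_subset _ hy'] at ny
  rw [finsuppInner_eq_sum _ _ ha'] at hx hy
  rw [finsuppInner_eq_sum _ _ hx']
  have cs := Finset.sum_mul_sq_le_sq_mul_sq S (fun i => a.coord i)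
    fun i => x.coord i + y.coord i
  have e1 : ∑ i ∈ S, a.coord i * (x.coord i + y.coord i) =
      ∑ i ∈ S, a.coord i * x.coord i + ∑ i ∈ S, a.coord i * y.coord i := by
    rw [← Finset.sum_add_distrib]
    exact Finset.sum_congr rfl fun i _ => by ring
  have e2 : ∑ i ∈ S, (x.coord i + y.coord i) ^ 2 =
      ∑ i ∈ S, x.coord i ^ 2 + 2 * ∑ i ∈ S, x.coord i * y.coord i + ∑ i ∈ S, y.coord i ^ 2 := by
    rw [Finset.mul_sum, ← Finset.sum_add_distrib, ← Finset.sum_add_distrib]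
    exact Finset.sum_congr rfl fun i _ => by ring
  rw [e1, e2, na, nx, ny] at cs
  nlinarith

open Classical in
/-- The characteristic class exists. -/
theorem exists_characteristic_cocycle :
    ∃ φ ∈ cocycles RPInf 1, ∃ θ, IsCharacteristic φ θ := by
  -- the values of `φ` compare the chosen representatives of two lines: they are `1` if these
  -- form an obtuse angle
  let φ : Cochain RPInf 1 := fun ξ =>
    if finsuppInner (ξ 0).out.coord (ξ 1).out.coord < 0 then 1 else 0
  let θ : SphereInf → ZMod 2 := fun x => if (toRP x).out = x then 0 else 1
  have hout : ∀ x, (toRP x).out = x ∨ (toRP x).out = -x := fun x =>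
    eq_or_eq_neg_of_toRP_eq (Quotient.out_eq (toRP x)).symm
  have hneg : ∀ x : SphereInf, -x ≠ x := by
    intro x h
    have h1 : -x.coord = x.coord := congrArg SphereInf.coord h
    refine x.coord_ne_zero ?_
    ext i
    have := DFunLike.congr_fun h1 i
    simp only [Finsupp.neg_apply] at this
    simp only [Finsupp.zero_apply]
    linarith
  have hθ : ∀ x, θ (-x) = θ x + 1 := by
    intro x
    simp only [θ, toRP_neg]
    rcases hout x with h | h
    · rw [h, if_neg (fun h' => hneg x h'.symm), if_pos rfl]
      decide
    · rw [h, if_pos rfl, if_neg (hneg x)]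
      decide
  have hloc : ∀ a, ∃ U ∈ 𝓝 a, ∀ x ∈ U, ∀ y ∈ U, φ ![toRP x, toRP y] = θ x + θ y := by
    intro a
    refine ⟨{x | 9 / 10 < finsuppInner a.coord x.coord}, ?_, ?_⟩
    · refine IsOpen.mem_nhds (isOpen_lt continuous_const ?_) ?_
      · have : (fun x : SphereInf => finsuppInner a.coord x.coord) = fun x =>
            ∑ i ∈ a.coord.support, a.coord i * x.coord i :=
          funext fun x => finsuppInner_eq_sum _ _ subset_rfl
        rw [this]
        exact continuous_finsetSum _ fun i _ =>
          continuous_const.mul (SphereInf.continuous_coord i)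
      · have : finsuppInner a.coord a.coord = 1 := by
          rw [← a.sum_sq, finsuppInner]
          simp only [sq, Finsupp.sum]
        rw [mem_ofPred_eq, this]
        norm_num
    · intro x hx y hy
      have hpos := finsuppInner_pos hx hy
      change (if finsuppInner (toRP x).out.coord (toRP y).out.coord < 0 then
        (1 : ZMod 2) else 0) = _
      simp only [θ]
      rcases hout x with h | h <;> rcases hout y with h' | h' <;> rw [h, h']
      · rw [if_neg (not_lt.2 hpos.le), if_pos rfl, if_pos rfl, add_zero]
      · rw [SphereInf.coord_neg, finsuppInner_neg_right, if_pos (neg_lt_zero.2 hpos), if_pos rfl,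
          if_neg (hneg y), zero_add]
      · rw [SphereInf.coord_neg, finsuppInner_neg_left, if_pos (neg_lt_zero.2 hpos), if_pos rfl,
          if_neg (hneg x), add_zero]
      · rw [SphereInf.coord_neg, SphereInf.coord_neg, finsuppInner_neg_left,
          finsuppInner_neg_right, neg_neg, if_neg (not_lt.2 hpos.le), if_neg (hneg x),
          if_neg (hneg y)]
        decide
  refine ⟨φ, ?_, θ, hθ, hloc⟩
  intro α
  obtain ⟨a, rfl⟩ : ∃ a, toRP a = α := Quotient.exists_rep α
  obtain ⟨U, hU, h⟩ := hloc a
  obtain ⟨V, hVU, hV, haV⟩ := mem_nhds_iff.1 hU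
  refine ⟨toRP '' V, (isOpenMap_toRP V hV).mem_nhds ⟨a, haV, rfl⟩, fun ξ hξ => ?_⟩
  obtain ⟨x, hx, hx'⟩ := hξ 0
  obtain ⟨y, hy, hy'⟩ := hξ 1
  obtain ⟨z, hz, hz'⟩ := hξ 2
  rw [coboundary_one_apply, ← hx', ← hy', ← hz', h x (hVU hx) y (hVU hy), h x (hVU hx) z (hVU hz),
    h y (hVU hy) z (hVU hz)]
  generalize θ x = p
  generalize θ y = q
  generalize θ z = r
  clear * -
  revert p q r
  decide

/-! ### The index in terms of cochains on the symmetric set -/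

/-- The value at `x` of the coboundary of a cochain given by a function of lists. -/
theorem sum_succAbove_eq_listCobd {X : Type*} (χ : List X → ZMod 2) {m : ℕ}
    (x : Fin (m + 1) → X) :
    ∑ i : Fin (m + 1), χ (List.ofFn fun j : Fin m => x (i.succAbove j)) =
      listCobd χ (List.ofFn x) := by
  induction m generalizing χ with
  | zero => simp [listCobd]
  | succ m ih =>
    rw [Fin.sum_univ_succ, List.ofFn_succ (f := x), listCobd]
    congr 1
    rw [← ih]
    refine Finset.sum_congr rfl fun i _ => ?_
    rw [List.ofFn_succ]
    simp only [Fin.succ_succAbove_zero, Fin.succ_succAbove_succ]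

theorem cobdPow_ofFn {X : Type*} (s : X → ZMod 2) {k : ℕ} (x : Fin (k + 1) → X) :
    cobdPow s (List.ofFn x) = ∏ i : Fin k, (s (x i.castSucc) + s (x i.succ)) := by
  induction k with
  | zero => simp [cobdPow]
  | succ k ih =>
    have := ih fun i => x i.succ
    rw [List.ofFn_succ] at this
    rw [List.ofFn_succ, List.ofFn_succ, cobdPow, this, Fin.prod_univ_succ]
    rfl

/-- The cup powers of a `1`-cochain. -/
def cochainPow {X : Type*} (φ : Cochain X 1) : (k : ℕ) → Cochain X k
  | 0 => fun _ => 1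
  | k + 1 => cochainCup (cochainPow φ k) φ

theorem cochainPow_apply {X : Type*} (φ : Cochain X 1) {k : ℕ} (x : Fin (k + 1) → X) :
    cochainPow φ k x = ∏ i : Fin k, φ ![x i.castSucc, x i.succ] := by
  induction k with
  | zero => simp [cochainPow]
  | succ k ih =>
    rw [cochainPow, cochainCup, ih, Fin.prod_univ_castSucc]
    rfl

theorem cochainPow_mem_cocycles {X : Type*} [TopologicalSpace X] {φ : Cochain X 1}
    (hφ : φ ∈ cocycles X 1) (k : ℕ) : cochainPow φ k ∈ cocycles X k := by
  induction k with
  | zero => exact fun _ => ⟨univ, univ_mem, fun _ _ => by simp [coboundary, cochainPow]; decide⟩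
  | succ k ih => exact cochainCup_cocycles ih hφ

theorem cupPow_mk {X : Type*} [TopologicalSpace X] {φ : Cochain X 1} (hφ : φ ∈ cocycles X 1)
    (k : ℕ) : cupPow (Submodule.Quotient.mk ⟨φ, hφ⟩ : Cohomology X 1) k =
      Submodule.Quotient.mk ⟨cochainPow φ k, cochainPow_mem_cocycles hφ k⟩ := by
  induction k with
  | zero => rfl
  | succ k ih => rw [cupPow, ih]; rfl

theorem mk_eq_zero_iff {X : Type*} [TopologicalSpace X] {q : ℕ} {φ : Cochain X q}
    (hφ : φ ∈ cocycles X q) :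
    (Submodule.Quotient.mk ⟨φ, hφ⟩ : Cohomology X q) = 0 ↔ φ ∈ coboundaries X q :=
  Submodule.Quotient.mk_eq_zero _

theorem pullback_cupPow_eq_zero_iff {X Y : Type*} [TopologicalSpace X] [TopologicalSpace Y]
    {f : X → Y} (hf : Continuous f) {φ : Cochain Y 1} (hφ : φ ∈ cocycles Y 1) (k : ℕ) :
    pullback f hf k (cupPow (Submodule.Quotient.mk ⟨φ, hφ⟩ : Cohomology Y 1) k) = 0 ↔
      cochainPullback f k (cochainPow φ k) ∈ coboundaries X k := by
  rw [cupPow_mk]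
  exact mk_eq_zero_iff _

section Orbit

variable {E : Type*} [NormedAddCommGroup E]

/-- The projection of a symmetric set to its orbit space. -/
def toOrbit {A : Set E} (x : A) : OrbitSpace (Subtype.val : A → E) := Quotient.mk _ x

theorem toOrbit_eq_iff {A : Set E} {x y : A} :
    toOrbit x = toOrbit y ↔ (y : E) = x ∨ (y : E) = -x := by
  refine ⟨fun h => ?_, fun h => Quotient.sound (s := antipodal Subtype.val) h⟩
  exact Quotient.exact (s := antipodal Subtype.val) h

theorem image_ball_mem_nhds {A : Set E} (hA : ∀ x ∈ A, -x ∈ A) (a : A) {r : ℝ} (hr : 0 < r) :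
    toOrbit '' {x : A | dist (x : E) a < r} ∈ 𝓝 (toOrbit a) := by
  refine IsOpen.mem_nhds ?_ ⟨a, by simpa using hr, rfl⟩
  refine isOpen_coinduced.2 ?_
  have : Quotient.mk (antipodal Subtype.val) ⁻¹' (toOrbit '' {x : A | dist (x : E) a < r}) =
      {x : A | dist (x : E) a < r} ∪ {x : A | dist (-(x : E)) a < r} := by
    ext x
    constructor
    · rintro ⟨y, hy, hxy⟩
      rcases toOrbit_eq_iff.1 hxy with h | h
      · exact Or.inl (by rw [mem_ofPred_eq, h]; exact hy)
      · exact Or.inr (by rw [mem_ofPred_eq, h, neg_neg]; exact hy)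
    · rintro (h | h)
      · exact ⟨x, h, rfl⟩
      · exact ⟨⟨-x, hA x x.2⟩, h, toOrbit_eq_iff.2 (Or.inr (by simp))⟩
  change IsOpen (Quotient.mk (antipodal Subtype.val) ⁻¹' (toOrbit '' {x : A | dist (x : E) a < r}))
  rw [this]
  exact (isOpen_lt (by fun_prop) continuous_const).union
    (isOpen_lt (by fun_prop) continuous_const)

theorem mem_ofFn_self {X : Type*} {n : ℕ} (y : Fin n → X) (i : Fin n) : y i ∈ List.ofFn y :=
  (List.mem_ofFn' _ _).2 ⟨i, rfl⟩

theorem exists_ofFn {X : Type*} {n : ℕ} (l : List X) (hl : l.length = n) :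
    ∃ x : Fin n → X, l = List.ofFn x := by
  subst hl
  exact ⟨l.get, (List.ofFn_get l).symm⟩

/-- On a compact set, local conditions on pairs hold uniformly. -/
theorem exists_uniform_of_nhds {A : Set E} (hA : IsCompact A) {Q : A → Set A}
    (hQ : ∀ a, Q a ∈ 𝓝 a) : ∃ δ > 0, ∀ x : A, ∃ a : A, ∀ y : A, dist (x : E) y < δ → y ∈ Q a := by
  have := isCompact_iff_compactSpace.1 hA
  obtain ⟨δ, hδ, h⟩ := lebesgue_number_lemma_of_metric (s := (univ : Set A))
    (c := fun a => interior (Q a)) isCompact_univ (fun _ => isOpen_interior)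
    fun a _ => mem_iUnion.2 ⟨a, mem_interior_iff_mem_nhds.2 (hQ a)⟩
  refine ⟨δ, hδ, fun x => ?_⟩
  obtain ⟨a, ha⟩ := h x (mem_univ _)
  refine ⟨a, fun y hy => interior_subset (ha ?_)⟩
  rw [Metric.mem_ball, dist_comm]
  exact hy

variable [NormedSpace ℝ E]

open Classical in
/-- The pull-back of the `k`-th power of the characteristic class vanishes in the
Alexander-Spanier cohomology of the orbit space if and only if it does so in the sense of
`PowVanishes`. Cochains descend to the orbit space through mutually close representatives. -/
theorem cochainPullback_mem_coboundaries_iff {A : Set E} (hc : IsCompact A)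
    (hA : ∀ x ∈ A, -x ∈ A) (h0 : (0 : E) ∉ A) {φ : Cochain RPInf 1} {θ : SphereInf → ZMod 2}
    (hφ : IsCharacteristic φ θ) {f : A → SphereInf} (hf : Continuous f)
    (hodd : ∀ x y : A, (y : E) = -(x : E) → (f y).coord = -(f x).coord) (k : ℕ) :
    cochainPullback (orbitMap f hodd) k (cochainPow φ k) ∈
      coboundaries (OrbitSpace (Subtype.val : A → E)) k ↔ PowVanishes A k := by
  rcases A.eq_empty_or_nonempty with rfl | ⟨a₀, ha₀⟩
  · have hv : PowVanishes (∅ : Set E) k := PowVanishes.mono (Nat.zero_le k) rfl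
    refine iff_of_true (locallyZero_le_coboundaries _ ?_) hv
    intro α
    obtain ⟨a, rfl⟩ := Quotient.exists_rep α
    exact a.2.elim
  let s : E → ZMod 2 := fun x => if h : x ∈ A then θ (f ⟨x, h⟩) else 0
  have hs : ∀ x ∈ A, s (-x) = s x + 1 := by
    intro x hx
    have : f ⟨-x, hA x hx⟩ = -f ⟨x, hx⟩ := SphereInf.coord_injective (hodd _ _ rfl)
    simp only [s, dif_pos hx, dif_pos (hA x hx), this, hφ.1]
  have hs' : ∀ x : A, s x = θ (f x) := fun x => dif_pos x.2
  -- the pulled back cochain is the coboundary of `s` on close pairs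
  obtain ⟨δ, hδ, hδs⟩ : ∃ δ > 0, ∀ x y : A, dist (x : E) y < δ →
      φ ![orbitMap f hodd (toOrbit x), orbitMap f hodd (toOrbit y)] = s x + s y := by
    choose U hU hUφ using hφ.2
    obtain ⟨δ, hδ, h⟩ := exists_uniform_of_nhds hc (Q := fun a => f ⁻¹' U (f a))
      fun a => hf.continuousAt.preimage_mem_nhds (hU _)
    refine ⟨δ, hδ, fun x y hxy => ?_⟩
    obtain ⟨a, ha⟩ := h x
    rw [hs', hs']
    exact hUφ (f a) _ (ha x (by simpa using hδ)) _ (ha y hxy)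
  have hpow : ∀ {q : ℕ} (y : Fin (q + 1) → A), (∀ i j, dist (y i : E) (y j) < δ) →
      cochainPullback (orbitMap f hodd) q (cochainPow φ q) (fun i => toOrbit (y i)) =
        cobdPow s (List.ofFn fun i => (y i : E)) := by
    intro q y hy
    change cochainPow φ q (fun i => orbitMap f hodd (toOrbit (y i))) = _
    rw [cochainPow_apply, cobdPow_ofFn]
    exact Finset.prod_congr rfl fun i _ => hδs _ _ (hy _ _)
  cases k with
  | zero =>
    refine iff_of_false (fun h => ?_) fun h => ?_
    · obtain ⟨U, hU, h⟩ := h (toOrbit ⟨a₀, ha₀⟩)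
      exact one_ne_zero (h (fun _ => toOrbit ⟨a₀, ha₀⟩) fun _ => mem_of_mem_nhds hU)
    · rw [show A = ∅ from h] at ha₀
      exact ha₀
  | succ k =>
    constructor
    · intro h
      obtain ⟨ζ, hζ, _, ⟨χ, rfl⟩, hsum⟩ := Submodule.mem_sup.1 h
      choose U hU hUζ using hζ
      obtain ⟨δ', hδ', hδζ⟩ := exists_uniform_of_nhds hc (Q := fun a => toOrbit ⁻¹' U (toOrbit a))
        fun a => continuous_quotient_mk'.continuousAt.preimage_mem_nhds (hU _)
      let P : E → OrbitSpace (Subtype.val : A → E) := fun x =>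
        if h : x ∈ A then toOrbit ⟨x, h⟩ else toOrbit ⟨a₀, ha₀⟩
      have hP : ∀ x : A, P x = toOrbit x := fun x => dif_pos x.2
      let ψ : List E → ZMod 2 := fun l => χ fun i : Fin (k + 1) => P (l.getD i 0)
      have hψ : ∀ y : Fin (k + 1) → E, ψ (List.ofFn y) = χ fun i => P (y i) := by
        intro y
        simp only [ψ]
        congr 1
        funext i
        congr 1
        rw [List.getD_eq_getElem _ _ (by rw [List.length_ofFn]; exact i.2), List.getElem_ofFn]
      refine ⟨min δ δ', lt_min hδ hδ', s, ψ, hs, ?_, ?_⟩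
      · intro l hl hlA
        obtain ⟨y, rfl⟩ := exists_ofFn l hl
        rw [List.map_ofFn, hψ, hψ]
        congr 1
        funext i
        have hy : y i ∈ A := hlA _ (mem_ofFn_self y i)
        simp only [Function.comp, P, dif_pos hy, dif_pos (hA _ hy)]
        exact toOrbit_eq_iff.2 (Or.inr (by simp))
      · intro l hl hlA hd
        obtain ⟨y, rfl⟩ := exists_ofFn l hl
        have hy : ∀ i, y i ∈ A := fun i => hlA _ (mem_ofFn_self y i)
        have hdy : ∀ i j, dist (y i) (y j) < min δ δ' := fun i j =>
          hd _ (mem_ofFn_self y i) _ (mem_ofFn_self y j)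
        let z : Fin (k + 1 + 1) → A := fun i => ⟨y i, hy i⟩
        have e1 := hpow z fun i j => (hdy i j).trans_le (min_le_left _ _)
        have e2 : ζ (fun i => toOrbit (z i)) = 0 := by
          obtain ⟨a, ha⟩ := hδζ (z 0)
          exact hUζ (toOrbit a) _ fun i => ha (z i) ((hdy 0 i).trans_le (min_le_right _ _))
        have e3 := congrFun hsum fun i => toOrbit (z i)
        rw [Pi.add_apply, e2, zero_add, e1] at e3
        change _ = cobdPow s (List.ofFn y) at e3
        rw [← e3, ← sum_succAbove_eq_listCobd]
        change (∑ i : Fin (k + 2), χ fun j => toOrbit (z (i.succAbove j))) = _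
        refine Finset.sum_congr rfl fun i _ => ?_
        rw [hψ]
        congr 1
        funext j
        exact (hP (z (i.succAbove j))).symm
    · intro h
      obtain ⟨δ', hδ', ψ, hψ, h⟩ := h.exists_primitive hs
      obtain ⟨m, hm, hmA⟩ : ∃ m > 0, ∀ x ∈ A, m ≤ ‖x‖ := by
        obtain ⟨m, hm, h⟩ := Metric.isOpen_iff.1 hc.isClosed.isOpen_compl 0 h0
        refine ⟨m, hm, fun x hx => ?_⟩
        by_contra hlt
        exact h (mem_ball_zero_iff.2 (not_le.1 hlt)) hx
      -- the representative of an orbit which is closer to a given point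
      let near : E → OrbitSpace (Subtype.val : A → E) → E := fun x ξ =>
        if dist (ξ.out : E) x < dist (-(ξ.out : E)) x then ξ.out else -ξ.out
      have hnear : ∀ (x : E) (ξ : OrbitSpace (Subtype.val : A → E)) (y : A), toOrbit y = ξ →
          dist (y : E) x < m → near x ξ = y := by
        rintro x _ y rfl hyx
        have hfar : m < dist (-(y : E)) x := by
          have h1 := dist_triangle (-(y : E)) x y
          have h2 : dist (-(y : E)) y = 2 * ‖(y : E)‖ := by
            rw [dist_eq_norm, show -(y : E) - y = (-2 : ℝ) • (y : E) by module, norm_smul]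
            norm_num
          have h3 := hmA y y.2
          rw [dist_comm x] at h1
          linarith
        have hout : (((toOrbit y).out : A) : E) = y ∨ (((toOrbit y).out : A) : E) = -y :=
          toOrbit_eq_iff.1 (Quotient.out_eq (toOrbit y)).symm
        simp only [near]
        rcases hout with h | h <;> rw [h]
        · rw [if_pos (hyx.trans hfar)]
        · rw [neg_neg, if_neg (not_lt.2 (hyx.trans hfar).le)]
      let χ : Cochain (OrbitSpace (Subtype.val : A → E)) k := fun ξ =>
        ψ (List.ofFn fun i => near ((ξ 0).out : A) (ξ i))
      have hχ : ∀ y : Fin (k + 1) → A, (∀ i j, dist (y i : E) (y j) < m) →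
          χ (fun i => toOrbit (y i)) = ψ (List.ofFn fun i => (y i : E)) := by
        intro y hy
        have hout : (((toOrbit (y 0)).out : A) : E) = y 0 ∨
            (((toOrbit (y 0)).out : A) : E) = -y 0 :=
          toOrbit_eq_iff.1 (Quotient.out_eq (toOrbit (y 0))).symm
        simp only [χ]
        rcases hout with h | h <;> rw [h]
        · congr 2
          funext i
          exact hnear _ _ _ rfl (hy i 0)
        · have hn : (fun i => near (-(y 0 : E)) (toOrbit (y i))) = fun i => -(y i : E) := by
            funext i
            refine hnear _ _ ⟨-y i, hA _ (y i).2⟩ ?_ ?_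
            · exact toOrbit_eq_iff.2 (Or.inr (by simp))
            · simpa only [dist_neg_neg] using hy i 0
          rw [hn, ← hψ (List.ofFn fun i => (y i : E)) (by simp), List.map_ofFn]
          · rfl
          · intro x hx
            obtain ⟨i, rfl⟩ := (List.mem_ofFn' _ _).1 hx
            exact (y i).2
      rw [← sub_add_cancel (cochainPullback (orbitMap f hodd) (k + 1) (cochainPow φ (k + 1)))
        (coboundary _ k χ)]
      refine Submodule.add_mem_sup ?_ ⟨χ, rfl⟩
      intro α
      obtain ⟨a, rfl⟩ : ∃ a, toOrbit a = α := Quotient.exists_rep α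
      refine ⟨_, image_ball_mem_nhds hA a (r := min m (min δ δ') / 2) (by positivity), ?_⟩
      intro ξ hξ
      choose y hy hyξ using hξ
      obtain rfl : (fun i => toOrbit (y i)) = ξ := funext hyξ
      have hd : ∀ i j, dist (y i : E) (y j) < min m (min δ δ') := by
        intro i j
        have h1 : dist (y i : E) a < min m (min δ δ') / 2 := hy i
        have h2 : dist (y j : E) a < min m (min δ δ') / 2 := hy j
        have h3 := dist_triangle_right (y i : E) (y j) a
        linarith
      rw [Pi.sub_apply, hpow y fun i j => (hd i j).trans_le
        ((min_le_right _ _).trans (min_le_left _ _)), h _ (by simp)]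
      · rw [← sum_succAbove_eq_listCobd]
        refine sub_eq_zero.2 (Finset.sum_congr rfl fun i _ => ?_)
        exact (hχ (fun j => y (i.succAbove j)) fun i' j =>
          (hd _ _).trans_le (min_le_left _ _)).symm
      · intro x hx
        obtain ⟨i, rfl⟩ := (List.mem_ofFn' _ _).1 hx
        exact (y i).2
      · intro x hx x' hx'
        obtain ⟨i, rfl⟩ := (List.mem_ofFn' _ _).1 hx
        obtain ⟨j, rfl⟩ := (List.mem_ofFn' _ _).1 hx'
        exact (hd i j).trans_le ((min_le_right _ _).trans (min_le_right _ _))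

/-- A compact symmetric set which does not contain the origin has an odd map to `S^∞`. -/
theorem exists_odd_map {A : Set E} (hc : IsCompact A) (h0 : (0 : E) ∉ A) :
    ∃ f : A → SphereInf, Continuous f ∧
      ∀ x y : A, (y : E) = -(x : E) → (f y).coord = -(f x).coord := by
  obtain ⟨r, hr, hrA⟩ : ∃ r > 0, ∀ x ∈ A, r ≤ ‖x‖ := by
    obtain ⟨m, hm, h⟩ := Metric.isOpen_iff.1 hc.isClosed.isOpen_compl 0 h0
    refine ⟨m, hm, fun x hx => ?_⟩
    by_contra hlt
    exact h (mem_ball_zero_iff.2 (not_le.1 hlt)) hx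
  obtain ⟨T, hTA, hT⟩ := hc.elim_nhds_subcover (fun x => Metric.ball x r)
    fun x _ => Metric.ball_mem_nhds x hr
  let e := T.equivFin
  -- the odd parts of bump functions supported in the balls of a finite cover are coordinates
  let lam : E → ℕ → ℝ := fun x i =>
    if h : i < T.card then max 0 (r - dist x (e.symm ⟨i, h⟩)) else 0
  have hlam : ∀ i, Continuous fun x => lam x i := by
    intro i
    by_cases h : i < T.card
    · simp only [lam, dif_pos h]
      fun_prop
    · simp only [lam, dif_neg h]
      fun_prop
  let v : E → ℕ →₀ ℝ := fun x => Finsupp.onFinset (Finset.range T.card)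
    (fun i => lam x i - lam (-x) i) (by
      intro i hi
      rw [Finset.mem_range]
      by_contra h
      simp [lam, h] at hi)
  have hv : ∀ x : A, v x ≠ 0 := by
    intro x hx
    obtain ⟨y, hy, hxy⟩ := mem_iUnion₂.1 (hT x.2)
    have h1 := DFunLike.congr_fun hx ((e ⟨y, hy⟩ : Fin T.card) : ℕ)
    simp only [v, lam, Finsupp.onFinset_apply, Fin.is_lt, dif_pos, Fin.eta, Equiv.symm_apply_apply,
      Finsupp.zero_apply] at h1
    rw [Metric.mem_ball] at hxy
    have h2 : dist (-(x : E)) y < r := by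
      by_contra h
      rw [max_eq_left (by linarith : r - dist (-(x : E)) y ≤ 0), sub_zero,
        max_eq_right (by linarith)] at h1
      linarith
    -- both `x` and `-x` are in the ball about `y`, hence so is their midpoint, the origin
    have h3 : (-2 : ℝ) • y = ((x : E) - y) + (-(x : E) - y) := by module
    have h4 := congrArg norm h3
    rw [norm_smul] at h4
    have h5 := norm_add_le ((x : E) - y) (-(x : E) - y)
    rw [dist_eq_norm] at hxy h2
    have h6 := hrA y (hTA y hy)
    norm_num at h4
    linarith
  refine ⟨fun x => SphereInf.normalize (v x) (hv x), ?_, ?_⟩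
  · refine SphereInf.continuous_normalize (y := fun x : A => v x) hv T.card ?_ ?_
    · intro x i hi
      simp [v, lam, not_lt.2 hi.le]
    · intro i
      exact ((hlam i).comp continuous_subtype_val).sub
        ((hlam i).comp (continuous_neg.comp continuous_subtype_val))
  · intro x y hxy
    have hneg : v y = -v x := by
      ext i
      simp [v, hxy]
    ext i
    rw [Finsupp.neg_apply, SphereInf.normalize_coord, SphereInf.normalize_coord, hneg,
      Finsupp.neg_apply, Finsupp.sum_neg_index (by simp)]
    simp

/-- The classes of characteristic cocycles are nonzero, as their restriction to a circle is. -/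
theorem IsCharacteristic.notMem_coboundaries {φ : Cochain RPInf 1} {θ : SphereInf → ZMod 2}
    (hφ : IsCharacteristic φ θ) : φ ∉ coboundaries RPInf 1 := by
  intro h
  obtain ⟨f, hf, hodd⟩ := exists_odd_map (isCompact_l1Sphere 1) (zero_notMem_l1Sphere 1)
  refine not_powVanishes_of_l1Sphere (N := 1) (g := id) continuousOn_id (fun _ _ => rfl)
    (mapsTo_id _) ((cochainPullback_mem_coboundaries_iff (isCompact_l1Sphere 1)
      (fun x hx => neg_mem_l1Sphere hx) (zero_notMem_l1Sphere 1) hφ hf hodd 1).1 ?_)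
  refine cochainPullback_coboundaries (continuous_orbitMap f hf hodd) ?_
  convert h using 1
  funext x
  rw [cochainPow_apply, Fin.prod_univ_one]
  congr 1
  funext i
  fin_cases i <;> rfl

/-- The index of a compact symmetric set in terms of cochains. -/
theorem succ_le_index_iff {A : Set E} (hc : IsCompact A) (hA : ∀ x ∈ A, -x ∈ A)
    (h0 : (0 : E) ∉ A) (m : ℕ) : ((m + 1 : ℕ) : ℕ∞) ≤ index A ↔ ¬ PowVanishes A m := by
  rw [index, if_neg h0]
  constructor
  · intro h hv
    have hle : ((m + 1 : ℕ) : ℕ∞) ≤ (m : ℕ) := by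
      refine h.trans (iSup₂_le fun k hk => ?_)
      obtain ⟨f, hf, hodd, w, hw, hk⟩ := hk
      obtain ⟨⟨φ, hφ⟩, rfl⟩ := Submodule.Quotient.mk_surjective _ w
      have hne : φ ∉ coboundaries RPInf 1 := fun h => hw ((Submodule.Quotient.mk_eq_zero _).2 h)
      obtain ⟨θ, hθ⟩ := exists_isCharacteristic hφ hne
      rw [Ne, pullback_cupPow_eq_zero_iff,
        cochainPullback_mem_coboundaries_iff hc hA h0 hθ hf hodd] at hk
      rw [Nat.cast_le]
      by_contra hlt
      exact hk (hv.mono (by omega))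
    rw [Nat.cast_le] at hle
    omega
  · intro hv
    obtain ⟨f, hf, hodd⟩ := exists_odd_map hc h0
    obtain ⟨φ, hφ, θ, hθ⟩ := exists_characteristic_cocycle
    refine le_iSup₂_of_le m ⟨f, hf, hodd, Submodule.Quotient.mk ⟨φ, hφ⟩, ?_, ?_⟩ le_rfl
    · intro h
      exact hθ.notMem_coboundaries ((mk_eq_zero_iff hφ).1 h)
    · rwa [Ne, pullback_cupPow_eq_zero_iff,
        cochainPullback_mem_coboundaries_iff hc hA h0 hθ hf hodd]

end Orbit

/-! ### Pull-back of Sobolev functions under similarities -/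

section LpComp

variable {X Y : Type*} [MeasurableSpace X] [MeasurableSpace Y] {μ : Measure X} {ν : Measure Y}
  {α : Y → X} {c : ℝ≥0∞}

theorem memLp_comp {E : Type*} [NormedAddCommGroup E] (hα : Measurable α) (hc : c ≠ ⊤)
    (h : ν.map α ≤ c • μ) {f : X → E} (hf : MemLp f 2 μ) : MemLp (f ∘ α) 2 ν :=
  (hf.of_measure_le_smul hc h).comp_of_map hα.aemeasurable

theorem ae_comp_eq {E : Type*} (hα : Measurable α) (h : ν.map α ≤ c • μ)
    {f g : X → E} (hfg : f =ᵐ[μ] g) :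
    f ∘ α =ᵐ[ν] g ∘ α := by
  have h1 : f =ᵐ[ν.map α] g :=
    (Measure.absolutelyContinuous_of_le h).ae_le (Measure.ae_smul_measure hfg c)
  exact ae_of_ae_map hα.aemeasurable h1

variable {E : Type*} [NormedAddCommGroup E] [NormedSpace ℝ E]

/-- Composition with a map `α` under which the image of the measure is dominated, as a continuous
linear map of `L²` spaces. -/
def lpComp (hα : Measurable α) (hc : c ≠ ⊤) (h : ν.map α ≤ c • μ) : Lp E 2 μ →L[ℝ] Lp E 2 ν :=
  LinearMap.mkContinuous
    { toFun := fun f => (memLp_comp hα hc h (Lp.memLp f)).toLp _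
      map_add' := fun f g => by
        rw [← MemLp.toLp_add]
        exact MemLp.toLp_congr _ _ (ae_comp_eq hα h (Lp.coeFn_add f g))
      map_smul' := fun a f => by
        rw [RingHom.id_apply, ← MemLp.toLp_const_smul]
        exact MemLp.toLp_congr _ _ (ae_comp_eq hα h (Lp.coeFn_smul a f)) }
    (c ^ ((1 : ℝ≥0∞) / 2).toReal).toReal fun f => by
      change ‖(memLp_comp hα hc h (Lp.memLp f)).toLp _‖ ≤ _
      rw [Lp.norm_toLp, Lp.norm_def, ← ENNReal.toReal_mul]
      refine ENNReal.toReal_mono ?_ ?_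
      · exact ENNReal.mul_ne_top (ENNReal.rpow_ne_top_of_nonneg ENNReal.toReal_nonneg hc)
          (Lp.eLpNorm_ne_top f)
      · rw [← eLpNorm_map_measure
          ((Lp.memLp f).of_measure_le_smul hc h).aestronglyMeasurable hα.aemeasurable]
        exact eLpNorm_le_of_measure_le_smul h

theorem coeFn_lpComp (hα : Measurable α) (hc : c ≠ ⊤) (h : ν.map α ≤ c • μ) (f : Lp E 2 μ) :
    lpComp hα hc h f =ᵐ[ν] fun x => f (α x) :=
  MemLp.coeFn_toLp (memLp_comp hα hc h (Lp.memLp f))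

end LpComp

section Similarity

variable {d : ℕ}

/-- The similarity `x ↦ a + t x`. -/
def similarity (a : Euc d) {t : ℝ} (ht : 0 < t) : Euc d ≃ₜ Euc d :=
  (Homeomorph.smulOfNeZero t ht.ne').trans (Homeomorph.addLeft a)

theorem similarity_apply (a : Euc d) {t : ℝ} (ht : 0 < t) (x : Euc d) :
    similarity a ht x = a + t • x := rfl

theorem similarity_symm_apply (a : Euc d) {t : ℝ} (ht : 0 < t) (y : Euc d) :
    (similarity a ht).symm y = t⁻¹ • (y - a) := by
  rw [Homeomorph.symm_apply_eq, similarity_apply, smul_smul, mul_inv_cancel₀ ht.ne', one_smul,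
    add_sub_cancel]

theorem map_similarity (a : Euc d) {t : ℝ} (ht : 0 < t) :
    (volume : Measure (Euc d)).map (similarity a ht) = ENNReal.ofReal (t ^ d)⁻¹ • volume := by
  have h1 : (similarity a ht : Euc d → Euc d) = (fun x => a + x) ∘ fun x => t • x := rfl
  rw [h1, ← Measure.map_map (measurable_const_add a) (measurable_const_smul t),
    Measure.map_addHaar_smul _ ht.ne', Measure.map_smul, map_add_left_eq_self,
    finrank_euclideanSpace_fin, abs_of_pos (by positivity)]

theorem map_restrict_similarity (a : Euc d) {t : ℝ} (ht : 0 < t) (S : Set (Euc d)) :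
    (volume.restrict S).map (similarity a ht) =
      ENNReal.ofReal (t ^ d)⁻¹ • volume.restrict (similarity a ht '' S) := by
  have h := (similarity a ht).measurableEmbedding.restrict_map volume (similarity a ht '' S)
  rw [(similarity a ht).injective.preimage_image] at h
  rw [← h, map_similarity, Measure.restrict_smul]

theorem map_similarity_le {Ω Ω' : Set (Euc d)} (a : Euc d) {t : ℝ} (ht : 0 < t)
    (h : MapsTo (similarity a ht) Ω' Ω) :
    (volume.restrict Ω').map (similarity a ht) ≤
      ENNReal.ofReal (t ^ d)⁻¹ • volume.restrict Ω := by
  rw [map_restrict_similarity]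
  exact Measure.le_iff.2 fun S _ => by
    simp only [Measure.smul_apply]
    gcongr
    exact h.image_subset

theorem integral_comp_similarity (a : Euc d) {t : ℝ} (ht : 0 < t) (H : Euc d → ℝ) :
    ∫ x, H (similarity a ht x) = (t ^ d)⁻¹ * ∫ x, H x := by
  have := Measure.integral_comp_smul (volume : Measure (Euc d)) (fun y => H (a + y)) t
  simp only [similarity_apply]
  rw [this, integral_add_left_eq_self, finrank_euclideanSpace_fin, abs_of_pos (by positivity),
    smul_eq_mul]

theorem lintegral_comp_similarity (a : Euc d) {t : ℝ} (ht : 0 < t) (S : Set (Euc d))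
    (F : Euc d → ℝ≥0∞) :
    ∫⁻ x in S, F (similarity a ht x) =
      ENNReal.ofReal (t ^ d)⁻¹ * ∫⁻ y in similarity a ht '' S, F y := by
  rw [← (similarity a ht).measurableEmbedding.lintegral_map F, map_restrict_similarity,
    lintegral_smul_measure, smul_eq_mul]

theorem setIntegral_comp_similarity {Ω Ω' : Set (Euc d)} (a : Euc d) {t : ℝ} (ht : 0 < t)
    (h : MapsTo (similarity a ht) Ω' Ω) (F G : Euc d → ℝ) (hG : ∀ x ∉ Ω', G x = 0) :
    ∫ x in Ω', F (similarity a ht x) * G x =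
      (t ^ d)⁻¹ * ∫ y in Ω, F y * G ((similarity a ht).symm y) := by
  rw [setIntegral_eq_integral_of_forall_compl_eq_zero fun x hx => by rw [hG x hx, mul_zero],
    setIntegral_eq_integral_of_forall_compl_eq_zero, ← integral_comp_similarity a ht]
  · simp only [Homeomorph.symm_apply_apply]
  · intro y hy
    rw [hG, mul_zero]
    intro hx
    exact hy (by simpa using h hx)

/-- The pull-back `u ↦ u (a + t ·)` from `H^1(Ω)` to `H^1(Ω')`, where `a + t Ω' ⊆ Ω`. -/
def H1.pull {Ω Ω' : Set (Euc d)} (a : Euc d) {t : ℝ} (ht : 0 < t)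
    (h : MapsTo (similarity a ht) Ω' Ω) : H1 Ω →L[ℝ] H1 Ω' :=
  (((lpComp (similarity a ht).measurable ENNReal.ofReal_ne_top (map_similarity_le a ht h)).prodMap
    (t • lpComp (similarity a ht).measurable ENNReal.ofReal_ne_top
      (map_similarity_le a ht h))).comp (H1 Ω).subtypeL).codRestrict (H1 Ω') (by
    intro v φ h1 h2 h3 i
    set α := similarity a ht with hα
    have hle := map_similarity_le a ht h
    have hαsymm : ∀ y, α.symm y = t⁻¹ • (y - a) := similarity_symm_apply a ht
    have hsupp : tsupport (φ ∘ α.symm) = α '' tsupport φ := by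
      rw [tsupport, tsupport, Function.support_comp_eq_preimage, ← α.image_eq_preimage_symm,
        α.image_closure]
    have c1 : ContDiff ℝ ∞ (φ ∘ α.symm) := by
      refine h1.comp ?_
      have : (α.symm : Euc d → Euc d) = fun y => t⁻¹ • (y - a) := funext hαsymm
      rw [this]
      fun_prop
    have c2 : HasCompactSupport (φ ∘ α.symm) := by
      rw [HasCompactSupport, hsupp]
      exact h2.isCompact.image α.continuous
    have c3 : tsupport (φ ∘ α.symm) ⊆ Ω := by
      rw [hsupp]
      exact (image_mono h3).trans h.image_subset
    -- the weak gradient of the pull-back is tested with `φ` by testing the one of `v` with the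
    -- transported function
    have key := v.2 _ c1 c2 c3 i
    have hfd : ∀ y, fderiv ℝ (φ ∘ α.symm) y (EuclideanSpace.single i 1) =
        t⁻¹ * fderiv ℝ φ (α.symm y) (EuclideanSpace.single i 1) := by
      intro y
      have e1 : HasFDerivAt α.symm (t⁻¹ • ContinuousLinearMap.id ℝ (Euc d)) y := by
        have : (α.symm : Euc d → Euc d) = fun y => t⁻¹ • (y - a) := funext hαsymm
        rw [this]
        exact ((hasFDerivAt_id y).sub_const a).const_smul t⁻¹
      have e2 := ((h1.differentiable (by simp)) (α.symm y)).hasFDerivAt.comp y e1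
      rw [e2.fderiv]
      simp
    have n1 : ∀ x ∉ Ω', φ x = 0 := fun x hx => image_eq_zero_of_notMem_tsupport fun h => hx (h3 h)
    have n2 : ∀ x ∉ Ω', fderiv ℝ φ x (EuclideanSpace.single i 1) = 0 := by
      intro x hx
      have : x ∉ tsupport (fderiv ℝ φ) := fun h => hx (h3 (tsupport_fderiv_subset ℝ h))
      rw [image_eq_zero_of_notMem_tsupport this]
      rfl
    have e1 : ∫ x in Ω', (lpComp α.measurable ENNReal.ofReal_ne_top hle v.1.1) x *
        fderiv ℝ φ x (EuclideanSpace.single i 1) =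
        ∫ x in Ω', v.1.1 (α x) * fderiv ℝ φ x (EuclideanSpace.single i 1) := by
      refine integral_congr_ae ?_
      filter_upwards [coeFn_lpComp α.measurable ENNReal.ofReal_ne_top hle v.1.1] with x hx
      rw [hx]
    have e2 : ∫ x in Ω', (t • lpComp α.measurable ENNReal.ofReal_ne_top hle v.1.2) x i * φ x =
        ∫ x in Ω', (t * v.1.2 (α x) i) * φ x := by
      refine integral_congr_ae ?_
      filter_upwards [coeFn_lpComp α.measurable ENNReal.ofReal_ne_top hle v.1.2,
        Lp.coeFn_smul t (lpComp α.measurable ENNReal.ofReal_ne_top hle v.1.2)] with x hx hx'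
      rw [hx', Pi.smul_apply, hx, PiLp.smul_apply, smul_eq_mul]
    change ∫ x in Ω', (lpComp α.measurable ENNReal.ofReal_ne_top hle v.1.1) x *
        fderiv ℝ φ x (EuclideanSpace.single i 1) =
      -∫ x in Ω', (t • lpComp α.measurable ENNReal.ofReal_ne_top hle v.1.2) x i * φ x
    rw [e1, e2, setIntegral_comp_similarity a ht h (fun y => v.1.1 y) _ n2,
      setIntegral_comp_similarity a ht h (fun y => t * v.1.2 y i) _ n1]
    simp only [hfd, Function.comp] at key
    have e3 : ∫ y in Ω, v.1.1 y * fderiv ℝ φ (α.symm y) (EuclideanSpace.single i 1) =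
        t * ∫ y in Ω, v.1.1 y * (t⁻¹ * fderiv ℝ φ (α.symm y) (EuclideanSpace.single i 1)) := by
      rw [← integral_const_mul]
      refine integral_congr_ae (Eventually.of_forall fun y => ?_)
      simp only
      field_simp
    have e4 : ∫ y in Ω, (t * v.1.2 y i) * φ (α.symm y) =
        t * ∫ y in Ω, v.1.2 y i * φ (α.symm y) := by
      rw [← integral_const_mul]
      refine integral_congr_ae (Eventually.of_forall fun y => ?_)
      simp only
      ring
    rw [← hα, e3, e4, key]
    ring)

theorem H1.pull_fst {Ω Ω' : Set (Euc d)} (a : Euc d) {t : ℝ} (ht : 0 < t)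
    (h : MapsTo (similarity a ht) Ω' Ω) (v : H1 Ω) :
    (H1.pull a ht h v).1.1 =ᵐ[volume.restrict Ω'] fun x => v.1.1 (similarity a ht x) :=
  coeFn_lpComp (similarity a ht).measurable ENNReal.ofReal_ne_top (map_similarity_le a ht h) v.1.1

theorem H1.pull_snd {Ω Ω' : Set (Euc d)} (a : Euc d) {t : ℝ} (ht : 0 < t)
    (h : MapsTo (similarity a ht) Ω' Ω) (v : H1 Ω) :
    (H1.pull a ht h v).1.2 =ᵐ[volume.restrict Ω'] fun x => t • v.1.2 (similarity a ht x) := by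
  filter_upwards [coeFn_lpComp (similarity a ht).measurable ENNReal.ofReal_ne_top
    (map_similarity_le a ht h) v.1.2, Lp.coeFn_smul t (lpComp (similarity a ht).measurable
      ENNReal.ofReal_ne_top (map_similarity_le a ht h) v.1.2)] with x hx hx'
  exact hx'.trans (by rw [Pi.smul_apply, hx])

attribute [irreducible] H1.pull

/-- The energy density. -/
def energyDensity (W : ℝ → ℝ) (ε : ℝ) {Ω : Set (Euc d)} (v : H1 Ω) (x : Euc d) : ℝ≥0∞ :=
  ENNReal.ofReal (ε * ‖v.1.2 x‖ ^ 2 / 2 + W (v.1.1 x) / ε)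

/-- The behaviour of the energy under scaling. -/
theorem energy_pull {n : ℕ} (W : ℝ → ℝ) (ε : ℝ) {Ω Ω' : Set (Euc (n + 1))} (a : Euc (n + 1))
    {t : ℝ} (ht : 0 < t) (h : MapsTo (similarity a ht) Ω' Ω) (v : H1 Ω) :
    ENNReal.ofReal (t ^ n) * energy W (ε / t) Ω' (H1.pull a ht h v) =
      ∫⁻ x in similarity a ht '' Ω', energyDensity W ε v x := by
  have hdens : ∀ r w : ℝ, ε / t * (t * r) ^ 2 / 2 + w / (ε / t) =
      t * (ε * r ^ 2 / 2 + w / ε) := by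
    intro r w
    rw [div_div_eq_mul_div]
    field_simp
  have e1 : energy W (ε / t) Ω' (H1.pull a ht h v) =
      ∫⁻ x in Ω', ENNReal.ofReal t * energyDensity W ε v (similarity a ht x) := by
    refine lintegral_congr_ae ?_
    filter_upwards [H1.pull_fst a ht h v, H1.pull_snd a ht h v] with x h1 h2
    simp only [h1, h2, energyDensity]
    rw [← ENNReal.ofReal_mul ht.le, norm_smul, Real.norm_eq_abs, abs_of_pos ht, hdens]
  have e2 : ∫⁻ x in Ω', ENNReal.ofReal t * energyDensity W ε v (similarity a ht x) =
      ENNReal.ofReal t * (ENNReal.ofReal (t ^ (n + 1))⁻¹ *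
        ∫⁻ x in similarity a ht '' Ω', energyDensity W ε v x) := by
    rw [lintegral_const_mul' _ _ ENNReal.ofReal_ne_top, lintegral_comp_similarity a ht Ω'
      (energyDensity W ε v)]
  rw [e1, e2]
  generalize ∫⁻ x in similarity a ht '' Ω', energyDensity W ε v x = I
  rw [← mul_assoc, ← mul_assoc, ← ENNReal.ofReal_mul (by positivity),
    ← ENNReal.ofReal_mul (by positivity), ← pow_succ, mul_inv_cancel₀ (by positivity),
    ENNReal.ofReal_one, one_mul]

end Similarity

/-! ### The min-max values -/

section Minmax

variable {d : ℕ} {W : ℝ → ℝ}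

/-- The sublevel sets of the energy are closed, by Fatou's lemma. -/
theorem isClosed_energy_le (hW : Continuous W) (ε : ℝ) {Ω : Set (Euc d)} (c : ℝ≥0∞) :
    IsClosed {v : H1 Ω | energy W ε Ω v ≤ c} := by
  refine IsSeqClosed.isClosed fun v w hv hvw => ?_
  have h1 : Tendsto (fun n => (v n).1.1) atTop (𝓝 w.1.1) :=
    ((continuous_fst.comp continuous_subtype_val).tendsto w).comp hvw
  have h2 : Tendsto (fun n => (v n).1.2) atTop (𝓝 w.1.2) :=
    ((continuous_snd.comp continuous_subtype_val).tendsto w).comp hvw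
  obtain ⟨r, hr, hr'⟩ := (tendstoInMeasure_of_tendsto_Lp h1).exists_seq_tendsto_ae
  obtain ⟨s, hs, hs'⟩ :=
    (tendstoInMeasure_of_tendsto_Lp (h2.comp hr.tendsto_atTop)).exists_seq_tendsto_ae
  have hm : ∀ n, AEMeasurable (fun x => ENNReal.ofReal
      (ε * ‖(v (r (s n))).1.2 x‖ ^ 2 / 2 + W ((v (r (s n))).1.1 x) / ε)) (volume.restrict Ω) := by
    intro n
    have m1 := (Lp.aestronglyMeasurable (v (r (s n))).1.2).norm.aemeasurable
    have m2 := hW.measurable.comp_aemeasurable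
      (Lp.aestronglyMeasurable (v (r (s n))).1.1).aemeasurable
    exact (((m1.pow_const 2).const_mul ε |>.div_const 2).add (m2.div_const ε)).ennreal_ofReal
  calc energy W ε Ω w
      = ∫⁻ x in Ω, liminf (fun n => ENNReal.ofReal
        (ε * ‖(v (r (s n))).1.2 x‖ ^ 2 / 2 + W ((v (r (s n))).1.1 x) / ε)) atTop := by
        refine lintegral_congr_ae ?_
        filter_upwards [hr', hs'] with x hx hx'
        refine (Tendsto.liminf_eq ?_).symm
        refine (ENNReal.continuous_ofReal.tendsto _).comp ?_
        have t1 := hx.comp hs.tendsto_atTop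
        have t2 : Tendsto (fun n => ‖(v (r (s n))).1.2 x‖) atTop (𝓝 ‖w.1.2 x‖) := hx'.norm
        exact (((t2.pow 2).const_mul ε).div_const 2).add
          (((hW.tendsto _).comp t1).div_const ε)
    _ ≤ liminf (fun n => energy W ε Ω (v (r (s n)))) atTop := lintegral_liminf_le' hm
    _ ≤ c := by
        refine liminf_le_of_frequently_le' (Frequently.of_forall fun n => ?_)
        exact hv _

theorem energy_neg (hWe : ∀ x, W (-x) = W x) (ε : ℝ) {Ω : Set (Euc d)} (v : H1 Ω) :
    energy W ε Ω (-v) = energy W ε Ω v := by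
  refine lintegral_congr_ae ?_
  filter_upwards [Lp.coeFn_neg v.1.1, Lp.coeFn_neg v.1.2] with x h1 h2
  have h1' : (-v).1.1 x = -v.1.1 x := h1
  have h2' : (-v).1.2 x = -v.1.2 x := h2
  rw [h1', h2', hWe, norm_neg]

theorem energy_zero (W : ℝ → ℝ) (ε : ℝ) (Ω : Set (Euc d)) :
    energy W ε Ω 0 = ENNReal.ofReal (W 0 / ε) * volume Ω := by
  have : energy W ε Ω 0 = ∫⁻ _ in Ω, ENNReal.ofReal (W 0 / ε) := by
    refine lintegral_congr_ae ?_
    filter_upwards [Lp.coeFn_zero ℝ 2 (volume.restrict Ω),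
      Lp.coeFn_zero (Euc d) 2 (volume.restrict Ω)] with x h1 h2
    have h1' : (0 : H1 Ω).1.1 x = 0 := h1
    have h2' : (0 : H1 Ω).1.2 x = 0 := h2
    rw [h1', h2']
    simp
  rw [this, lintegral_const, Measure.restrict_apply_univ]

theorem singleton_zero_mem_sweepouts (Ω : Set (Euc d)) (p : ℕ) :
    ({0} : Set (H1 Ω)) ∈ sweepouts Ω p := by
  refine ⟨isCompact_singleton, fun v hv => ?_, ?_⟩
  · rw [mem_singleton_iff.1 hv, neg_zero]
    rfl
  · rw [index, if_pos (mem_singleton _)]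
    exact le_top

theorem minmax_le_energy_zero (W : ℝ → ℝ) (ε : ℝ) (p : ℕ) (Ω : Set (Euc d)) :
    minmax W ε p Ω ≤ energy W ε Ω 0 := by
  refine (iInf₂_le _ (singleton_zero_mem_sweepouts Ω p)).trans ?_
  simp

theorem minmax_ne_top (W : ℝ → ℝ) (ε : ℝ) (p : ℕ) {Ω : Set (Euc d)} (hΩ : volume Ω ≠ ⊤) :
    minmax W ε p Ω ≠ ⊤ := by
  refine ((minmax_le_energy_zero W ε p Ω).trans_lt ?_).ne
  rw [energy_zero]
  exact (ENNReal.mul_ne_top ENNReal.ofReal_ne_top hΩ).lt_top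

theorem minmax_mono (W : ℝ → ℝ) (ε : ℝ) {p q : ℕ} (hpq : p ≤ q) (Ω : Set (Euc d)) :
    minmax W ε p Ω ≤ minmax W ε q Ω := by
  refine iInf_le_iInf_of_subset fun A hA => ⟨hA.1, hA.2.1, le_trans ?_ hA.2.2⟩
  exact_mod_cast Nat.succ_le_succ hpq

/-- The image of a symmetric set of large index under an odd map is a sweepout. -/
theorem image_mem_sweepouts {E : Type*} [NormedAddCommGroup E] [NormedSpace ℝ E] {A : Set E}
    (hc : IsCompact A) (hA : ∀ x ∈ A, -x ∈ A) {p : ℕ} {Ω : Set (Euc d)} {g : E → H1 Ω}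
    (hg : ContinuousOn g A) (hodd : ∀ x ∈ A, g (-x) = -g x)
    (hv : ¬ PowVanishes (g '' A) p) : g '' A ∈ sweepouts Ω p := by
  have hsym : ∀ v ∈ g '' A, -v ∈ g '' A := by
    rintro _ ⟨x, hx, rfl⟩
    exact ⟨-x, hA x hx, hodd x hx⟩
  refine ⟨hc.image_of_continuousOn hg, hsym, ?_⟩
  by_cases h0 : (0 : H1 Ω) ∈ g '' A
  · rw [index, if_pos h0]
    exact le_top
  · exact (succ_le_index_iff (hc.image_of_continuousOn hg) hsym h0 p).2 hv

/-- A symmetric set is not covered by closed symmetric sets whose indices add up to less than its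
own. -/
theorem exists_forall_notMem {E ι : Type*} [NormedAddCommGroup E] [NormedSpace ℝ E] {A : Set E}
    (hc : IsCompact A) (hA : ∀ x ∈ A, -x ∈ A) (h0 : (0 : E) ∉ A) (s : Finset ι) (B : ι → Set E)
    (p : ι → ℕ) (hB : ∀ i, IsClosed (B i)) (hBs : ∀ i, ∀ x ∈ B i, -x ∈ B i)
    (h : ∀ i ∈ s, PowVanishes (A ∩ B i) (p i)) (hv : ¬ PowVanishes A (∑ i ∈ s, p i)) :
    ∃ x ∈ A, ∀ i ∈ s, x ∉ B i := by
  classical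
  by_contra hcon
  push Not at hcon
  have key : ∀ t ⊆ s, PowVanishes (A ∩ ⋃ i ∈ t, B i) (∑ i ∈ t, p i) := by
    intro t
    induction t using Finset.induction_on with
    | empty => simp [PowVanishes]
    | insert a t ha ih =>
      intro hts
      rw [Finset.set_biUnion_insert, inter_union_distrib_left, Finset.sum_insert ha]
      refine (h a (hts (Finset.mem_insert_self _ _))).union ?_ ?_ ?_ ?_ (fun h => h0 h.1)
        (fun h => h0 h.1) (ih ((Finset.subset_insert _ _).trans hts))
      · exact fun x hx => ⟨hA x hx.1, hBs a x hx.2⟩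
      · rintro x ⟨hx, hx'⟩
        obtain ⟨i, hi, hxi⟩ := mem_iUnion₂.1 hx'
        exact ⟨hA x hx, mem_iUnion₂.2 ⟨i, hi, hBs i x hxi⟩⟩
      · exact hc.isClosed.inter (hB a)
      · exact hc.isClosed.inter (t.finite_toSet.isClosed_biUnion fun i _ => hB i)
  have := key s subset_rfl
  rw [inter_eq_left.2 fun x hx => ?_] at this
  · exact hv this
  · obtain ⟨i, hi, hxi⟩ := hcon x hx
    exact mem_iUnion₂.2 ⟨i, hi, hxi⟩

theorem isClosed_energy_add_le (hW : Continuous W) (ε : ℝ) {Ω : Set (Euc d)} (δ : ℝ≥0)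
    (c : ℝ≥0∞) : IsClosed {v : H1 Ω | energy W ε Ω v + δ ≤ c} := by
  by_cases hle : (δ : ℝ≥0∞) ≤ c
  · have : {v : H1 Ω | energy W ε Ω v + δ ≤ c} = {v : H1 Ω | energy W ε Ω v ≤ c - δ} := by
      ext v
      exact (ENNReal.cancel_coe.le_tsub_iff_right hle).symm
    rw [this]
    exact isClosed_energy_le hW _ _
  · have : {v : H1 Ω | energy W ε Ω v + δ ≤ c} = ∅ :=
      eq_empty_of_forall_notMem fun v hv => hle (le_trans le_add_self hv)
    rw [this]
    exact isClosed_empty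

/-- The part of a symmetric compact set that an odd map sends to functions of energy strictly
below the min-max value has small index. -/
theorem powVanishes_inter_energy_add_le (hW : Continuous W) (hWe : ∀ x, W (-x) = W x) (ε : ℝ)
    {E : Type*} [NormedAddCommGroup E] [NormedSpace ℝ E] {A : Set E} (hc : IsCompact A)
    (hA : ∀ x ∈ A, -x ∈ A) {Ω : Set (Euc d)} (hΩ : volume Ω ≠ ⊤) (g : E →L[ℝ] H1 Ω) (p : ℕ)
    {δ : ℝ≥0} (hδ : 0 < δ) :
    PowVanishes (A ∩ {x | energy W ε Ω (g x) + δ ≤ minmax W ε p Ω}) p := by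
  have hc' : IsCompact (A ∩ {x | energy W ε Ω (g x) + δ ≤ minmax W ε p Ω}) :=
    hc.inter_right ((isClosed_energy_add_le hW ε δ _).preimage g.continuous)
  have hodd : ∀ x, g (-x) = -g x := map_neg g
  generalize hB : A ∩ {x | energy W ε Ω (g x) + δ ≤ minmax W ε p Ω} = B at hc'
  have hle : ∀ x ∈ B, energy W ε Ω (g x) + δ ≤ minmax W ε p Ω := by
    rw [← hB]
    exact fun x hx => hx.2
  have hsym : ∀ x ∈ B, -x ∈ B := by
    rw [← hB]
    refine fun x hx => ⟨hA x hx.1, ?_⟩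
    rw [mem_ofPred_eq, hodd, energy_neg hWe]
    exact hx.2
  by_contra hvi
  have hmem := image_mem_sweepouts (p := p) hc' hsym g.continuous.continuousOn
    (fun x _ => hodd x) fun h => hvi (h.of_map hc' g.continuous.continuousOn (fun x _ => hodd x)
      (mapsTo_image _ _))
  obtain ⟨x₀, hx₀⟩ : B.Nonempty := by
    by_contra hne
    exact hvi (PowVanishes.mono (Nat.zero_le _) (not_nonempty_iff_eq_empty.1 hne))
  have hle' : minmax W ε p Ω ≤ minmax W ε p Ω - δ := by
    refine (iInf₂_le _ hmem).trans (iSup₂_le ?_)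
    rintro _ ⟨x, hx, rfl⟩
    exact ENNReal.le_sub_of_add_le_right ENNReal.coe_ne_top (hle x hx)
  have hδM : (δ : ℝ≥0∞) ≤ minmax W ε p Ω := le_trans le_add_self (hle x₀ hx₀)
  have hδ0 : (δ : ℝ≥0∞) ≠ 0 := by exact_mod_cast hδ.ne'
  refine absurd hle' (not_le.2 (ENNReal.sub_lt_self (minmax_ne_top _ _ _ hΩ) ?_ hδ0))
  exact fun h => hδ0 (nonpos_iff_eq_zero.1 (h ▸ hδM))

theorem sum_energy_pull_le {n : ℕ} (W : ℝ → ℝ) (ε : ℝ) {ι : Type*} (s : Finset ι)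
    {Ω : Set (Euc (n + 1))} (Ω' : ι → Set (Euc (n + 1)))
    (hΩ' : ∀ i, IsOpen (Ω' i)) (a : ι → Euc (n + 1)) (t : ι → ℝ)
    (ht : ∀ i, 0 < t i) (hmap : ∀ i, MapsTo (similarity (a i) (ht i)) (Ω' i) Ω)
    (hdisj : (s : Set ι).PairwiseDisjoint fun i => similarity (a i) (ht i) '' Ω' i) (v : H1 Ω) :
    ∑ i ∈ s, ENNReal.ofReal (t i ^ n) *
      energy W (ε / t i) (Ω' i) (H1.pull (a i) (ht i) (hmap i) v) ≤ energy W ε Ω v := by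
  have e : ∀ i ∈ s, ENNReal.ofReal (t i ^ n) *
      energy W (ε / t i) (Ω' i) (H1.pull (a i) (ht i) (hmap i) v) =
      ∫⁻ x in similarity (a i) (ht i) '' Ω' i, energyDensity W ε v x := fun i _ =>
    energy_pull W ε (a i) (ht i) (hmap i) v
  rw [Finset.sum_congr rfl e, ← lintegral_biUnion_finset hdisj fun i _ =>
    ((similarity (a i) (ht i)).isOpenMap _ (hΩ' i)).measurableSet]
  exact lintegral_mono_set (iUnion₂_subset fun i _ => (hmap i).image_subset)

/-- The abstract form of the Lusternik-Schnirelmann inequality: in every sweepout of index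
`∑ p i + 1` there is a function whose image under each of the maps `g i` has almost the min-max
energy, since otherwise the sweepout is covered by sets of index `p i`. -/
theorem sum_mul_minmax_le (hW : Continuous W) (hWe : ∀ x, W (-x) = W x) (ε : ℝ) {ι : Type*}
    (s : Finset ι) {Ω : Set (Euc d)} (Ω' : ι → Set (Euc d)) (hfin : ∀ i, volume (Ω' i) ≠ ⊤)
    (c : ι → ℝ≥0) (η : ι → ℝ) (p : ι → ℕ) (g : ∀ i, H1 Ω →L[ℝ] H1 (Ω' i))
    (hE : ∀ v, ∑ i ∈ s, c i * energy W (η i) (Ω' i) (g i v) ≤ energy W ε Ω v) :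
    ∑ i ∈ s, c i * minmax W (η i) (p i) (Ω' i) ≤ minmax W ε (∑ i ∈ s, p i) Ω := by
  refine le_iInf₂ fun A hA => ?_
  obtain ⟨hc, hsym, hind⟩ := hA
  by_cases h0 : (0 : H1 Ω) ∈ A
  · refine le_trans ?_ ((hE 0).trans (le_iSup₂_of_le 0 h0 le_rfl))
    gcongr with i hi
    rw [map_zero]
    exact minmax_le_energy_zero _ _ _ _
  have hv := (succ_le_index_iff hc hsym h0 _).1 hind
  refine ENNReal.le_of_forall_pos_le_add fun r hr _ => ?_
  obtain ⟨δ, hδ, hδr⟩ : ∃ δ : ℝ≥0, 0 < δ ∧ δ * ∑ i ∈ s, c i ≤ r := by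
    refine ⟨r / (1 + ∑ i ∈ s, c i), by positivity, ?_⟩
    rw [div_mul_eq_mul_div, div_le_iff₀ (by positivity)]
    gcongr
    exact le_add_self
  obtain ⟨v, hvA, hvB⟩ := exists_forall_notMem hc hsym h0 s
    (fun i => {v | energy W (η i) (Ω' i) (g i v) + δ ≤ minmax W (η i) (p i) (Ω' i)}) p
    (fun i => (isClosed_energy_add_le hW _ δ _).preimage (g i).continuous)
    (fun i v hv => by
      rw [mem_ofPred_eq, map_neg, energy_neg hWe]
      exact hv)
    (fun i _ => powVanishes_inter_energy_add_le hW hWe _ hc hsym (hfin i) (g i) (p i) hδ) hv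
  have h1 : ∑ i ∈ s, c i * minmax W (η i) (p i) (Ω' i) ≤
      ∑ i ∈ s, c i * (energy W (η i) (Ω' i) (g i v) + δ) :=
    Finset.sum_le_sum fun i hi => mul_le_mul_right (not_le.1 (hvB i hi)).le _
  have h2 : ∀ e : ι → ℝ≥0∞, ∑ i ∈ s, c i * (e i + δ) =
      ∑ i ∈ s, c i * e i + (δ * ∑ i ∈ s, c i : ℝ≥0) := by
    intro e
    push_cast
    rw [Finset.mul_sum, ← Finset.sum_add_distrib]
    exact Finset.sum_congr rfl fun i _ => by ring
  have h3 : energy W ε Ω v ≤ ⨆ v ∈ A, energy W ε Ω v :=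
    le_iSup₂ (f := fun v (_ : v ∈ A) => energy W ε Ω v) v hvA
  exact (h1.trans (h2 _).le).trans (add_le_add ((hE v).trans h3) (ENNReal.coe_le_coe.2 hδr))

/-- The Lusternik-Schnirelmann inequality: the min-max values are superadditive with respect to
disjoint similar copies `a i + t i • Ω' i` of domains inside `Ω`. -/
theorem sum_minmax_le {n : ℕ} {W : ℝ → ℝ} (hW : Continuous W)
    (hWe : ∀ x, W (-x) = W x) (ε : ℝ) {ι : Type*} (s : Finset ι) {Ω : Set (Euc (n + 1))}
    (Ω' : ι → Set (Euc (n + 1))) (hΩ' : ∀ i, IsOpen (Ω' i)) (hfin : ∀ i, volume (Ω' i) ≠ ⊤)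
    (a : ι → Euc (n + 1)) (t : ι → ℝ) (ht : ∀ i, 0 < t i)
    (hmap : ∀ i, MapsTo (similarity (a i) (ht i)) (Ω' i) Ω)
    (hdisj : (s : Set ι).PairwiseDisjoint fun i => similarity (a i) (ht i) '' Ω' i) (p : ι → ℕ) :
    ∑ i ∈ s, ENNReal.ofReal (t i ^ n) * minmax W (ε / t i) (p i) (Ω' i) ≤
      minmax W ε (∑ i ∈ s, p i) Ω :=
  sum_mul_minmax_le hW hWe ε s Ω' hfin (fun i => (t i ^ n).toNNReal) (fun i => ε / t i) p
    (fun i => H1.pull (a i) (ht i) (hmap i))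
    (sum_energy_pull_le W ε s Ω' hΩ' a t ht hmap hdisj)

end Minmax

/-! ### Smooth functions in `H^1` -/

section Smooth

variable {d : ℕ}

theorem gradient_apply (u : Euc d → ℝ) (x : Euc d) (i : Fin d) :
    gradient u x i = fderiv ℝ u x (EuclideanSpace.single i 1) := by
  have h := InnerProductSpace.toDual_symm_apply (𝕜 := ℝ) (x := EuclideanSpace.single i (1 : ℝ))
    (y := fderiv ℝ u x)
  rw [EuclideanSpace.inner_single_right] at h
  simpa [gradient] using h

theorem norm_gradient (u : Euc d → ℝ) (x : Euc d) : ‖gradient u x‖ = ‖fderiv ℝ u x‖ := by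
  rw [gradient, LinearIsometryEquiv.norm_map]

theorem continuous_gradient {u : Euc d → ℝ} (hu : ContDiff ℝ 1 u) : Continuous (gradient u) :=
  (InnerProductSpace.toDual ℝ (Euc d)).symm.continuous.comp (hu.continuous_fderiv (by simp))

/-- A continuously differentiable function that is square integrable together with its gradient
defines an element of `H^1`. -/
theorem toLp_mem_H1 {Ω : Set (Euc d)} {u : Euc d → ℝ} (hu : ContDiff ℝ 1 u)
    (h1 : MemLp u 2 (volume.restrict Ω)) (h2 : MemLp (gradient u) 2 (volume.restrict Ω)) :
    (h1.toLp u, h2.toLp (gradient u)) ∈ H1 Ω := by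
  intro φ hφ hc hs i
  have hφ' : Continuous fun x => fderiv ℝ φ x (EuclideanSpace.single i 1) :=
    (hφ.continuous_fderiv (by simp)).clm_apply continuous_const
  have hc' : HasCompactSupport fun x => fderiv ℝ φ x (EuclideanSpace.single i 1) :=
    hc.fderiv_apply ℝ _
  have hu' : Continuous fun x => fderiv ℝ u x (EuclideanSpace.single i 1) :=
    (hu.continuous_fderiv (by simp)).clm_apply continuous_const
  have e1 : ∫ x in Ω, h1.toLp u x * fderiv ℝ φ x (EuclideanSpace.single i 1) =
      ∫ x, u x * fderiv ℝ φ x (EuclideanSpace.single i 1) := by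
    refine (integral_congr_ae ?_).trans (setIntegral_eq_integral_of_forall_compl_eq_zero ?_)
    · filter_upwards [h1.coeFn_toLp] with x hx
      rw [hx]
    · intro x hx
      rw [image_eq_zero_of_notMem_tsupport fun h => hx (hs (tsupport_fderiv_subset ℝ h))]
      simp
  have e2 : ∫ x in Ω, h2.toLp (gradient u) x i * φ x =
      ∫ x, fderiv ℝ u x (EuclideanSpace.single i 1) * φ x := by
    refine (integral_congr_ae ?_).trans (setIntegral_eq_integral_of_forall_compl_eq_zero ?_)
    · filter_upwards [h2.coeFn_toLp] with x hx
      rw [hx, gradient_apply]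
    · intro x hx
      rw [image_eq_zero_of_notMem_tsupport fun h => hx (hs h), mul_zero]
  rw [e1, e2]
  exact integral_mul_fderiv_eq_neg_fderiv_mul_of_integrable
    ((hu'.mul hφ.continuous).integrable_of_hasCompactSupport hc.mul_left)
    ((hu.continuous.mul hφ').integrable_of_hasCompactSupport hc'.mul_left)
    ((hu.continuous.mul hφ.continuous).integrable_of_hasCompactSupport hc.mul_left)
    (fun x _ => hu.differentiable (by simp) x) (fun x _ => hφ.differentiable (by simp) x)

/-- Dominated convergence in `L²` of a set of finite measure. -/
theorem tendsto_toLp_of_ae {E ι : Type*} [NormedAddCommGroup E] {l : Filter ι}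
    [l.IsCountablyGenerated] {Ω : Set (Euc d)} (hΩ : volume Ω ≠ ⊤) {f : ι → Euc d → E}
    {g : Euc d → E} (hf : ∀ j, MemLp (f j) 2 (volume.restrict Ω))
    (hg : MemLp g 2 (volume.restrict Ω)) {M : ℝ} (hfM : ∀ j x, ‖f j x‖ ≤ M)
    (hgM : ∀ x, ‖g x‖ ≤ M) (h : ∀ x, Tendsto (fun j => f j x) l (𝓝 (g x))) :
    Tendsto (fun j => (hf j).toLp (f j)) l (𝓝 (hg.toLp g)) := by
  rw [Lp.tendsto_Lp_iff_tendsto_eLpNorm'']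
  have key : Tendsto (fun j => ∫⁻ x in Ω, ‖(f j - g) x‖ₑ ^ (2 : ℝ)) l (𝓝 (∫⁻ _ in Ω, 0)) := by
    have : IsFiniteMeasure (volume.restrict Ω) :=
      ⟨by rw [Measure.restrict_apply_univ]; exact hΩ.lt_top⟩
    refine tendsto_lintegral_filter_of_dominated_convergence'
      (fun _ => ENNReal.ofReal (M + M) ^ (2 : ℝ)) ?_ ?_ ?_ ?_
    · exact Eventually.of_forall fun j =>
        ((hf j).1.sub hg.1).enorm.pow_const _
    · refine Eventually.of_forall fun j => Eventually.of_forall fun x => ?_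
      gcongr
      rw [← ofReal_norm]
      exact ENNReal.ofReal_le_ofReal ((norm_sub_le _ _).trans (add_le_add (hfM j x) (hgM x)))
    · rw [lintegral_const, Measure.restrict_apply_univ]
      exact ENNReal.mul_ne_top (ENNReal.rpow_ne_top_of_nonneg (by norm_num) ENNReal.ofReal_ne_top)
        hΩ
    · refine Eventually.of_forall fun x => ?_
      have h0 : Tendsto (fun j => ‖(f j - g) x‖ₑ) l (𝓝 0) := by
        have := ((h x).sub_const (g x)).enorm
        simpa using this
      have := (ENNReal.continuous_rpow_const (y := 2)).tendsto 0 |>.comp h0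
      simpa [Function.comp_def] using this
  rw [lintegral_zero] at key
  have h2 := (ENNReal.continuous_rpow_const (y := 1 / 2)).tendsto 0 |>.comp key
  rw [ENNReal.zero_rpow_of_pos (by norm_num)] at h2
  refine h2.congr fun j => ?_
  rw [eLpNorm_eq_lintegral_rpow_enorm_toReal (by norm_num) (by norm_num)]
  simp

end Smooth

/-! ### Mollification -/

section Mollify

open scoped Convolution

variable {d : ℕ}

/-- A smooth bump function supported in the unit ball. -/
def bump (d : ℕ) : ContDiffBump (0 : Euc d) := ⟨1 / 2, 1, by norm_num, by norm_num⟩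

/-- The mollifier: a smooth probability density supported in the unit ball. -/
def kernel (d : ℕ) : Euc d → ℝ := (bump d).normed volume

theorem contDiff_kernel : ContDiff ℝ 1 (kernel d) := (bump d).contDiff_normed (n := 1)

theorem hasCompactSupport_kernel : HasCompactSupport (kernel d) := (bump d).hasCompactSupport_normed

theorem norm_convolution_le {F : Type*} [NormedAddCommGroup F] [NormedSpace ℝ F] 
    {f : Euc d → F} (hf : Continuous f) (hc : HasCompactSupport f) (L : F →L[ℝ] ℝ →L[ℝ] F)
    {g : Euc d → ℝ} (hg : ∀ x, |g x| ≤ 1) (x : Euc d) :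
    ‖(f ⋆[L, volume] g) x‖ ≤ ‖L‖ * ∫ y, ‖f y‖ := by
  rw [convolution_def, ← integral_const_mul]
  refine norm_integral_le_of_norm_le
    ((hf.norm.integrable_of_hasCompactSupport hc.norm).const_mul _)
    (Eventually.of_forall fun y => ?_)
  refine (L.le_opNorm₂ _ _).trans ?_
  exact mul_le_of_le_one_right (by positivity) (hg _)

theorem tendsto_convolution {F ι : Type*} [NormedAddCommGroup F] [NormedSpace ℝ F]
    {l : Filter ι} [l.IsCountablyGenerated]
    {f : Euc d → F} (hf : Continuous f) (hc : HasCompactSupport f) (L : F →L[ℝ] ℝ →L[ℝ] F)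
    {g : ι → Euc d → ℝ} {g' : Euc d → ℝ} (hm : ∀ j, Measurable (g j)) (hg : ∀ j x, |g j x| ≤ 1)
    (h : ∀ᵐ x, Tendsto (fun j => g j x) l (𝓝 (g' x))) (x : Euc d) :
    Tendsto (fun j => (f ⋆[L, volume] g j) x) l (𝓝 ((f ⋆[L, volume] g') x)) := by
  simp only [convolution_def]
  refine tendsto_integral_filter_of_dominated_convergence (fun y => ‖L‖ * ‖f y‖) ?_ ?_ ?_ ?_
  · refine Eventually.of_forall fun j => ?_
    have h1 : StronglyMeasurable fun t => g j (x - t) :=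
      ((hm j).comp (measurable_const.sub measurable_id)).stronglyMeasurable
    exact (L.aestronglyMeasurable_comp₂ 
      (hf.integrable_of_hasCompactSupport (μ := volume) hc).1 h1.aestronglyMeasurable)
  · refine Eventually.of_forall fun j => Eventually.of_forall fun y => ?_
    refine (L.le_opNorm₂ _ _).trans ?_
    exact mul_le_of_le_one_right (by positivity) (hg _ _)
  · exact (hf.norm.integrable_of_hasCompactSupport hc.norm).const_mul _
  · have := (quasiMeasurePreserving_sub_left volume x).ae h
    filter_upwards [this] with y hy
    exact ((L (f y)).continuous.tendsto _).comp hy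

/-- The mollification of `V` at scale `ε`. -/
def mollify (ε : ℝ) (V : Euc d → ℝ) (x : Euc d) : ℝ :=
  (kernel d ⋆[ContinuousLinearMap.lsmul ℝ ℝ, volume] fun y => V (ε • y)) (ε⁻¹ • x)

variable {ε : ℝ} {V : Euc d → ℝ}

theorem locallyIntegrable_comp_smul (hV : Measurable V) (hV1 : ∀ x, |V x| ≤ 1) (ε : ℝ) :
    LocallyIntegrable (fun y : Euc d => V (ε • y)) volume := by
  refine (locallyIntegrable_const (1 : ℝ)).mono
    (hV.comp (measurable_const_smul ε)).aestronglyMeasurable (Eventually.of_forall fun y => ?_)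
  simpa using hV1 _

theorem contDiff_mollify (hV : Measurable V) (hV1 : ∀ x, |V x| ≤ 1) :
    ContDiff ℝ 1 (mollify ε V) :=
  (hasCompactSupport_kernel.contDiff_convolution_left (n := 1) _ contDiff_kernel
    (locallyIntegrable_comp_smul hV hV1 ε)).comp (contDiff_const_smul ε⁻¹)

theorem fderiv_mollify (hV : Measurable V) (hV1 : ∀ x, |V x| ≤ 1) (x : Euc d) :
    fderiv ℝ (mollify ε V) x = ε⁻¹ • (fderiv ℝ (kernel d) ⋆[ContinuousLinearMap.precompL (Euc d)
      (ContinuousLinearMap.lsmul ℝ ℝ), volume] fun y => V (ε • y)) (ε⁻¹ • x) := by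
  have h1 := hasCompactSupport_kernel.hasFDerivAt_convolution_left
    (ContinuousLinearMap.lsmul ℝ ℝ) contDiff_kernel
    (locallyIntegrable_comp_smul hV hV1 ε) (ε⁻¹ • x)
  have h2 : HasFDerivAt (fun x : Euc d => ε⁻¹ • x) (ε⁻¹ • ContinuousLinearMap.id ℝ (Euc d)) x :=
    (hasFDerivAt_id x).const_smul ε⁻¹
  have h3 := (h1.comp x h2).fderiv
  refine h3.trans ?_
  ext v
  simp

theorem abs_mollify_le (hV1 : ∀ x, |V x| ≤ 1) (x : Euc d) : |mollify ε V x| ≤ 1 := by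
  refine (norm_convolution_le contDiff_kernel.continuous hasCompactSupport_kernel _
    (fun _ => hV1 _) _).trans ?_
  have : ∫ y, ‖kernel d y‖ = 1 := by
    rw [← (bump d).integral_normed (μ := volume)]
    exact integral_congr_ae (Eventually.of_forall fun y =>
      Real.norm_of_nonneg ((bump d).nonneg_normed y))
  rw [this, mul_one]
  exact ContinuousLinearMap.opNorm_lsmul_le

theorem norm_gradient_mollify_le (hε : 0 < ε) (hV : Measurable V) (hV1 : ∀ x, |V x| ≤ 1)
    (x : Euc d) : ‖gradient (mollify ε V) x‖ ≤ ε⁻¹ * ∫ y, ‖fderiv ℝ (kernel d) y‖ := by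
  rw [norm_gradient, fderiv_mollify hV hV1, norm_smul, Real.norm_of_nonneg (by positivity)]
  gcongr
  refine (norm_convolution_le (contDiff_kernel.continuous_fderiv (by simp))
    (hasCompactSupport_kernel.fderiv ℝ) _ (fun _ => hV1 _) _).trans ?_
  refine mul_le_of_le_one_left (by positivity) ?_
  exact (ContinuousLinearMap.norm_precompL_le _ _).trans ContinuousLinearMap.opNorm_lsmul_le

theorem mollify_neg (ε : ℝ) (V : Euc d → ℝ) : mollify ε (-V) = -mollify ε V := by
  ext x
  simp [mollify, convolution_def, integral_neg]

/-- Where `V` is constant nearby, so is its mollification. -/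
theorem mollify_eq (hε : 0 < ε) {x : Euc d} (h : ∀ y ∈ Metric.ball x (2 * ε), V y = V x) :
    mollify ε V x = V x ∧ gradient (mollify ε V) x = 0 := by
  have key : ∀ y ∈ Metric.ball x ε, mollify ε V y = V x := by
    intro y hy
    have hxy : V y = V x := h y (Metric.ball_subset_ball (by linarith) hy)
    have hsm : ε • ε⁻¹ • y = y := smul_inv_smul₀ hε.ne' y
    refine ((bump d).normed_convolution_eq_right (g := fun y => V (ε • y)) fun z hz => ?_).trans ?_
    · simp only [hsm, hxy]
      refine h _ ?_
      have hz' : dist z (ε⁻¹ • y) < 1 := hz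
      have : dist (ε • z) (ε • ε⁻¹ • y) < ε := by
        rw [dist_smul₀, Real.norm_of_nonneg hε.le]
        nlinarith
      rw [hsm] at this
      have h2 := dist_triangle (ε • z) y x
      rw [Metric.mem_ball] at hy ⊢
      linarith
    · simp only [hsm, hxy]
  refine ⟨key x (Metric.mem_ball_self hε), ?_⟩
  have : mollify ε V =ᶠ[𝓝 x] fun _ => V x :=
    Filter.eventually_of_mem (Metric.ball_mem_nhds x hε) key
  rw [gradient, this.fderiv_eq]
  simp

theorem ae_comp_smul {P : Euc d → Prop} (hε : 0 < ε) (h : ∀ᵐ x, P x) : ∀ᵐ x, P (ε • x) := by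
  have h2 := ae_of_ae_map (similarity (0 : Euc d) hε).measurable.aemeasurable
    (p := P) (μ := volume) (by
      rw [map_similarity]
      exact Measure.ae_smul_measure h _)
  filter_upwards [h2] with x hx
  simpa [similarity] using hx

theorem tendsto_mollify {ι : Type*} {l : Filter ι} [l.IsCountablyGenerated] (hε : 0 < ε)
    {V : ι → Euc d → ℝ} {V' : Euc d → ℝ} (hV : ∀ j, Measurable (V j)) (hV1 : ∀ j x, |V j x| ≤ 1)
    (h : ∀ᵐ x, Tendsto (fun j => V j x) l (𝓝 (V' x))) (x : Euc d) :
    Tendsto (fun j => mollify ε (V j) x) l (𝓝 (mollify ε V' x)) :=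
  tendsto_convolution contDiff_kernel.continuous hasCompactSupport_kernel _
    (fun j => (hV j).comp (measurable_const_smul ε)) (fun j _ => hV1 j _) (ae_comp_smul hε h) _

theorem tendsto_gradient_mollify {ι : Type*} {l : Filter ι} [l.IsCountablyGenerated] (hε : 0 < ε)
    {V : ι → Euc d → ℝ} {V' : Euc d → ℝ} (hV : ∀ j, Measurable (V j)) (hV1 : ∀ j x, |V j x| ≤ 1)
    (hV' : Measurable V') (hV1' : ∀ x, |V' x| ≤ 1)
    (h : ∀ᵐ x, Tendsto (fun j => V j x) l (𝓝 (V' x))) (x : Euc d) :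
    Tendsto (fun j => gradient (mollify ε (V j)) x) l (𝓝 (gradient (mollify ε V') x)) := by
  refine ((LinearIsometryEquiv.continuous _).tendsto _).comp ?_
  simp only [fderiv_mollify (hV _) (hV1 _), fderiv_mollify hV' hV1']
  exact (tendsto_convolution (contDiff_kernel.continuous_fderiv (by simp))
    (hasCompactSupport_kernel.fderiv ℝ) _ (fun j => (hV j).comp (measurable_const_smul ε))
    (fun j _ => hV1 j _) (ae_comp_smul hε h) _).const_smul _

theorem memLp_mollify {Ω : Set (Euc d)} (hΩ : volume Ω ≠ ⊤) (hV : Measurable V)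
    (hV1 : ∀ x, |V x| ≤ 1) : MemLp (mollify ε V) 2 (volume.restrict Ω) := by
  have : IsFiniteMeasure (volume.restrict Ω) :=
    ⟨by rw [Measure.restrict_apply_univ]; exact hΩ.lt_top⟩
  exact MemLp.of_bound (contDiff_mollify hV hV1).continuous.aestronglyMeasurable 1
    (Eventually.of_forall (abs_mollify_le hV1))

theorem memLp_gradient_mollify {Ω : Set (Euc d)} (hΩ : volume Ω ≠ ⊤) (hε : 0 < ε)
    (hV : Measurable V) (hV1 : ∀ x, |V x| ≤ 1) :
    MemLp (gradient (mollify ε V)) 2 (volume.restrict Ω) := by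
  have : IsFiniteMeasure (volume.restrict Ω) :=
    ⟨by rw [Measure.restrict_apply_univ]; exact hΩ.lt_top⟩
  exact MemLp.of_bound (continuous_gradient (contDiff_mollify hV hV1)).aestronglyMeasurable _
    (Eventually.of_forall (norm_gradient_mollify_le hε hV hV1))

/-- The mollification of a measurable function with values in `[-1, 1]` as an element of `H^1`. -/
def H1.mollify {Ω : Set (Euc d)} (hΩ : volume Ω ≠ ⊤) (hε : 0 < ε) (hV : Measurable V)
    (hV1 : ∀ x, |V x| ≤ 1) : H1 Ω :=
  ⟨_, toLp_mem_H1 (contDiff_mollify hV hV1) (memLp_mollify hΩ hV hV1)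
    (memLp_gradient_mollify hΩ hε hV hV1)⟩

theorem H1.tendsto_mollify {ι : Type*} {l : Filter ι} [l.IsCountablyGenerated] {Ω : Set (Euc d)}
    (hΩ : volume Ω ≠ ⊤) (hε : 0 < ε)
    {V : ι → Euc d → ℝ} {V' : Euc d → ℝ} (hV : ∀ j, Measurable (V j)) (hV1 : ∀ j x, |V j x| ≤ 1)
    (hV' : Measurable V') (hV1' : ∀ x, |V' x| ≤ 1)
    (h : ∀ᵐ x, Tendsto (fun j => V j x) l (𝓝 (V' x))) :
    Tendsto (fun j => H1.mollify hΩ hε (hV j) (hV1 j)) l (𝓝 (H1.mollify hΩ hε hV' hV1')) := by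
  refine tendsto_subtype_rng.2 (Tendsto.prodMk_nhds ?_ ?_)
  · exact tendsto_toLp_of_ae hΩ _ _ (fun j x => abs_mollify_le (hV1 j) x)
      (abs_mollify_le hV1') (AllenCahn.tendsto_mollify hε hV hV1 h)
  · exact tendsto_toLp_of_ae hΩ _ _ (fun j x => norm_gradient_mollify_le hε (hV j) (hV1 j) x)
      (norm_gradient_mollify_le hε hV' hV1') (tendsto_gradient_mollify hε hV hV1 hV' hV1' h)

theorem H1.mollify_neg {Ω : Set (Euc d)} (hΩ : volume Ω ≠ ⊤) (hε : 0 < ε) (hV : Measurable V)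
    (hV1 : ∀ x, |V x| ≤ 1) {V' : Euc d → ℝ} (hV' : Measurable V') (hV1' : ∀ x, |V' x| ≤ 1)
    (h : V' = -V) : H1.mollify (ε := ε) hΩ hε hV' hV1' = -H1.mollify hΩ hε hV hV1 := by
  subst h
  refine Subtype.ext (Prod.ext ?_ ?_)
  · refine (MemLp.toLp_congr (memLp_mollify hΩ hV' hV1') (memLp_mollify hΩ hV hV1).neg ?_).trans
      (MemLp.toLp_neg (memLp_mollify hΩ hV hV1))
    rw [AllenCahn.mollify_neg]
  · refine (MemLp.toLp_congr (memLp_gradient_mollify hΩ hε hV' hV1')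
      (memLp_gradient_mollify hΩ hε hV hV1).neg ?_).trans
        (MemLp.toLp_neg (memLp_gradient_mollify hΩ hε hV hV1))
    refine Eventually.of_forall fun x => ?_
    rw [AllenCahn.mollify_neg, gradient, Pi.neg_apply, gradient, fderiv_neg, map_neg]

/-- The energy of the mollification of a function with values `±1` is controlled by the measure
of the set of points near which the function is not constant. -/
theorem energy_mollify_le {W : ℝ → ℝ} {M : ℝ} (hM : ∀ t, |t| ≤ 1 → W t ≤ M)
    (h1 : W 1 = 0) (h2 : W (-1) = 0) {Ω : Set (Euc d)} (hΩ : volume Ω ≠ ⊤) (hΩo : MeasurableSet Ω)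
    (hε : 0 < ε)
    (hV : Measurable V) (hV1 : ∀ x, |V x| ≤ 1) {B : Set (Euc d)}
    (hB : ∀ x ∈ Ω, x ∉ B → (V x = 1 ∨ V x = -1) ∧ ∀ y ∈ Metric.ball x (2 * ε), V y = V x) :
    energy W ε Ω (H1.mollify hΩ hε hV hV1) ≤
      ENNReal.ofReal (((∫ y, ‖fderiv ℝ (kernel d) y‖) ^ 2 / 2 + M) / ε) * volume B := by
  refine le_trans ?_ ((lintegral_indicator_const_le (μ := volume) B _))
  refine le_trans ?_ (setLIntegral_le_lintegral Ω _)
  refine lintegral_mono_ae ?_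
  filter_upwards [(memLp_mollify (ε := ε) hΩ hV hV1).coeFn_toLp,
    (memLp_gradient_mollify hΩ hε hV hV1).coeFn_toLp, ae_restrict_mem hΩo] with x e1 e2 hx
  have e1' : (H1.mollify hΩ hε hV hV1).1.1 x = mollify ε V x := e1
  have e2' : (H1.mollify hΩ hε hV hV1).1.2 x = gradient (mollify ε V) x := e2
  rw [e1', e2']
  by_cases hxB : x ∈ B
  · rw [indicator_of_mem hxB]
    refine ENNReal.ofReal_le_ofReal ?_
    have g1 := norm_gradient_mollify_le hε hV hV1 x
    have g2 := hM _ (abs_mollify_le (ε := ε) hV1 x)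
    have g3 : ‖gradient (mollify ε V) x‖ ^ 2 ≤ (ε⁻¹ * ∫ y, ‖fderiv ℝ (kernel d) y‖) ^ 2 := by
      gcongr
    calc ε * ‖gradient (mollify ε V) x‖ ^ 2 / 2 + W (mollify ε V x) / ε
        ≤ ε * (ε⁻¹ * ∫ y, ‖fderiv ℝ (kernel d) y‖) ^ 2 / 2 + M / ε := by gcongr
      _ = _ := by field_simp
  · obtain ⟨h3, h4⟩ := hB x hx hxB
    rw [indicator_of_notMem hxB, (mollify_eq hε h4).1, (mollify_eq hε h4).2]
    rcases h3 with h3 | h3 <;> simp [h3, h1, h2]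

end Mollify

/-! ### Sweepouts of the unit cube by polynomials -/

section Cube

variable {d : ℕ}

theorem volume_setOf_forall_mem (s : Fin d → Set ℝ) :
    volume {x : Euc d | ∀ i, x i ∈ s i} = ∏ i, volume (s i) := by
  rw [← volume_pi_pi s, ← (EuclideanSpace.volume_preserving_symm_measurableEquiv_toLp
    (Fin d)).measure_preimage_equiv]
  congr 1
  ext x
  simp

/-- The open unit cube. -/
def unitCube (d : ℕ) : Set (Euc d) := {x | ∀ i, x i ∈ Ioo (0 : ℝ) 1}

theorem isOpen_unitCube : IsOpen (unitCube d) := by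
  have : unitCube d = ⋂ i, (fun x : Euc d => x i) ⁻¹' Ioo 0 1 := by
    ext x
    simp [unitCube]
  rw [this]
  exact isOpen_iInter_of_finite fun i => isOpen_Ioo.preimage (by fun_prop)

theorem volume_unitCube : volume (unitCube d) = 1 := by
  rw [unitCube, volume_setOf_forall_mem (fun _ => Ioo 0 1)]
  simp

/-- The measure of a slab in the unit cube. -/
theorem volume_slab_le (i : Fin d) (s : Set ℝ) :
    volume {x ∈ unitCube d | x i ∈ s} ≤ volume s := by
  classical
  calc volume {x ∈ unitCube d | x i ∈ s}
      ≤ volume {x : Euc d | ∀ j, x j ∈ Function.update (fun _ => Ioo (0 : ℝ) 1) i s j} := by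
        refine measure_mono fun x hx j => ?_
        rcases eq_or_ne j i with rfl | hj
        · simpa using hx.2
        · simpa [hj] using hx.1 j
    _ = volume s := by
        rw [volume_setOf_forall_mem, Fintype.prod_eq_single i fun j hj => by simp [hj]]
        simp

end Cube

section Polynomial

variable {N : ℕ}

/-- The value at `t` of the polynomial with coefficients `a`. -/
def polyEval (a : Fin (N + 1) → ℝ) (t : ℝ) : ℝ := ∑ i, a i * t ^ (i : ℕ)

theorem continuous_polyEval (a : Fin (N + 1) → ℝ) : Continuous (polyEval a) := by
  unfold polyEval
  fun_prop

theorem continuous_polyEval_left (t : ℝ) :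
    Continuous fun a : Fin (N + 1) → ℝ => polyEval a t := by
  unfold polyEval
  fun_prop

theorem polyEval_neg (a : Fin (N + 1) → ℝ) (t : ℝ) : polyEval (-a) t = -polyEval a t := by
  simp [polyEval]

open Polynomial in
theorem exists_finset_roots {a : Fin (N + 1) → ℝ} (ha : a ≠ 0) :
    ∃ R : Finset ℝ, R.card ≤ N ∧ ∀ t, polyEval a t = 0 → t ∈ R := by
  set P : ℝ[X] := ∑ i, C (a i) * X ^ (i : ℕ) with hP
  have hev : ∀ t, P.eval t = polyEval a t := fun t => by
    simp [hP, polyEval, eval_finsetSum]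
  have h0 : P ≠ 0 := by
    intro h
    refine ha (funext fun i => ?_)
    have h1 : P.coeff i = 0 := by rw [h, coeff_zero]
    rw [hP, finsetSum_coeff, Finset.sum_eq_single i] at h1
    · simpa using h1
    · intro j _ hj
      rw [coeff_C_mul, coeff_X_pow, if_neg fun h => hj (Fin.ext h.symm), mul_zero]
    · simp
  have hdeg : P.natDegree ≤ N :=
    natDegree_sum_le_of_forall_le _ _ fun i _ =>
      (natDegree_C_mul_X_pow_le _ _).trans (Nat.lt_succ_iff.1 i.2)
  classical
  refine ⟨P.roots.toFinset, (Multiset.toFinset_card_le _).trans ((card_roots' P).trans hdeg),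
    fun t ht => ?_⟩
  rw [Multiset.mem_toFinset, mem_roots h0, IsRoot.def, hev, ht]

theorem tendsto_sign {ι : Type*} {l : Filter ι} {f : ι → ℝ} {y : ℝ} (hy : y ≠ 0)
    (h : Tendsto f l (𝓝 y)) : Tendsto (fun j => Real.sign (f j)) l (𝓝 (Real.sign y)) := by
  refine tendsto_const_nhds.congr' ?_
  rcases lt_or_gt_of_ne hy with hy | hy
  · filter_upwards [h.eventually (eventually_lt_nhds hy)] with j hj
    rw [Real.sign_of_neg hy, Real.sign_of_neg hj]
  · filter_upwards [h.eventually (eventually_gt_nhds hy)] with j hj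
    rw [Real.sign_of_pos hy, Real.sign_of_pos hj]

theorem sign_eq_of_forall_ne_zero {f : ℝ → ℝ} (hf : Continuous f) {x y : ℝ}
    (h : ∀ t ∈ uIcc x y, f t ≠ 0) : Real.sign (f x) = Real.sign (f y) := by
  have h1 : (0 : ℝ) ∉ uIcc (f x) (f y) := fun h0 => by
    obtain ⟨t, ht, ht0⟩ := intermediate_value_uIcc hf.continuousOn h0
    exact h t ht ht0
  have hx := h x left_mem_uIcc
  have hy := h y right_mem_uIcc
  rcases lt_or_gt_of_ne hx with hx | hx <;> rcases lt_or_gt_of_ne hy with hy | hy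
  · rw [Real.sign_of_neg hx, Real.sign_of_neg hy]
  · exact absurd (mem_uIcc.2 (Or.inl ⟨hx.le, hy.le⟩)) h1
  · exact absurd (mem_uIcc.2 (Or.inr ⟨hy.le, hx.le⟩)) h1
  · rw [Real.sign_of_pos hx, Real.sign_of_pos hy]

theorem measurable_sign : Measurable Real.sign :=
  Measurable.ite measurableSet_Iio measurable_const
    (Measurable.ite measurableSet_Ioi measurable_const measurable_const)

theorem abs_sign_le (t : ℝ) : |Real.sign t| ≤ 1 := by
  rcases Real.sign_apply_eq t with h | h | h <;> rw [h] <;> norm_num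

end Polynomial

section Sweepout

variable {n N : ℕ}

/-- A number encoding the column `ℝ × ∏ [z i / k, (z i + 1) / k)` of `ℝ^(n+1)` that contains a
point. -/
def column (k : ℕ) (x : Euc (n + 1)) : ℕ := Encodable.encode fun i : Fin n => ⌊(k : ℝ) * x i.succ⌋

/-- The position of a point when the columns of `unitCube` are laid out one after the other
along the real line. -/
def position (k : ℕ) (x : Euc (n + 1)) : ℝ := column k x + x 0

theorem measurable_position (k : ℕ) : Measurable (position (n := n) k) := by
  have h1 : Measurable fun x : Euc (n + 1) => fun i : Fin n => ⌊(k : ℝ) * x i.succ⌋ :=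
    measurable_pi_iff.2 fun i => Int.measurable_floor.comp (by fun_prop)
  have h2 : Measurable fun x : Euc (n + 1) => (column k x : ℝ) :=
    (measurable_of_countable fun z : Fin n → ℤ => (Encodable.encode z : ℝ)).comp h1
  exact h2.add (by fun_prop)

/-- The function on `ℝ^(n+1)` taking the values `±1` according to the sign of a polynomial at the
position of a point. -/
def polySign (k : ℕ) (a : Fin (N + 1) → ℝ) (x : Euc (n + 1)) : ℝ :=
  Real.sign (polyEval a (position k x))

theorem measurable_polySign (k : ℕ) (a : Fin (N + 1) → ℝ) :
    Measurable (polySign (n := n) k a) :=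
  measurable_sign.comp ((continuous_polyEval a).measurable.comp (measurable_position k))

theorem abs_polySign_le (k : ℕ) (a : Fin (N + 1) → ℝ) (x : Euc (n + 1)) :
    |polySign k a x| ≤ 1 := abs_sign_le _

theorem polySign_neg (k : ℕ) (a : Fin (N + 1) → ℝ) :
    polySign (n := n) k (-a) = -polySign k a := by
  ext x
  rw [Pi.neg_apply, polySign, polySign, polyEval_neg, Real.sign_neg]

theorem ae_polyEval_position_ne_zero (k : ℕ) {a : Fin (N + 1) → ℝ} (ha : a ≠ 0) :
    ∀ᵐ x : Euc (n + 1), polyEval a (position k x) ≠ 0 := by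
  obtain ⟨R, -, hR⟩ := exists_finset_roots ha
  have h0 : ∀ c : ℝ, volume {x : Euc (n + 1) | x 0 = c} = 0 := by
    intro c
    refine measure_mono_null (t := {x : Euc (n + 1) | ∀ j, x j ∈
      (Fin.cons {c} fun _ => univ : Fin (n + 1) → Set ℝ) j}) (fun x hx j => ?_) ?_
    · refine Fin.cases ?_ (fun j => ?_) j
      · simpa using hx
      · simp
    · rw [volume_setOf_forall_mem]
      exact Finset.prod_eq_zero (Finset.mem_univ 0) (by simp)
  have h1 : volume (⋃ r ∈ R, ⋃ m : ℕ, {x : Euc (n + 1) | x 0 = r - m}) = 0 :=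
    (measure_biUnion_null_iff R.countable_toSet).2 fun r _ =>
      measure_iUnion_null fun m => h0 _
  rw [ae_iff]
  refine measure_mono_null (fun x hx => ?_) h1
  simp only [ne_eq, not_not, mem_ofPred_eq] at hx
  refine mem_iUnion₂.2 ⟨_, hR _ hx, mem_iUnion.2 ⟨column k x, ?_⟩⟩
  simp [position]

theorem ae_tendsto_polySign (k : ℕ) {a : Fin (N + 1) → ℝ} (ha : a ≠ 0)
    {ι : Type*} {l : Filter ι} {b : ι → Fin (N + 1) → ℝ} (hb : Tendsto b l (𝓝 a)) :
    ∀ᵐ x : Euc (n + 1), Tendsto (fun j => polySign k (b j) x) l (𝓝 (polySign k a x)) := by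
  filter_upwards [ae_polyEval_position_ne_zero k ha] with x hx
  exact tendsto_sign hx (((continuous_polyEval_left _).tendsto a).comp hb)

/-- The part of the unit cube near the walls of the columns. -/
def nearWalls (n k : ℕ) (δ : ℝ) : Set (Euc (n + 1)) :=
  ⋃ i : Fin n, ⋃ j ∈ Finset.range (k + 1),
    {x ∈ unitCube (n + 1) | x i.succ ∈ Icc ((j : ℝ) / k - δ) ((j : ℝ) / k + δ)}

theorem volume_nearWalls_le (n k : ℕ) (δ : ℝ) :
    volume (nearWalls n k δ) ≤ ENNReal.ofReal (n * (k + 1) * (2 * δ)) := by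
  calc volume (nearWalls n k δ)
      ≤ ∑ _i : Fin n, ∑ _j ∈ Finset.range (k + 1), ENNReal.ofReal (2 * δ) := by
        refine (measure_iUnion_fintype_le _ _).trans (Finset.sum_le_sum fun i _ => ?_)
        refine (measure_biUnion_finset_le _ _).trans (Finset.sum_le_sum fun j _ => ?_)
        refine (volume_slab_le _ _).trans ?_
        rw [Real.volume_Icc]
        exact ENNReal.ofReal_le_ofReal (by linarith)
    _ = _ := by
        rw [Finset.sum_const, Finset.sum_const, Finset.card_univ, Fintype.card_fin,
          Finset.card_range, ← ENNReal.ofReal_nsmul, ← ENNReal.ofReal_nsmul]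
        congr 1
        simp only [nsmul_eq_mul]
        push_cast
        ring

theorem floor_eq_of_notMem_nearWalls {k : ℕ} (hk : 0 < k) {δ : ℝ} {x y : Euc (n + 1)}
    (hx : x ∈ unitCube (n + 1)) (hxw : x ∉ nearWalls n k δ) (hy : y ∈ Metric.ball x δ)
    (i : Fin n) : ⌊(k : ℝ) * y i.succ⌋ = ⌊(k : ℝ) * x i.succ⌋ := by
  have hk' : (0 : ℝ) < k := by exact_mod_cast hk
  have hxy : |y i.succ - x i.succ| < δ := by
    have h1 := PiLp.norm_apply_le (y - x) i.succ
    rw [Metric.mem_ball, dist_eq_norm] at hy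
    exact h1.trans_lt hy
  have hw : ∀ j : ℕ, j ≤ k → (j : ℝ) / k ∉ Icc (x i.succ - δ) (x i.succ + δ) := by
    intro j hj hm
    refine hxw (mem_iUnion.2 ⟨i, mem_iUnion₂.2 ⟨j, Finset.mem_range.2 (by omega), hx, ?_⟩⟩)
    exact ⟨by linarith [hm.2], by linarith [hm.1]⟩
  obtain ⟨m, hm⟩ : ∃ m : ℕ, ⌊(k : ℝ) * x i.succ⌋ = m :=
    ⟨_, (Int.toNat_of_nonneg (Int.floor_nonneg.2 (mul_nonneg hk'.le (hx i.succ).1.le))).symm⟩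
  obtain ⟨h1, h2⟩ := Int.floor_eq_iff.1 hm
  rw [Int.cast_natCast] at h1 h2
  have hmk : m < k := by
    have : (m : ℝ) < k := by nlinarith [(hx i.succ).2]
    exact_mod_cast this
  obtain ⟨h3, h4⟩ := abs_lt.1 hxy
  have a1 : (m : ℝ) / k ≤ x i.succ := by rw [div_le_iff₀ hk']; linarith
  have a2 : x i.succ < ((m + 1 : ℕ) : ℝ) / k := by
    rw [lt_div_iff₀ hk']
    push_cast
    linarith
  have b1 : (m : ℝ) / k < x i.succ - δ := by
    by_contra hcon
    exact hw m hmk.le ⟨not_lt.1 hcon, by linarith⟩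
  have b2 : x i.succ + δ < ((m + 1 : ℕ) : ℝ) / k := by
    by_contra hcon
    exact hw (m + 1) hmk ⟨by linarith, not_lt.1 hcon⟩
  rw [hm, Int.floor_eq_iff, Int.cast_natCast]
  have c1 : (m : ℝ) / k < y i.succ := by linarith
  have c2 : y i.succ < ((m + 1 : ℕ) : ℝ) / k := by linarith
  rw [div_lt_iff₀ hk'] at c1
  rw [lt_div_iff₀ hk'] at c2
  push_cast at c2
  exact ⟨by linarith, by linarith⟩

/-- A level set of the position has small measure in the unit cube, since it meets only few
columns. -/
theorem volume_position_mem_le {k : ℕ} (hk : 0 < k) {δ : ℝ} (hδ : δ ≤ 1 / 2)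
    (r : ℝ) :
    volume {x ∈ unitCube (n + 1) | position k x ∈ Icc (r - δ) (r + δ)} ≤
      ENNReal.ofReal (4 * (2 * δ * (1 / k) ^ n)) := by
  have hk' : (0 : ℝ) < k := by exact_mod_cast hk
  -- in one column the position is confined to a box with one side `2 δ` and the others `1 / k`
  have hT : ∀ m : ℤ, volume {x : Euc (n + 1) | (column k x : ℤ) = m ∧
      position k x ∈ Icc (r - δ) (r + δ)} ≤ ENNReal.ofReal (2 * δ * (1 / k) ^ n) := by
    intro m
    rcases eq_empty_or_nonempty {x : Euc (n + 1) | (column k x : ℤ) = m ∧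
      position k x ∈ Icc (r - δ) (r + δ)} with h | ⟨z, hz, -⟩
    · rw [h, measure_empty]
      exact zero_le
    refine (measure_mono (t := {x : Euc (n + 1) | ∀ j, x j ∈ (Fin.cons
      (Icc (r - m - δ) (r - m + δ)) fun i : Fin n => Ico (⌊(k : ℝ) * z i.succ⌋ / k : ℝ)
        ((⌊(k : ℝ) * z i.succ⌋ + 1) / k) : Fin (n + 1) → Set ℝ) j}) fun x hx j => ?_).trans ?_
    · obtain ⟨hx1, hx2⟩ := hx
      refine Fin.cases ?_ (fun j => ?_) j
      · have : position k x = m + x 0 := by rw [position, ← hx1, Int.cast_natCast]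
        rw [this] at hx2
        exact ⟨by linarith [hx2.1], by linarith [hx2.2]⟩
      · have hxz : column k x = column k z := by exact_mod_cast hx1.trans hz.symm
        have h1 : ⌊(k : ℝ) * x j.succ⌋ = ⌊(k : ℝ) * z j.succ⌋ :=
          congrFun (Encodable.encode_injective hxz) j
        obtain ⟨h2, h3⟩ := Int.floor_eq_iff.1 h1
        refine ⟨?_, ?_⟩
        · rw [div_le_iff₀ hk']
          linarith
        · rw [lt_div_iff₀ hk']
          linarith
    · rw [volume_setOf_forall_mem, Fin.prod_univ_succ]
      simp only [Fin.cons_zero, Fin.cons_succ, Real.volume_Icc, Real.volume_Ico]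
      have e1 : ∀ i : Fin n, ENNReal.ofReal (((⌊(k : ℝ) * z i.succ⌋ : ℝ) + 1) / k -
          ⌊(k : ℝ) * z i.succ⌋ / k) = ENNReal.ofReal (1 / k) := by
        intro i
        congr 1
        ring
      rw [Finset.prod_congr rfl fun i _ => e1 i, Finset.prod_const, Finset.card_univ,
        Fintype.card_fin, ← ENNReal.ofReal_pow (by positivity),
        ← ENNReal.ofReal_mul' (by positivity)]
      refine ENNReal.ofReal_le_ofReal (le_of_eq ?_)
      ring
  -- column `m` occupies positions in `(m, m + 1)`, so only `⌊r⌋ - 2 ≤ m ≤ ⌊r⌋ + 1` contribute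
  calc volume {x ∈ unitCube (n + 1) | position k x ∈ Icc (r - δ) (r + δ)}
      ≤ volume (⋃ m ∈ Finset.Icc (⌊r⌋ - 2) (⌊r⌋ + 1), {x : Euc (n + 1) |
          (column k x : ℤ) = m ∧ position k x ∈ Icc (r - δ) (r + δ)}) := by
        refine measure_mono fun x hx => ?_
        refine mem_iUnion₂.2 ⟨column k x, ?_, rfl, hx.2⟩
        obtain ⟨h1, h2⟩ := hx.1 0
        obtain ⟨h3, h4⟩ := hx.2
        rw [position] at h3 h4
        have f1 := Int.floor_le r
        have f2 := Int.lt_floor_add_one r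
        rw [Finset.mem_Icc]
        constructor
        · have : ((⌊r⌋ - 2 : ℤ) : ℝ) < ((column k x : ℤ) : ℝ) + 1 := by
            push_cast
            linarith
          exact Int.lt_add_one_iff.1 (by exact_mod_cast this)
        · have : ((column k x : ℤ) : ℝ) < ((⌊r⌋ + 1 : ℤ) : ℝ) + 1 := by
            push_cast
            linarith
          exact Int.lt_add_one_iff.1 (by exact_mod_cast this)
    _ ≤ ∑ _m ∈ Finset.Icc (⌊r⌋ - 2) (⌊r⌋ + 1), ENNReal.ofReal (2 * δ * (1 / k) ^ n) :=
        (measure_biUnion_finset_le _ _).trans (Finset.sum_le_sum fun m _ => hT m)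
    _ = _ := by
        rw [Finset.sum_const, Int.card_Icc, ← ENNReal.ofReal_nsmul]
        have : (⌊r⌋ + 1 + 1 - (⌊r⌋ - 2)).toNat = 4 := by
          rw [show ⌊r⌋ + 1 + 1 - (⌊r⌋ - 2) = 4 by ring]
          rfl
        rw [this]
        simp

/-- The set of points near which the sign of a polynomial of degree `N` may change has small
measure: each of its roots contributes a piece of a level set of the position. -/
theorem exists_polySign_eq_of_notMem {k : ℕ} (hk : 0 < k) {a : Fin (N + 1) → ℝ} (ha : a ≠ 0)
    {δ : ℝ} (hδ : 0 < δ) (hδ' : δ ≤ 1 / 2) :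
    ∃ B : Set (Euc (n + 1)),
      volume B ≤ ENNReal.ofReal (n * (k + 1) * (2 * δ) + N * (4 * (2 * δ * (1 / k) ^ n))) ∧
      ∀ x ∈ unitCube (n + 1), x ∉ B → (polySign k a x = 1 ∨ polySign k a x = -1) ∧
        ∀ y ∈ Metric.ball x δ, polySign k a y = polySign k a x := by
  obtain ⟨R, hRN, hR⟩ := exists_finset_roots ha
  refine ⟨nearWalls n k δ ∪ ⋃ r ∈ R, {x ∈ unitCube (n + 1) | position k x ∈ Icc (r - δ) (r + δ)},
    ?_, ?_⟩
  · rw [ENNReal.ofReal_add (by positivity) (by positivity)]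
    refine (measure_union_le _ _).trans (add_le_add (volume_nearWalls_le n k δ) ?_)
    refine (measure_biUnion_finset_le _ _).trans ((Finset.sum_le_sum fun r _ =>
      volume_position_mem_le hk hδ' r).trans ?_)
    rw [Finset.sum_const, ← ENNReal.ofReal_nsmul, nsmul_eq_mul]
    gcongr
  · intro x hx hxB
    rw [mem_union, not_or] at hxB
    -- near a point outside the exceptional set the column is constant, and the position does not
    -- meet a root
    have key : ∀ y ∈ Metric.ball x δ, ∀ t ∈ uIcc (position k x) (position k y),
        polyEval a t ≠ 0 := by
      intro y hy t ht h0
      have h1 : position k y - position k x = y 0 - x 0 := by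
        have : column k y = column k x :=
          congrArg Encodable.encode (funext fun i => floor_eq_of_notMem_nearWalls hk hx hxB.1 hy i)
        rw [position, position, this]
        ring
      have h2 : |y 0 - x 0| < δ := by
        have h3 := PiLp.norm_apply_le (y - x) 0
        rw [Metric.mem_ball, dist_eq_norm] at hy
        exact h3.trans_lt hy
      have h4 := abs_sub_left_of_mem_uIcc ht
      rw [h1] at h4
      refine hxB.2 (mem_iUnion₂.2 ⟨t, hR t h0, hx, ?_⟩)
      obtain ⟨h5, h6⟩ := abs_lt.1 (h4.trans_lt h2)
      exact ⟨by linarith, by linarith⟩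
    refine ⟨?_, fun y hy => (sign_eq_of_forall_ne_zero (continuous_polyEval a) (key y hy)).symm⟩
    have h0 := key x (Metric.mem_ball_self hδ) _ left_mem_uIcc
    rcases Real.sign_apply_eq_of_ne_zero _ h0 with h | h
    · exact Or.inr h
    · exact Or.inl h

/-- The min-max values of the unit cube grow at most like `p ^ (1 / (n + 1))`: the polynomials of
degree at most `k ^ (n + 1)`, evaluated along the `k ^ n` columns of the cube, have altogether at
most `k ^ (n + 1)` sign changes, each on a set of area `k ^ (-n)`. -/
theorem exists_minmax_unitCube_le (n : ℕ) {W : ℝ → ℝ} (hW : Continuous W) (h1 : W 1 = 0)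
    (h2 : W (-1) = 0) : ∃ K : ℝ, 0 ≤ K ∧ ∀ k : ℕ, 0 < k → ∀ ε : ℝ, 0 < ε → ε ≤ 1 / 4 →
      minmax W ε (k ^ (n + 1)) (unitCube (n + 1)) ≤ ENNReal.ofReal (K * k) := by
  obtain ⟨M, hM⟩ := (isCompact_Icc (a := (-1 : ℝ)) (b := 1)).exists_bound_of_continuousOn
    hW.continuousOn
  have hM' : ∀ t, |t| ≤ 1 → W t ≤ M := fun t ht => (le_abs_self _).trans (hM t (abs_le.1 ht))
  have hM0 : 0 ≤ M := (norm_nonneg _).trans (hM 0 (by norm_num))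
  have hfin : volume (unitCube (n + 1)) ≠ ⊤ := by rw [volume_unitCube]; simp
  set G := (∫ y, ‖fderiv ℝ (kernel (n + 1)) y‖) ^ 2 / 2 + M with hG
  have hG0 : 0 ≤ G := by positivity
  refine ⟨G * (8 * n + 16), by positivity, fun k hk ε hε hε' => ?_⟩
  set g : (Fin (k ^ (n + 1) + 1) → ℝ) → H1 (unitCube (n + 1)) := fun a =>
    H1.mollify hfin hε (measurable_polySign k a) (abs_polySign_le k a) with hg
  have hne : ∀ a ∈ l1Sphere (k ^ (n + 1)), a ≠ 0 := fun a ha h =>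
    zero_notMem_l1Sphere _ (h ▸ ha)
  have hcont : ContinuousOn g (l1Sphere (k ^ (n + 1))) := fun a ha =>
    H1.tendsto_mollify hfin hε (fun b => measurable_polySign k b) (fun b => abs_polySign_le k b)
      (measurable_polySign k a) (abs_polySign_le k a)
      (ae_tendsto_polySign k (hne a ha) (tendsto_id.mono_left nhdsWithin_le_nhds))
  have hodd : ∀ a ∈ l1Sphere (k ^ (n + 1)), g (-a) = -g a := fun a _ =>
    H1.mollify_neg hfin hε _ _ _ _ (polySign_neg k a)
  -- the mollified signs of all polynomials of degree at most `k ^ (n + 1)` are an odd image of a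
  -- sphere of that dimension
  have hmem : g '' l1Sphere (k ^ (n + 1)) ∈ sweepouts (unitCube (n + 1)) (k ^ (n + 1)) :=
    image_mem_sweepouts (isCompact_l1Sphere _) (fun _ => neg_mem_l1Sphere) hcont hodd
      (not_powVanishes_of_l1Sphere hcont hodd (mapsTo_image _ _))
  refine (iInf₂_le _ hmem).trans (iSup₂_le ?_)
  rintro _ ⟨a, ha, rfl⟩
  obtain ⟨B, hBv, hB⟩ := exists_polySign_eq_of_notMem (n := n) hk (hne a ha)
    (δ := 2 * ε) (by positivity) (by linarith)
  refine (energy_mollify_le hM' h1 h2 hfin isOpen_unitCube.measurableSet hε _ _ hB).trans ?_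
  rw [← hG]
  refine (mul_le_mul_right hBv _).trans ?_
  rw [← ENNReal.ofReal_mul (by positivity)]
  refine ENNReal.ofReal_le_ofReal ?_
  have hk' : (1 : ℝ) ≤ k := by exact_mod_cast hk
  have e1 : ((k ^ (n + 1) : ℕ) : ℝ) * (1 / k) ^ n = k := by
    push_cast
    rw [pow_succ, one_div, inv_pow]
    field_simp
  calc G / ε * (n * (k + 1) * (2 * (2 * ε)) +
        ((k ^ (n + 1) : ℕ) : ℝ) * (4 * (2 * (2 * ε) * (1 / k) ^ n)))
      = G / ε * (n * (k + 1) * (2 * (2 * ε)) +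
        (((k ^ (n + 1) : ℕ) : ℝ) * (1 / k) ^ n) * (16 * ε)) := by ring
    _ = G * (n * (k + 1) * 4 + k * 16) := by
        rw [e1]
        field_simp
        ring
    _ ≤ G * (n * (k + k) * 4 + k * 16) := by gcongr
    _ = G * (8 * n + 16) * k := by ring

end Sweepout

/-! ### A Poincaré inequality on balls -/

section Poincare

variable {d : ℕ}

/-- The change of variables `y ↦ (1 - s) z + s y`, which maps the ball into itself. -/
theorem setLIntegral_ball_convexComb_le (g : Euc d → ℝ≥0∞) {c z : Euc d} {r : ℝ}
    (hz : z ∈ Metric.ball c r) {s : ℝ} (hs : 1 / 2 ≤ s) (hs1 : s ≤ 1) :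
    ∫⁻ y in Metric.ball c r, g ((1 - s) • z + s • y) ≤
      ENNReal.ofReal (2 ^ d) * ∫⁻ y in Metric.ball c r, g y := by
  have hs0 : 0 < s := by linarith
  have h := lintegral_comp_similarity ((1 - s) • z) hs0 (Metric.ball c r) g
  simp only [similarity_apply] at h
  rw [h]
  refine mul_le_mul' (ENNReal.ofReal_le_ofReal ?_) (lintegral_mono_set ?_)
  · rw [← inv_pow]
    refine pow_le_pow_left₀ (by positivity) ?_ d
    rw [inv_le_comm₀ hs0 (by norm_num)]
    linarith
  · rintro _ ⟨y, hy, rfl⟩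
    rw [similarity_apply]
    exact convex_ball c r hz hy (by linarith) hs0.le (by ring)

theorem enorm_sub_le_lintegral_fderiv {f : Euc d → ℝ} (hf : ContDiff ℝ 1 f) (x y : Euc d) :
    ‖f x - f y‖ₑ ≤ ‖x - y‖ₑ * ∫⁻ t in Ioc (0 : ℝ) 1, ‖fderiv ℝ f (y + t • (x - y))‖ₑ := by
  have hd : ∀ t : ℝ, HasDerivAt (fun t : ℝ => f (y + t • (x - y)))
      (fderiv ℝ f (y + t • (x - y)) (x - y)) t := by
    intro t
    have h1 : HasDerivAt (fun t : ℝ => y + t • (x - y)) (x - y) t := by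
      simpa using ((hasDerivAt_id t).smul_const (x - y)).const_add y
    exact ((hf.differentiable (by simp) _).hasFDerivAt).comp_hasDerivAt t h1
  have hc : Continuous fun t : ℝ => fderiv ℝ f (y + t • (x - y)) (x - y) :=
    ((hf.continuous_fderiv (by simp)).comp (by fun_prop)).clm_apply continuous_const
  have h2 := intervalIntegral.integral_eq_sub_of_hasDerivAt (a := 0) (b := 1)
    (fun t _ => hd t) (hc.intervalIntegrable _ _)
  have h3 : f x - f y = ∫ t in Ioc (0 : ℝ) 1, fderiv ℝ f (y + t • (x - y)) (x - y) := by
    rw [← intervalIntegral.integral_of_le zero_le_one, h2]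
    simp
  rw [h3, ← lintegral_const_mul' _ _ enorm_ne_top]
  refine (enorm_integral_le_lintegral_enorm _).trans (lintegral_mono fun t => ?_)
  rw [mul_comm]
  exact ContinuousLinearMap.le_opENorm _ _

/-- The Poincaré inequality in `L¹`: the mean oscillation on a ball is controlled by the integral
of the gradient, by integrating along segments. -/
theorem lintegral_lintegral_enorm_sub_le {f : Euc d → ℝ} (hf : ContDiff ℝ 1 f) (c : Euc d)
    (r : ℝ) :
    ∫⁻ x in Metric.ball c r, ∫⁻ y in Metric.ball c r, ‖f x - f y‖ₑ ≤
      ENNReal.ofReal (2 * r) * (ENNReal.ofReal (2 ^ d) * volume (Metric.ball c r) *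
        ∫⁻ z in Metric.ball c r, ‖fderiv ℝ f z‖ₑ) := by
  set B := Metric.ball c r with hB
  have hBm : MeasurableSet B := measurableSet_ball
  set g : Euc d → ℝ≥0∞ := fun z => ‖fderiv ℝ f z‖ₑ with hg
  have hgc : Measurable g := (hf.continuous_fderiv (by simp)).enorm.measurable
  have hF : Measurable fun q : (Euc d × ℝ) × Euc d => g (q.2 + q.1.2 • (q.1.1 - q.2)) :=
    hgc.comp (by fun_prop)
  have hF2 : ∀ t : ℝ, Measurable (Function.uncurry fun x y : Euc d => g (y + t • (x - y))) :=
    fun t => hgc.comp (f := fun q : Euc d × Euc d => q.2 + t • (q.1 - q.2)) (by fun_prop)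
  have hF3 : ∀ x : Euc d, Measurable (Function.uncurry fun (y : Euc d) (t : ℝ) =>
      g (y + t • (x - y))) :=
    fun x => hgc.comp (f := fun q : Euc d × ℝ => q.1 + q.2 • (x - q.1)) (by fun_prop)
  -- `y + t • (x - y)` depends on `y` with factor `1 - t` and on `x` with factor `t`; one of them is
  -- at least `1 / 2`, and the change of this variable costs at most `2 ^ d`
  have hslice : ∀ t ∈ Ioc (0 : ℝ) 1, ∫⁻ x in B, ∫⁻ y in B, g (y + t • (x - y)) ≤
      ENNReal.ofReal (2 ^ d) * volume B * ∫⁻ z in B, g z := by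
    intro t ht
    have key : ∀ s : ℝ, 1 / 2 ≤ s → s ≤ 1 → ∫⁻ z in B, ∫⁻ y in B, g ((1 - s) • z + s • y) ≤
        ENNReal.ofReal (2 ^ d) * volume B * ∫⁻ z in B, g z := by
      intro s hs hs1
      refine (setLIntegral_mono' hBm fun z hz =>
        setLIntegral_ball_convexComb_le g hz hs hs1).trans ?_
      rw [lintegral_const, Measure.restrict_apply_univ]
      exact le_of_eq (by ring)
    rcases le_total t (1 / 2) with h | h
    · refine le_trans (le_of_eq ?_) (key (1 - t) (by linarith) (by linarith [ht.1]))
      refine lintegral_congr fun x => lintegral_congr fun y => congrArg g ?_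
      module
    · rw [lintegral_lintegral_swap (hF2 t).aemeasurable]
      refine le_trans (le_of_eq ?_) (key t h ht.2)
      refine lintegral_congr fun x => lintegral_congr fun y => congrArg g ?_
      module
  calc ∫⁻ x in B, ∫⁻ y in B, ‖f x - f y‖ₑ
      ≤ ∫⁻ x in B, ∫⁻ y in B, ENNReal.ofReal (2 * r) *
          ∫⁻ t in Ioc (0 : ℝ) 1, g (y + t • (x - y)) := by
        refine setLIntegral_mono' hBm fun x hx => setLIntegral_mono' hBm fun y hy => ?_
        refine (enorm_sub_le_lintegral_fderiv hf x y).trans (mul_le_mul_left ?_ _)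
        rw [← ofReal_norm]
        refine ENNReal.ofReal_le_ofReal ?_
        rw [← dist_eq_norm]
        have h1 := dist_triangle_right x y c
        rw [hB, Metric.mem_ball] at hx hy
        linarith
    _ = ENNReal.ofReal (2 * r) *
          ∫⁻ t in Ioc (0 : ℝ) 1, ∫⁻ x in B, ∫⁻ y in B, g (y + t • (x - y)) := by
        simp only [lintegral_const_mul' _ _ ENNReal.ofReal_ne_top]
        congr 1
        have h1 : ∀ x, ∫⁻ y in B, ∫⁻ t in Ioc (0 : ℝ) 1, g (y + t • (x - y)) =
            ∫⁻ t in Ioc (0 : ℝ) 1, ∫⁻ y in B, g (y + t • (x - y)) := fun x =>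
          lintegral_lintegral_swap (hF3 x).aemeasurable
        simp only [h1]
        exact lintegral_lintegral_swap
          (hF.lintegral_prod_right' (ν := volume.restrict B)).aemeasurable
    _ ≤ ENNReal.ofReal (2 * r) * ∫⁻ _t in Ioc (0 : ℝ) 1,
          (ENNReal.ofReal (2 ^ d) * volume B * ∫⁻ z in B, g z) := by
        gcongr 1
        exact setLIntegral_mono' measurableSet_Ioc hslice
    _ = _ := by
        rw [lintegral_const, Measure.restrict_apply_univ, Real.volume_Ioc]
        simp

end Poincare

/-! ### Oscillation of truncations of `H^1` functions -/

section Oscillation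

open scoped Convolution

variable {d : ℕ}

/-- `g` is the weak gradient of `u` in `Ω`; both functions are defined on the whole space. -/
def IsWeakGradient (Ω : Set (Euc d)) (u : Euc d → ℝ) (g : Euc d → Euc d) : Prop :=
  ∀ φ : Euc d → ℝ, ContDiff ℝ ∞ φ → HasCompactSupport φ → tsupport φ ⊆ Ω → ∀ i : Fin d,
    ∫ x, u x * fderiv ℝ φ x (EuclideanSpace.single i 1) = -∫ x, g x i * φ x

theorem H1.isWeakGradient {Ω : Set (Euc d)} (hΩ : MeasurableSet Ω) (v : H1 Ω) :
    IsWeakGradient Ω (Ω.indicator v.1.1) (Ω.indicator v.1.2) := by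
  intro φ h1 h2 h3 i
  have e1 : ∫ x, Ω.indicator v.1.1 x * fderiv ℝ φ x (EuclideanSpace.single i 1) =
      ∫ x in Ω, v.1.1 x * fderiv ℝ φ x (EuclideanSpace.single i 1) := by
    rw [← integral_indicator hΩ]
    refine integral_congr_ae (Eventually.of_forall fun y => ?_)
    by_cases hy : y ∈ Ω <;> simp [hy]
  have e2 : ∫ x, Ω.indicator v.1.2 x i * φ x = ∫ x in Ω, v.1.2 x i * φ x := by
    rw [← integral_indicator hΩ]
    refine integral_congr_ae (Eventually.of_forall fun y => ?_)
    by_cases hy : y ∈ Ω <;> simp [hy]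
  rw [e1, e2]
  exact v.2 φ h1 h2 h3 i

variable {Ω : Set (Euc d)} {u : Euc d → ℝ} {g : Euc d → Euc d}

/-- Mollification commutes with weak gradients. -/
theorem gradient_convolution (hu : LocallyIntegrable u volume) (hg : LocallyIntegrable g volume)
    (hw : IsWeakGradient Ω u g) (φ : ContDiffBump (0 : Euc d))
    {x : Euc d} (hx : Metric.closedBall x φ.rOut ⊆ Ω) :
    gradient (φ.normed volume ⋆[ContinuousLinearMap.lsmul ℝ ℝ, volume] u) x =
      (φ.normed volume ⋆[ContinuousLinearMap.lsmul ℝ ℝ, volume] g) x := by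
  set ρ := φ.normed volume with hρ
  have hρs : ContDiff ℝ ∞ ρ := φ.contDiff_normed
  have hρc : HasCompactSupport ρ := φ.hasCompactSupport_normed
  have hρ1 : ContDiff ℝ 1 ρ := φ.contDiff_normed (n := 1)
  set ψ : Euc d → ℝ := fun y => ρ (x - y) with hψ
  have hψs : ContDiff ℝ ∞ ψ := hρs.comp (contDiff_const.sub contDiff_id)
  have hψt : tsupport ψ ⊆ Metric.closedBall x φ.rOut := by
    refine closure_minimal (fun y hy => ?_) Metric.isClosed_closedBall
    have h1 : x - y ∈ Function.support ρ := hy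
    rw [hρ, φ.support_normed_eq, mem_ball_zero_iff] at h1
    rw [Metric.mem_closedBall, dist_comm, dist_eq_norm]
    exact h1.le
  have hψc : HasCompactSupport ψ :=
    HasCompactSupport.of_support_subset_isCompact (isCompact_closedBall x φ.rOut)
      (subset_closure.trans hψt)
  have hψd : ∀ y w, fderiv ℝ ψ y w = -fderiv ℝ ρ (x - y) w := by
    intro y w
    have h1 : HasFDerivAt (fun y : Euc d => x - y) (-ContinuousLinearMap.id ℝ (Euc d)) y :=
      (hasFDerivAt_id y).const_sub x
    have h2 := ((hρ1.differentiable (by simp) (x - y)).hasFDerivAt.comp y h1).fderiv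
    rw [show fderiv ℝ ψ y = _ from h2]
    simp
  ext i
  have hweak := hw ψ hψs hψc (hψt.trans hx) i
  have e1 : gradient (ρ ⋆[ContinuousLinearMap.lsmul ℝ ℝ, volume] u) x i =
      ∫ t, u (x - t) * fderiv ℝ ρ t (EuclideanSpace.single i 1) := by
    rw [gradient_apply, (hρc.hasFDerivAt_convolution_left _ hρ1 hu x).fderiv, convolution_def,
      ContinuousLinearMap.integral_apply]
    · refine integral_congr_ae (Eventually.of_forall fun t => ?_)
      simp [ContinuousLinearMap.precompL_apply, mul_comm]
    · exact (hρc.fderiv ℝ).convolutionExists_left _ (hρ1.continuous_fderiv (by simp)) hu x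
  have e2 : (ρ ⋆[ContinuousLinearMap.lsmul ℝ ℝ, volume] g) x i =
      ∫ t, g (x - t) i * ρ t := by
    rw [convolution_def]
    have h1 := (EuclideanSpace.proj (𝕜 := ℝ) i).integral_comp_comm
      (hρc.convolutionExists_left (ContinuousLinearMap.lsmul ℝ ℝ) hρ1.continuous hg x)
    refine h1.symm.trans (integral_congr_ae (Eventually.of_forall fun t => ?_))
    simp [mul_comm]
  have e3 := integral_sub_left_eq_self (fun y => u y *
    fderiv ℝ ρ (x - y) (EuclideanSpace.single i 1)) volume x
  have e4 := integral_sub_left_eq_self (fun y => g y i * ρ (x - y)) volume x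
  simp only [sub_sub_cancel] at e3 e4
  rw [e1, e2, e3, e4]
  have e5 : ∫ y, u y * fderiv ℝ ρ (x - y) (EuclideanSpace.single i 1) =
      -∫ y, u y * fderiv ℝ ψ y (EuclideanSpace.single i 1) := by
    rw [← integral_neg]
    refine integral_congr_ae (Eventually.of_forall fun y => ?_)
    simp only [hψd]
    ring
  rw [e5, hweak, neg_neg]

theorem lintegral_normed (φ : ContDiffBump (0 : Euc d)) :
    ∫⁻ t, ENNReal.ofReal (φ.normed volume t) = 1 := by
  rw [← ofReal_integral_eq_lintegral_ofReal φ.integrable_normed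
    (Eventually.of_forall φ.nonneg_normed), φ.integral_normed, ENNReal.ofReal_one]

/-- Young's inequality for the gradient of a truncation `G ∘ u` of a mollified function. -/
theorem enorm_fderiv_comp_convolution_le (hu : LocallyIntegrable u volume)
    (hg : LocallyIntegrable g volume) (hw : IsWeakGradient Ω u g) (φ : ContDiffBump (0 : Euc d))
    {x : Euc d} (hx : Metric.closedBall x φ.rOut ⊆ Ω)
    {G : ℝ → ℝ} (hG : ContDiff ℝ 1 G) {ε : ℝ} (hε : 0 < ε) :
    ‖fderiv ℝ (fun x => G ((φ.normed volume ⋆[ContinuousLinearMap.lsmul ℝ ℝ, volume]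
      u) x)) x‖ₑ ≤
      (∫⁻ t, ENNReal.ofReal (φ.normed volume t) *
        ENNReal.ofReal (ε * ‖g (x - t)‖ ^ 2 / 2)) +
      ENNReal.ofReal (deriv G ((φ.normed volume ⋆[ContinuousLinearMap.lsmul ℝ ℝ, volume]
        u) x) ^ 2 / (2 * ε)) := by
  have hgrad := gradient_convolution hu hg hw φ hx
  set U := φ.normed volume ⋆[ContinuousLinearMap.lsmul ℝ ℝ, volume] u with hU
  have hUd : ContDiff ℝ 1 U := φ.hasCompactSupport_normed.contDiff_convolution_left (n := 1) _
    (φ.contDiff_normed (n := 1)) hu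
  set a := deriv G (U x) with ha
  have h1 : fderiv ℝ (fun x => G (U x)) x = a • fderiv ℝ U x :=
    (((hG.differentiable (by simp) (U x)).hasDerivAt).comp_hasFDerivAt x
      (hUd.differentiable (by simp) x).hasFDerivAt).fderiv
  have h2 : ‖fderiv ℝ (fun x => G (U x)) x‖ₑ = ‖a • gradient U x‖ₑ := by
    rw [h1, enorm_smul, enorm_smul, ← ofReal_norm (fderiv ℝ U x), ← norm_gradient, ofReal_norm]
  rw [h2, hgrad, convolution_def, ← integral_smul]
  refine (enorm_integral_le_lintegral_enorm _).trans ?_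
  have h3 : ∀ t, ‖a • (ContinuousLinearMap.lsmul ℝ ℝ (φ.normed volume t)
      (g (x - t)))‖ₑ ≤ ENNReal.ofReal (φ.normed volume t) *
        ENNReal.ofReal (ε * ‖g (x - t)‖ ^ 2 / 2) +
        ENNReal.ofReal (φ.normed volume t) * ENNReal.ofReal (a ^ 2 / (2 * ε)) := by
    intro t
    have hn : 0 ≤ φ.normed volume t := φ.nonneg_normed t
    rw [← mul_add, ← ENNReal.ofReal_add (by positivity) (by positivity),
      ← ENNReal.ofReal_mul hn, ← ofReal_norm]
    refine ENNReal.ofReal_le_ofReal ?_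
    rw [ContinuousLinearMap.lsmul_apply, norm_smul, norm_smul, Real.norm_of_nonneg hn,
      Real.norm_eq_abs, mul_left_comm]
    refine mul_le_mul_of_nonneg_left ?_ hn
    generalize ‖g (x - t)‖ = b
    have h4 : ε * b ^ 2 / 2 + a ^ 2 / (2 * ε) - |a| * b = (ε * b - |a|) ^ 2 / (2 * ε) := by
      rw [← sq_abs a]
      field_simp
      ring
    have h5 : 0 ≤ (ε * b - |a|) ^ 2 / (2 * ε) := by positivity
    linarith
  refine (lintegral_mono h3).trans ?_
  rw [lintegral_add_right _ (φ.continuous_normed.measurable.ennreal_ofReal.mul_const _),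
    lintegral_mul_const' _ _ ENNReal.ofReal_ne_top, lintegral_normed, one_mul]

theorem lintegral_lintegral_normed_mul (φ : ContDiffBump (0 : Euc d)) {h : Euc d → ℝ≥0∞}
    (hh : Measurable h) :
    ∫⁻ x, ∫⁻ t, ENNReal.ofReal (φ.normed volume t) * h (x - t) = ∫⁻ x, h x := by
  rw [lintegral_lintegral_swap]
  · have : ∀ t, ∫⁻ x, ENNReal.ofReal (φ.normed volume t) * h (x - t) =
        ENNReal.ofReal (φ.normed volume t) * ∫⁻ x, h x := by
      intro t
      rw [lintegral_const_mul' _ _ ENNReal.ofReal_ne_top, lintegral_sub_right_eq_self h t]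
    simp only [this]
    rw [lintegral_mul_const _ φ.continuous_normed.measurable.ennreal_ofReal, lintegral_normed,
      one_mul]
  · have h1 : Measurable fun q : Euc d × Euc d => ENNReal.ofReal (φ.normed volume q.2) :=
      φ.continuous_normed.measurable.ennreal_ofReal.comp measurable_snd
    exact (h1.mul (hh.comp (measurable_fst.sub measurable_snd))).aemeasurable

theorem lintegral_lintegral_enorm_comp_convolution_sub_le (hu : LocallyIntegrable u volume)
    (hg : LocallyIntegrable g volume) (hgm : Measurable g) (hw : IsWeakGradient Ω u g)
    {c : Euc d} {r : ℝ} (hcr : Metric.ball c (2 * r) ⊆ Ω) {G : ℝ → ℝ} (hG : ContDiff ℝ 1 G)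
    {ε : ℝ} (hε : 0 < ε) (φ : ContDiffBump (0 : Euc d)) (hφ : φ.rOut ≤ r) {U : Euc d → ℝ}
    (hU : U = φ.normed volume ⋆[ContinuousLinearMap.lsmul ℝ ℝ, volume] u)
    (hUd : ContDiff ℝ 1 U) :
    ∫⁻ x in Metric.ball c r, ∫⁻ y in Metric.ball c r, ‖G (U x) - G (U y)‖ₑ ≤
      ENNReal.ofReal (2 * r) * (ENNReal.ofReal (2 ^ d) * volume (Metric.ball c r) *
        ((∫⁻ x, ENNReal.ofReal (ε * ‖g x‖ ^ 2 / 2)) +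
          ∫⁻ x in Metric.ball c r, ENNReal.ofReal (deriv G (U x) ^ 2 / (2 * ε)))) := by
  refine (lintegral_lintegral_enorm_sub_le (hG.comp hUd) c r).trans ?_
  refine mul_le_mul_right (mul_le_mul_right ?_ _) _
  have h1 : ∀ x ∈ Metric.ball c r, Metric.closedBall x φ.rOut ⊆ Ω := by
    intro x hx y hy
    refine hcr ?_
    have h3 := dist_triangle y x c
    rw [Metric.mem_ball] at hx
    rw [Metric.mem_closedBall] at hy
    rw [Metric.mem_ball]
    linarith
  have h2 : ∀ x ∈ Metric.ball c r, ‖fderiv ℝ (fun x => G (U x)) x‖ₑ ≤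
      (∫⁻ t, ENNReal.ofReal (φ.normed volume t) * ENNReal.ofReal (ε * ‖g (x - t)‖ ^ 2 / 2)) +
        ENNReal.ofReal (deriv G (U x) ^ 2 / (2 * ε)) := by
    intro x hx
    rw [hU]
    exact enorm_fderiv_comp_convolution_le hu hg hw φ (h1 x hx) hG hε
  refine (setLIntegral_mono' measurableSet_ball h2).trans ?_
  rw [lintegral_add_right]
  · refine add_le_add ((setLIntegral_le_lintegral _ _).trans ?_) le_rfl
    rw [lintegral_lintegral_normed_mul φ (h := fun x => ENNReal.ofReal (ε * ‖g x‖ ^ 2 / 2))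
      (((hgm.norm.pow_const 2).const_mul ε).div_const 2).ennreal_ofReal]
  · exact ((((hG.continuous_deriv (by simp)).comp hUd.continuous).pow 2).div_const
      _).measurable.ennreal_ofReal

theorem lintegral_lintegral_enorm_sub_le_liminf {B : Set (Euc d)} {f : Euc d → ℝ}
    {F : ℕ → Euc d → ℝ} (hF : ∀ m, Continuous (F m))
    (h : ∀ᵐ x ∂(volume.restrict B), Tendsto (fun m => F m x) atTop (𝓝 (f x))) :
    ∫⁻ x in B, ∫⁻ y in B, ‖f x - f y‖ₑ ≤
      liminf (fun m => ∫⁻ x in B, ∫⁻ y in B, ‖F m x - F m y‖ₑ) atTop := by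
  have hm : ∀ m, Measurable fun q : Euc d × Euc d => ‖F m q.1 - F m q.2‖ₑ := fun m =>
    (((hF m).comp continuous_fst).sub ((hF m).comp continuous_snd)).enorm.measurable
  refine le_trans (lintegral_mono_ae ?_) (lintegral_liminf_le fun m =>
    (hm m).lintegral_prod_right')
  filter_upwards [h] with x hx
  refine le_trans (le_of_eq (lintegral_congr_ae ?_)) (lintegral_liminf_le fun m =>
    (hm m).comp (measurable_const.prodMk measurable_id))
  filter_upwards [h] with y hy
  refine (Tendsto.liminf_eq ?_).symm
  exact (hx.sub hy).enorm

theorem tendsto_lintegral_sq_div {B : Set (Euc d)} (hB : volume B ≠ ⊤) {f : Euc d → ℝ}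
    {F : ℕ → Euc d → ℝ} (hF : ∀ m, Continuous (F m)) {L : ℝ} (hL : ∀ m x, |F m x| ≤ L)
    (h : ∀ᵐ x ∂(volume.restrict B), Tendsto (fun m => F m x) atTop (𝓝 (f x))) {η : ℝ}
    (hη : 0 < η) :
    Tendsto (fun m => ∫⁻ x in B, ENNReal.ofReal (F m x ^ 2 / η))
      atTop (𝓝 (∫⁻ x in B, ENNReal.ofReal (f x ^ 2 / η))) := by
  refine tendsto_lintegral_of_dominated_convergence
    (fun _ => ENNReal.ofReal (L ^ 2 / η)) (fun m => ?_) (fun m => ?_) ?_ ?_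
  · exact (((hF m).pow 2).div_const _).measurable.ennreal_ofReal
  · refine Eventually.of_forall fun x => ENNReal.ofReal_le_ofReal ?_
    rw [← sq_abs]
    gcongr
    exact hL m x
  · rw [lintegral_const, Measure.restrict_apply_univ]
    exact ENNReal.mul_ne_top ENNReal.ofReal_ne_top hB
  · filter_upwards [h] with x hx
    exact (ENNReal.continuous_ofReal.tendsto _).comp ((hx.pow 2).div_const _)

/-- The oscillation of a truncation `G ∘ u` of a weakly differentiable function on a ball. -/
theorem lintegral_lintegral_enorm_comp_sub_le (hu : LocallyIntegrable u volume)
    (hg : LocallyIntegrable g volume) (hgm : Measurable g) (hw : IsWeakGradient Ω u g)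
    {c : Euc d} {r : ℝ} (hr : 0 < r) (hcr : Metric.ball c (2 * r) ⊆ Ω)
    {G : ℝ → ℝ} (hG : ContDiff ℝ 1 G) {L : ℝ} (hL : ∀ t, |deriv G t| ≤ L) {ε : ℝ} (hε : 0 < ε) :
    ∫⁻ x in Metric.ball c r, ∫⁻ y in Metric.ball c r, ‖G (u x) - G (u y)‖ₑ ≤
      ENNReal.ofReal (2 * r) * (ENNReal.ofReal (2 ^ d) * volume (Metric.ball c r) *
        ((∫⁻ x, ENNReal.ofReal (ε * ‖g x‖ ^ 2 / 2)) +
          ∫⁻ x in Metric.ball c r, ENNReal.ofReal (deriv G (u x) ^ 2 / (2 * ε)))) := by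
  have hBfin : volume (Metric.ball c r) ≠ ⊤ := measure_ball_lt_top.ne
  -- mollifiers of radius tending to zero, with inner and outer radii comparable, so that the
  -- mollified functions converge almost everywhere
  obtain ⟨φ, hφr, hφ0, hφK⟩ : ∃ φ : ℕ → ContDiffBump (0 : Euc d), (∀ m, (φ m).rOut ≤ r) ∧
      Tendsto (fun m => (φ m).rOut) atTop (𝓝 0) ∧ ∀ m, (φ m).rOut ≤ 2 * (φ m).rIn := by
    refine ⟨fun m => ⟨r / (m + 1) / 2, r / (m + 1), by positivity, half_lt_self (by positivity)⟩,
      fun m => div_le_self hr.le (by linarith [m.cast_nonneg (α := ℝ)]), ?_, fun m => ?_⟩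
    · have := (tendsto_one_div_add_atTop_nhds_zero_nat (𝕜 := ℝ)).const_mul r
      rw [mul_zero] at this
      exact this.congr fun m => mul_one_div _ _
    · simp only
      linarith
  have hUd : ∀ m, ContDiff ℝ 1
      ((φ m).normed volume ⋆[ContinuousLinearMap.lsmul ℝ ℝ, volume] u) := fun m =>
    (φ m).hasCompactSupport_normed.contDiff_convolution_left (n := 1) _
      ((φ m).contDiff_normed (n := 1)) hu
  have hconv : ∀ᵐ x ∂(volume.restrict (Metric.ball c r)), Tendsto (fun m =>
      ((φ m).normed volume ⋆[ContinuousLinearMap.lsmul ℝ ℝ, volume] u) x) atTop (𝓝 (u x)) :=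
    ae_restrict_of_ae (ContDiffBump.ae_convolution_tendsto_right_of_locallyIntegrable hφ0
      (Eventually.of_forall hφK) hu)
  have hstep := fun m => lintegral_lintegral_enorm_comp_convolution_sub_le hu hg hgm hw hcr hG hε
    (φ m) (hφr m) rfl (hUd m)
  generalize hU : (fun m => (φ m).normed volume ⋆[ContinuousLinearMap.lsmul ℝ ℝ, volume] u) = U
  replace hU := fun m => congrFun hU m
  simp only [hU] at hUd hconv hstep
  have hG' : Continuous (deriv G) := hG.continuous_deriv (by simp)
  have hlim := tendsto_lintegral_sq_div hBfin (f := fun x => deriv G (u x))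
    (F := fun m x => deriv G (U m x)) (fun m => hG'.comp (hUd m).continuous)
    (fun m x => hL _) (hconv.mono fun x hx => (hG'.tendsto _).comp hx) (η := 2 * ε) (by positivity)
  have hFatou := lintegral_lintegral_enorm_sub_le_liminf (f := fun x => G (u x))
    (F := fun m x => G (U m x)) (fun m => hG.continuous.comp (hUd m).continuous)
    (hconv.mono fun x hx => (hG.continuous.tendsto _).comp hx)
  refine hFatou.trans ((liminf_le_liminf (Eventually.of_forall hstep)).trans (le_of_eq ?_))
  refine Tendsto.liminf_eq ?_
  have h2 : ENNReal.ofReal (2 ^ d) * volume (Metric.ball c r) ≠ ⊤ :=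
    ENNReal.mul_ne_top ENNReal.ofReal_ne_top hBfin
  exact ENNReal.Tendsto.const_mul (ENNReal.Tendsto.const_mul (hlim.const_add _) (Or.inr h2))
    (Or.inr ENNReal.ofReal_ne_top)

end Oscillation

/-! ### Positivity of the first min-max value -/

section Balanced

/-- Truncation to `[-1, 1]`. -/
def clamp (t : ℝ) : ℝ := max (-1) (min 1 t)

theorem lipschitzWith_clamp : LipschitzWith 1 clamp :=
  (LipschitzWith.id.const_min 1).const_max (-1)

theorem clamp_neg (t : ℝ) : clamp (-t) = -clamp t := by
  simp only [clamp, max_def, min_def]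
  split_ifs <;> linarith

theorem clamp_zero : clamp 0 = 0 := by norm_num [clamp]

theorem abs_clamp_le (t : ℝ) : |clamp t| ≤ 1 :=
  abs_le.2 ⟨le_max_left _ _, max_le (by norm_num) (min_le_left _ _)⟩

theorem powVanishes_pair : PowVanishes ({1, -1} : Set ℝ) 1 := by
  refine ⟨1, one_pos, fun t => if 0 < t then 1 else 0, fun _ => 0, ?_, fun _ _ _ => rfl, ?_⟩
  · rintro x (rfl | rfl)
    · norm_num
      decide
    · norm_num
  · intro l hl hA hdist
    obtain ⟨x, y, rfl⟩ := List.length_eq_two.1 hl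
    have h1 : x = y := by
      have h2 := hdist x (by simp) y (by simp)
      have hx := hA x (by simp)
      have hy := hA y (by simp)
      rcases hx with rfl | rfl <;> rcases hy with rfl | rfl
      · rfl
      · norm_num [Real.dist_eq] at h2
      · norm_num [Real.dist_eq] at h2
      · rfl
    subst h1
    simp [cobdPow, listCobd, zmod_two_add_self]

/-- An odd continuous function has a zero on every compact symmetric set of index at least `2`. -/
theorem exists_eq_zero_of_odd {E : Type*} [NormedAddCommGroup E] [NormedSpace ℝ E] {A : Set E}
    (hc : IsCompact A) {F : E → ℝ} (hF : Continuous F)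
    (hodd : ∀ x, F (-x) = -F x) (hA : ¬ PowVanishes A 1) : ∃ x ∈ A, F x = 0 := by
  by_contra hcon
  push Not at hcon
  refine hA (powVanishes_pair.of_map (g := fun x => Real.sign (F x)) hc ?_ ?_ ?_)
  · exact fun x hx => tendsto_sign (hcon x hx)
      (hF.continuousAt.tendsto.mono_left nhdsWithin_le_nhds)
  · intro x _
    simp only [hodd, Real.sign_neg]
  · intro x hx
    rcases Real.sign_apply_eq_of_ne_zero _ (hcon x hx) with h | h
    · exact Or.inr h
    · exact Or.inl h

variable {d : ℕ} {Ω B : Set (Euc d)}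

/-- The mean of the truncation is a continuous function on `H^1`. -/
theorem exists_continuous_integral_clamp (hB : MeasurableSet B) (hBΩ : B ⊆ Ω)
    (hfin : volume B ≠ ⊤) : ∃ F : H1 Ω → ℝ, Continuous F ∧
      ∀ v, F v = ∫ x in B, clamp (v.1.1 x) := by
  have hfin' : (volume.restrict Ω) B ≠ ⊤ :=
    ((Measure.restrict_apply_le _ _).trans_lt hfin.lt_top).ne
  refine ⟨fun v => inner ℝ (indicatorConstLp 2 hB hfin' (1 : ℝ))
    (lipschitzWith_clamp.compLp clamp_zero v.1.1), ?_, fun v => ?_⟩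
  · exact continuous_const.inner ((lipschitzWith_clamp.continuous_compLp clamp_zero).comp
      (continuous_fst.comp continuous_subtype_val))
  · simp only
    rw [L2.inner_indicatorConstLp_one, Measure.restrict_restrict_of_subset hBΩ]
    refine integral_congr_ae ?_
    have h := lipschitzWith_clamp.coeFn_compLp clamp_zero v.1.1
    exact ae_mono (Measure.restrict_mono_set _ hBΩ) h

/-- Every sweepout of index at least `2` contains a function whose truncation has mean value zero
on a given set. -/
theorem exists_integral_clamp_eq_zero (hB : MeasurableSet B) (hBΩ : B ⊆ Ω) (hfin : volume B ≠ ⊤)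
    {A : Set (H1 Ω)} (hA : A ∈ sweepouts Ω 1) : ∃ v ∈ A, ∫ x in B, clamp (v.1.1 x) = 0 := by
  obtain ⟨F, hF, hFv⟩ := exists_continuous_integral_clamp hB hBΩ hfin
  have hodd : ∀ v, F (-v) = -F v := by
    intro v
    rw [hFv, hFv, ← integral_neg]
    refine integral_congr_ae ?_
    have h := ae_mono (Measure.restrict_mono_set volume hBΩ) (Lp.coeFn_neg v.1.1)
    filter_upwards [h] with x hx
    have h' : (-v).1.1 x = -v.1.1 x := hx
    rw [h', clamp_neg]
  obtain ⟨hc, hsym, hind⟩ := hA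
  by_cases h0 : (0 : H1 Ω) ∈ A
  · refine ⟨0, h0, ?_⟩
    have := hodd 0
    rw [neg_zero] at this
    rw [← hFv]
    linarith
  · obtain ⟨v, hv, h⟩ := exists_eq_zero_of_odd hc hF hodd ((succ_le_index_iff hc hsym h0 1).1 hind)
    exact ⟨v, hv, by rw [← hFv, h]⟩

theorem measureReal_le_of_integral_clamp {X : Type*} [MeasurableSpace X] (μ : Measure X)
    [IsFiniteMeasure μ] {f : X → ℝ} (hf : Measurable f) (h : 0 ≤ ∫ x, clamp (f x) ∂μ) :
    μ.real {x | f x ≤ -(1 / 2)} ≤ 2 * (μ.real {x | 1 / 2 ≤ f x} + μ.real {x | |f x| < 1 / 2}) := by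
  have m1 : MeasurableSet {x | f x ≤ -(1 / 2)} := measurableSet_le hf measurable_const
  have m2 : MeasurableSet {x | 1 / 2 ≤ f x} := measurableSet_le measurable_const hf
  have m3 : MeasurableSet {x | |f x| < 1 / 2} := measurableSet_lt hf.abs measurable_const
  have i1 : Integrable ({x | f x ≤ -(1 / 2)}.indicator fun _ => (-(1 / 2) : ℝ)) μ :=
    (integrable_const _).indicator m1
  have i2 : Integrable ({x | 1 / 2 ≤ f x}.indicator fun _ => (1 : ℝ)) μ :=
    (integrable_const _).indicator m2
  have i3 : Integrable ({x | |f x| < 1 / 2}.indicator fun _ => (1 : ℝ)) μ :=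
    (integrable_const _).indicator m3
  have hle : ∫ x, clamp (f x) ∂μ ≤
      ∫ x, ({x | f x ≤ -(1 / 2)}.indicator (fun _ => (-(1 / 2) : ℝ)) x +
      {x | 1 / 2 ≤ f x}.indicator (fun _ => (1 : ℝ)) x +
      {x | |f x| < 1 / 2}.indicator (fun _ => (1 : ℝ)) x) ∂μ := by
    refine integral_mono ?_ ((i1.add i2).add i3) fun x => ?_
    · refine Integrable.of_bound
        (lipschitzWith_clamp.continuous.measurable.comp hf).aestronglyMeasurable 1
        (Eventually.of_forall fun x => abs_clamp_le _)
    · have hc := (abs_le.1 (abs_clamp_le (f x))).2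
      simp only [indicator_apply, mem_ofPred_eq]
      by_cases c1 : f x ≤ -(1 / 2)
      · have c2 : ¬ 1 / 2 ≤ f x := by linarith
        have c3 : ¬ |f x| < 1 / 2 := fun h => by linarith [(abs_lt.1 h).1]
        rw [if_pos c1, if_neg c2, if_neg c3, add_zero, add_zero]
        refine max_le (by norm_num) ((min_le_right _ _).trans c1)
      · rw [if_neg c1]
        by_cases c2 : 1 / 2 ≤ f x
        · rw [if_pos c2]
          split_ifs <;> linarith
        · have c3 : |f x| < 1 / 2 := abs_lt.2 ⟨by linarith, by linarith⟩
          rw [if_neg c2, if_pos c3]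
          linarith
  have hsum := (integral_add (i1.add i2) i3).trans (congrArg (· + _) (integral_add i1 i2))
  rw [integral_indicator_const _ m1, integral_indicator_const _ m2,
    integral_indicator_const _ m3] at hsum
  replace hle := hle.trans hsum.le
  simp only [smul_eq_mul] at hle
  linarith

/-- A function that changes sign in the mean, takes small values only on a small set, and is
truncated by `G`, oscillates. -/
theorem sq_le_lintegral_lintegral {X : Type*} [MeasurableSpace X] (μ : Measure X)
    [IsFiniteMeasure μ] {f : X → ℝ} (hf : Measurable f) (h : ∫ x, clamp (f x) ∂μ = 0)
    {G : ℝ → ℝ} (h1 : ∀ t, 1 / 2 ≤ t → G t = 1) (h2 : ∀ t, t ≤ -(1 / 2) → G t = 0)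
    (hs : μ.real {x | |f x| < 1 / 2} ≤ μ.real univ / 8) :
    ENNReal.ofReal ((μ.real univ / 5) ^ 2) ≤ ∫⁻ x, ∫⁻ y, ‖G (f x) - G (f y)‖ₑ ∂μ ∂μ := by
  have m1 : MeasurableSet {x | f x ≤ -(1 / 2)} := measurableSet_le hf measurable_const
  have m2 : MeasurableSet {x | 1 / 2 ≤ f x} := measurableSet_le measurable_const hf
  have e1 := measureReal_le_of_integral_clamp μ hf h.ge
  have e2 := measureReal_le_of_integral_clamp μ hf.neg (f := fun x => -f x) (by
    simp only [clamp_neg]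
    rw [integral_neg, h, neg_zero])
  have s1 : {x | -f x ≤ -(1 / 2)} = {x | 1 / 2 ≤ f x} := by ext x; simp
  have s2 : {x | 1 / 2 ≤ -f x} = {x | f x ≤ -(1 / 2)} := by
    ext x
    simp only [mem_ofPred_eq]
    constructor <;> intro h <;> linarith
  simp only [abs_neg] at e2
  rw [s1, s2] at e2
  have e3 : μ.real univ ≤ μ.real {x | f x ≤ -(1 / 2)} + μ.real {x | 1 / 2 ≤ f x} +
      μ.real {x | |f x| < 1 / 2} := by
    refine (measureReal_mono (fun x _ => ?_)).trans ((measureReal_union_le _ _).trans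
      (add_le_add_left (measureReal_union_le _ _) _))
    by_cases c1 : f x ≤ -(1 / 2)
    · exact Or.inl (Or.inl c1)
    · by_cases c2 : 1 / 2 ≤ f x
      · exact Or.inl (Or.inr c2)
      · have c3 : |f x| < 1 / 2 := abs_lt.2 ⟨by linarith, by linarith⟩
        exact Or.inr c3
  have hb : 0 ≤ μ.real univ := measureReal_nonneg
  have p1 : μ.real univ / 5 ≤ μ.real {x | 1 / 2 ≤ f x} := by linarith
  have p2 : μ.real univ / 5 ≤ μ.real {x | f x ≤ -(1 / 2)} := by linarith
  calc ENNReal.ofReal ((μ.real univ / 5) ^ 2)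
      ≤ ENNReal.ofReal (μ.real {x | 1 / 2 ≤ f x} * μ.real {x | f x ≤ -(1 / 2)}) := by
        refine ENNReal.ofReal_le_ofReal ?_
        rw [sq]
        gcongr
    _ = μ {x | 1 / 2 ≤ f x} * μ {x | f x ≤ -(1 / 2)} := by
        rw [ENNReal.ofReal_mul measureReal_nonneg, ofReal_measureReal, ofReal_measureReal]
    _ = ∫⁻ x in {x | 1 / 2 ≤ f x}, ∫⁻ y in {x | f x ≤ -(1 / 2)}, 1 ∂μ ∂μ := by
        simp only [lintegral_const, Measure.restrict_apply_univ, one_mul]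
        rw [mul_comm]
    _ ≤ ∫⁻ x in {x | 1 / 2 ≤ f x}, ∫⁻ y in {x | f x ≤ -(1 / 2)}, ‖G (f x) - G (f y)‖ₑ ∂μ ∂μ := by
        refine setLIntegral_mono' m2 fun x hx => setLIntegral_mono' m1 fun y hy => ?_
        rw [h1 _ hx, h2 _ hy]
        simp
    _ ≤ _ := (setLIntegral_le_lintegral _ _).trans
        (lintegral_mono fun x => setLIntegral_le_lintegral _ _)

/-- A cutoff function that separates the two wells and is constant near each of them. -/
theorem exists_cutoff : ∃ G : ℝ → ℝ, ContDiff ℝ 1 G ∧ (∀ t, 1 / 2 ≤ t → G t = 1) ∧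
    (∀ t, t ≤ -(1 / 2) → G t = 0) ∧
    ∃ L, 0 ≤ L ∧ (∀ t, |deriv G t| ≤ L) ∧ ∀ t, 1 / 2 < |t| → deriv G t = 0 := by
  have hG : ContDiff ℝ 1 fun t : ℝ => Real.smoothTransition (t + 1 / 2) :=
    Real.smoothTransition.contDiff.comp (contDiff_id.add contDiff_const)
  have h1 : ∀ t : ℝ, 1 / 2 ≤ t → Real.smoothTransition (t + 1 / 2) = 1 := fun t ht =>
    Real.smoothTransition.one_of_one_le (by linarith)
  have h2 : ∀ t : ℝ, t ≤ -(1 / 2) → Real.smoothTransition (t + 1 / 2) = 0 := fun t ht =>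
    Real.smoothTransition.zero_of_nonpos (by linarith)
  have h0 : ∀ t : ℝ, 1 / 2 < |t| →
      deriv (fun t : ℝ => Real.smoothTransition (t + 1 / 2)) t = 0 := by
    intro t ht
    rcases lt_abs.1 ht with ht | ht
    · have : (fun t : ℝ => Real.smoothTransition (t + 1 / 2)) =ᶠ[𝓝 t] fun _ => 1 := by
        filter_upwards [eventually_gt_nhds ht] with s hs using h1 s hs.le
      rw [this.deriv_eq, deriv_const]
    · have : (fun t : ℝ => Real.smoothTransition (t + 1 / 2)) =ᶠ[𝓝 t] fun _ => 0 := by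
        filter_upwards [eventually_lt_nhds (show t < -(1 / 2) by linarith)]
          with s hs using h2 s hs.le
      rw [this.deriv_eq, deriv_const]
  obtain ⟨L, hL⟩ := (isCompact_Icc (a := -(1 / 2 : ℝ)) (b := 1 / 2)).exists_bound_of_continuousOn
    (hG.continuous_deriv (by simp)).continuousOn
  have hL0 : 0 ≤ L := (norm_nonneg _).trans (hL 0 (by norm_num))
  refine ⟨_, hG, h1, h2, L, hL0, fun t => ?_, h0⟩
  rcases le_or_gt |t| (1 / 2) with ht | ht
  · exact hL t (abs_le.1 ht)
  · rw [h0 t ht, abs_zero]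
    exact hL0

end Balanced

section Lower

variable {d : ℕ} {Ω : Set (Euc d)} {W : ℝ → ℝ}

theorem mul_volume_le_energy {ε : ℝ} (hε : 0 < ε)
    (v : H1 Ω) {S : Set (Euc d)} (hS : MeasurableSet S) (hSΩ : S ⊆ Ω) {c₀ : ℝ}
    (hc : ∀ x ∈ S, c₀ ≤ W (v.1.1 x)) : ENNReal.ofReal (c₀ / ε) * volume S ≤ energy W ε Ω v := by
  calc ENNReal.ofReal (c₀ / ε) * volume S = ∫⁻ _ in S, ENNReal.ofReal (c₀ / ε) := by
        rw [lintegral_const, Measure.restrict_apply_univ]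
    _ ≤ ∫⁻ x in S, ENNReal.ofReal (ε * ‖v.1.2 x‖ ^ 2 / 2 + W (v.1.1 x) / ε) := by
        refine setLIntegral_mono' hS fun x hx => ENNReal.ofReal_le_ofReal ?_
        have h1 : c₀ / ε ≤ W (v.1.1 x) / ε := by
          gcongr
          exact hc x hx
        have h2 : 0 ≤ ε * ‖v.1.2 x‖ ^ 2 / 2 := by positivity
        linarith
    _ ≤ energy W ε Ω v := lintegral_mono_set hSΩ

/-- The energy controls both terms of Young's inequality for a function `b` of `v` which is
dominated by the potential; this is applied to the derivative of the cutoff function. -/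
theorem lintegral_gradient_add_le_energy (hW0 : ∀ t, 0 ≤ W t) {ε : ℝ} (hε : 0 < ε) (v : H1 Ω)
    {B : Set (Euc d)} (hBΩ : B ⊆ Ω) {b : ℝ → ℝ} {Λ : ℝ} (hΛ : 0 ≤ Λ)
    (hb : ∀ t, b t ^ 2 ≤ 2 * (Λ * W t)) :
    (∫⁻ x in Ω, ENNReal.ofReal (ε * ‖v.1.2 x‖ ^ 2 / 2)) +
      ∫⁻ x in B, ENNReal.ofReal (b (v.1.1 x) ^ 2 / (2 * ε)) ≤
      ENNReal.ofReal (1 + Λ) * energy W ε Ω v := by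
  rw [ENNReal.ofReal_add zero_le_one hΛ, ENNReal.ofReal_one, add_mul, one_mul]
  refine add_le_add (lintegral_mono fun x => ENNReal.ofReal_le_ofReal ?_) ?_
  · have : 0 ≤ W (v.1.1 x) / ε := div_nonneg (hW0 _) hε.le
    linarith
  · rw [energy, ← lintegral_const_mul' _ _ ENNReal.ofReal_ne_top]
    refine le_trans (lintegral_mono fun x => ?_) (lintegral_mono_set hBΩ)
    rw [← ENNReal.ofReal_mul hΛ]
    refine ENNReal.ofReal_le_ofReal ?_
    have h1 : b (v.1.1 x) ^ 2 / (2 * ε) ≤ Λ * (W (v.1.1 x) / ε) := by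
      rw [div_le_iff₀ (by positivity)]
      calc b (v.1.1 x) ^ 2 ≤ 2 * (Λ * W (v.1.1 x)) := hb _
        _ = Λ * (W (v.1.1 x) / ε) * (2 * ε) := by field_simp
    have h2 : 0 ≤ Λ * (ε * ‖v.1.2 x‖ ^ 2 / 2) := by positivity
    linarith

/-- The energy of a function whose truncation has mean value zero on a ball is bounded from below
independently of `ε`. -/
theorem exists_le_energy_of_integral_clamp_eq_zero (hΩ : MeasurableSet Ω)
    (hW0 : ∀ t, 0 ≤ W t) {c₀ : ℝ} (hc₀ : 0 < c₀) (hWc : ∀ t, |t| ≤ 1 / 2 → c₀ ≤ W t)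
    {c : Euc d} {r : ℝ} (hr : 0 < r) (hcr : Metric.ball c (2 * r) ⊆ Ω) :
    ∃ κ : ℝ, 0 < κ ∧ ∀ ε : ℝ, 0 < ε → ε ≤ 1 → ∀ v : H1 Ω,
      ∫ x in Metric.ball c r, clamp (v.1.1 x) = 0 → ENNReal.ofReal κ ≤ energy W ε Ω v := by
  obtain ⟨G, hG, hG1, hG0, L, hL0, hL, hL'⟩ := exists_cutoff
  set B := Metric.ball c r with hB
  have hBm : MeasurableSet B := measurableSet_ball
  have hBΩ : B ⊆ Ω := (Metric.ball_subset_ball (by linarith)).trans hcr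
  have hBfin : volume B ≠ ⊤ := measure_ball_lt_top.ne
  have : IsFiniteMeasure (volume.restrict B) :=
    ⟨by rw [Measure.restrict_apply_univ]; exact hBfin.lt_top⟩
  set b := volume.real B with hb
  have hb0 : 0 < b := ENNReal.toReal_pos (Metric.measure_ball_pos volume c hr).ne' hBfin
  have hbu : (volume.restrict B).real univ = b := by
    rw [measureReal_restrict_apply_univ]
  set Λ := L ^ 2 / (2 * c₀) with hΛ
  have hΛ0 : 0 ≤ Λ := by positivity
  have hGW : ∀ t, deriv G t ^ 2 ≤ 2 * (Λ * W t) := by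
    intro t
    rcases le_or_gt |t| (1 / 2) with ht | ht
    · have h1 : deriv G t ^ 2 ≤ L ^ 2 := by
        rw [← sq_abs]
        gcongr
        exact hL t
      have h2 : L ^ 2 = 2 * (Λ * c₀) := by
        rw [hΛ]
        field_simp
      have h3 := mul_le_mul_of_nonneg_left (hWc t ht) hΛ0
      linarith
    · rw [hL' t ht]
      have := mul_nonneg hΛ0 (hW0 t)
      simpa using this
  set K := 2 * r * (2 ^ d * b * (1 + Λ)) with hK
  have hK0 : 0 < K := by positivity
  refine ⟨min (c₀ * (b / 8)) ((b / 5) ^ 2 / K), by positivity, fun ε hε hε1 v hv => ?_⟩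
  have hm : Measurable v.1.1 := (Lp.stronglyMeasurable v.1.1).measurable
  have mS : MeasurableSet {x | |v.1.1 x| < 1 / 2} := measurableSet_lt hm.abs measurable_const
  -- either `|v| ≥ 1 / 2` on most of the ball, and then `v` has to pass from one well to the
  -- other, or the potential alone contributes energy of order `1 / ε`
  rcases le_or_gt ((volume.restrict B).real {x | |v.1.1 x| < 1 / 2}) (b / 8) with hs | hs
  · have hosc := lintegral_lintegral_enorm_comp_sub_le (Ω := Ω)
      (((memLp_indicator_iff_restrict hΩ).2 (Lp.memLp v.1.1)).locallyIntegrable (by norm_num))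
      (((memLp_indicator_iff_restrict hΩ).2 (Lp.memLp v.1.2)).locallyIntegrable (by norm_num))
      ((Lp.stronglyMeasurable v.1.2).measurable.indicator hΩ) (H1.isWeakGradient hΩ v) hr hcr hG
      hL hε
    have e1 : ∫⁻ x in B, ∫⁻ y in B, ‖G (Ω.indicator v.1.1 x) - G (Ω.indicator v.1.1 y)‖ₑ =
        ∫⁻ x in B, ∫⁻ y in B, ‖G (v.1.1 x) - G (v.1.1 y)‖ₑ := by
      refine setLIntegral_congr_fun hBm fun x hx => setLIntegral_congr_fun hBm fun y hy => ?_
      simp only [indicator_of_mem (hBΩ hx), indicator_of_mem (hBΩ hy)]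
    have e2 : ∫⁻ x in B, ENNReal.ofReal (deriv G (Ω.indicator v.1.1 x) ^ 2 / (2 * ε)) =
        ∫⁻ x in B, ENNReal.ofReal (deriv G (v.1.1 x) ^ 2 / (2 * ε)) := by
      refine setLIntegral_congr_fun hBm fun x hx => ?_
      simp only [indicator_of_mem (hBΩ hx)]
    have e3 : ∫⁻ x, ENNReal.ofReal (ε * ‖Ω.indicator v.1.2 x‖ ^ 2 / 2) =
        ∫⁻ x in Ω, ENNReal.ofReal (ε * ‖v.1.2 x‖ ^ 2 / 2) := by
      rw [← lintegral_indicator hΩ]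
      refine lintegral_congr fun x => ?_
      by_cases hx : x ∈ Ω <;> simp [hx]
    rw [← hB, e1, e2, e3] at hosc
    have hlow := sq_le_lintegral_lintegral (volume.restrict B) hm hv hG1 hG0 (by rwa [hbu])
    rw [hbu] at hlow
    have hmain : ENNReal.ofReal ((b / 5) ^ 2) ≤ ENNReal.ofReal K * energy W ε Ω v := by
      refine (hlow.trans hosc).trans ?_
      refine (mul_le_mul_right (mul_le_mul_right
        (lintegral_gradient_add_le_energy hW0 hε v hBΩ hΛ0 hGW) _) _).trans (le_of_eq ?_)
      rw [hK, ENNReal.ofReal_mul (p := 2 * r) (by positivity),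
        ENNReal.ofReal_mul (p := 2 ^ d * b) (by positivity),
        ENNReal.ofReal_mul (p := 2 ^ d) (by positivity), hb, ofReal_measureReal]
      ring
    refine (ENNReal.ofReal_le_ofReal (min_le_right _ _)).trans ?_
    rw [ENNReal.ofReal_div_of_pos hK0]
    exact ENNReal.div_le_of_le_mul' hmain
  · have hle := mul_volume_le_energy hε v (S := {x | |v.1.1 x| < 1 / 2} ∩ B) (mS.inter hBm)
      (inter_subset_right.trans hBΩ) (c₀ := c₀) fun x hx => hWc _ (le_of_lt hx.1)
    refine le_trans ?_ hle
    rw [← Measure.restrict_apply mS, ← ofReal_measureReal, ← ENNReal.ofReal_mul (by positivity)]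
    refine ENNReal.ofReal_le_ofReal ((min_le_left _ _).trans ?_)
    refine mul_le_mul ?_ hs.le (by positivity) (by positivity)
    rw [le_div_iff₀ hε]
    nlinarith

theorem IsDoubleWell.pos (hW : IsDoubleWell W) {t : ℝ} (h1 : t ≠ 1) (h2 : t ≠ -1) : 0 < W t := by
  refine lt_of_le_of_ne (hW.nonneg t) fun h0 => ?_
  have hmin : IsLocalMin W t := Eventually.of_forall fun s => by
    rw [← h0]
    exact hW.nonneg s
  rcases (hW.critical t).1 hmin.deriv_eq_zero with h | h | h
  · exact h2 h
  · subst h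
    have hz : ∀ᶠ s in 𝓝 (0 : ℝ), W s = 0 := by
      filter_upwards [hW.isLocalMax] with s hs
      exact le_antisymm (h0 ▸ hs) (hW.nonneg s)
    have hd : ∀ᶠ s in 𝓝 (0 : ℝ), deriv W s = 0 := by
      filter_upwards [hz.eventually_nhds] with s hs
      have : W =ᶠ[𝓝 s] fun _ => 0 := hs
      rw [this.deriv_eq, deriv_const]
    have hd' : ∀ᶠ s in 𝓝[>] (0 : ℝ), deriv W s = 0 := nhdsWithin_le_nhds hd
    obtain ⟨s, hs, hs0, hs1⟩ := (hd'.and (Ioo_mem_nhdsGT one_pos)).exists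
    rcases (hW.critical s).1 hs with h | h | h <;> linarith
  · exact h1 h

theorem IsDoubleWell.sigma_pos (hW : IsDoubleWell W) : 0 < sigma W := by
  refine intervalIntegral.intervalIntegral_pos_of_pos_on ?_ (fun t ht => ?_) (by norm_num)
  · exact (Real.continuous_sqrt.comp (hW.contDiff.continuous.div_const 2)).intervalIntegrable _ _
  · exact Real.sqrt_pos.2 (half_pos (hW.pos ht.2.ne ht.1.ne'))

theorem exists_le_minmax_unitCube (hW : IsDoubleWell W) : ∃ κ : ℝ, 0 < κ ∧
    ∀ ε : ℝ, 0 < ε → ε ≤ 1 → ENNReal.ofReal κ ≤ minmax W ε 1 (unitCube d) := by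
  obtain ⟨c₀, hc₀, hWc⟩ : ∃ c₀ : ℝ, 0 < c₀ ∧ ∀ t, |t| ≤ 1 / 2 → c₀ ≤ W t := by
    obtain ⟨s, hs, hmin⟩ := (isCompact_Icc (a := -(1 / 2 : ℝ)) (b := 1 / 2)).exists_isMinOn
      ⟨0, by norm_num⟩ hW.contDiff.continuous.continuousOn
    refine ⟨W s, hW.pos ?_ ?_, fun t ht => hmin (abs_le.1 ht)⟩
    · linarith [hs.2]
    · linarith [hs.1]
  have hball : Metric.ball (WithLp.toLp 2 fun _ => 1 / 2 : Euc d) (2 * (1 / 4)) ⊆ unitCube d := by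
    intro x hx i
    have h1 := PiLp.norm_apply_le (x - WithLp.toLp 2 fun _ => 1 / 2) i
    rw [Metric.mem_ball, dist_eq_norm] at hx
    have h2 := abs_lt.1 (h1.trans_lt hx)
    simp only [PiLp.sub_apply] at h2
    exact ⟨by linarith [h2.1], by linarith [h2.2]⟩
  obtain ⟨κ, hκ, h⟩ := exists_le_energy_of_integral_clamp_eq_zero isOpen_unitCube.measurableSet
    hW.nonneg hc₀ hWc (by norm_num) hball
  refine ⟨κ, hκ, fun ε hε hε1 => le_iInf₂ fun A hA => ?_⟩
  obtain ⟨v, hv, hv0⟩ := exists_integral_clamp_eq_zero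
    (B := Metric.ball (WithLp.toLp 2 fun _ => 1 / 2 : Euc d) (1 / 4)) measurableSet_ball
    ((Metric.ball_subset_ball (by norm_num)).trans hball) measure_ball_lt_top.ne hA
  exact (h ε hε hε1 v hv0).trans
    (le_iSup₂ (f := fun v (_ : v ∈ A) => energy W ε (unitCube d) v) v hv)

end Lower

/-! ### Superadditivity of the spectrum -/

section Superadditivity

/-- The lower limit of the min-max values, which is the spectrum up to normalization. -/
def limMinmax {d : ℕ} (W : ℝ → ℝ) (p : ℕ) (Ω : Set (Euc d)) : ℝ≥0∞ :=
  liminf (fun ε : ℝ => minmax W ε p Ω) (𝓝[>] 0)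

theorem add_liminf_le {ι : Type*} {l : Filter ι} (u v : ι → ℝ≥0∞) :
    liminf u l + liminf v l ≤ liminf (fun j => u j + v j) l := by
  rcases eq_or_ne (liminf u l) 0 with hu | hu
  · rw [hu, zero_add]
    exact liminf_le_liminf (Eventually.of_forall fun j => le_add_self)
  rcases eq_or_ne (liminf v l) 0 with hv | hv
  · rw [hv, add_zero]
    exact liminf_le_liminf (Eventually.of_forall fun j => le_self_add)
  refine le_of_forall_lt fun c hc => ?_
  obtain ⟨a, ha, b, hb, hab⟩ := ENNReal.exists_lt_add_of_lt_add hc hu hv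
  refine hab.trans_le (le_liminf_of_le (by isBoundedDefault) ?_)
  filter_upwards [eventually_lt_of_lt_liminf ha, eventually_lt_of_lt_liminf hb] with j h1 h2
  exact add_le_add h1.le h2.le

theorem sum_liminf_le {ι κ : Type*} {l : Filter ι} (s : Finset κ) (u : κ → ι → ℝ≥0∞) :
    ∑ i ∈ s, liminf (u i) l ≤ liminf (fun j => ∑ i ∈ s, u i j) l := by
  classical
  induction s using Finset.induction_on with
  | empty => simp
  | insert a s ha ih =>
    simp only [Finset.sum_insert ha]
    exact (add_le_add le_rfl ih).trans (add_liminf_le _ _)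

theorem liminf_le_liminf_comp_div {t : ℝ} (ht : 0 < t) (f : ℝ → ℝ≥0∞) :
    liminf f (𝓝[>] 0) ≤ liminf (fun ε => f (ε / t)) (𝓝[>] 0) := by
  have h : Tendsto (fun ε : ℝ => ε / t) (𝓝[>] 0) (𝓝[>] 0) := by
    refine tendsto_nhdsWithin_iff.2 ⟨?_, ?_⟩
    · have : Tendsto (fun ε : ℝ => ε / t) (𝓝 0) (𝓝 (0 / t)) := tendsto_id.div_const t
      rw [zero_div] at this
      exact this.mono_left nhdsWithin_le_nhds
    · filter_upwards [self_mem_nhdsWithin] with ε hε using div_pos hε ht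
  exact h.liminf_le_liminf_comp

variable {n : ℕ} {W : ℝ → ℝ}

/-- Superadditivity survives the limit, in which the change of scale of `ε` disappears. -/
theorem sum_limMinmax_le (hW : Continuous W) (hWe : ∀ x, W (-x) = W x) {ι : Type*} (s : Finset ι)
    {Ω : Set (Euc (n + 1))} (Ω' : ι → Set (Euc (n + 1))) (hΩ' : ∀ i, IsOpen (Ω' i))
    (hfin : ∀ i, volume (Ω' i) ≠ ⊤) (a : ι → Euc (n + 1)) (t : ι → ℝ) (ht : ∀ i, 0 < t i)
    (hmap : ∀ i, MapsTo (similarity (a i) (ht i)) (Ω' i) Ω)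
    (hdisj : (s : Set ι).PairwiseDisjoint fun i => similarity (a i) (ht i) '' Ω' i) (p : ι → ℕ) :
    ∑ i ∈ s, ENNReal.ofReal (t i ^ n) * limMinmax W (p i) (Ω' i) ≤
      limMinmax W (∑ i ∈ s, p i) Ω := by
  calc ∑ i ∈ s, ENNReal.ofReal (t i ^ n) * limMinmax W (p i) (Ω' i)
      ≤ ∑ i ∈ s, liminf (fun ε => ENNReal.ofReal (t i ^ n) * minmax W (ε / t i) (p i) (Ω' i))
          (𝓝[>] 0) := by
        refine Finset.sum_le_sum fun i _ => ?_
        rw [ENNReal.liminf_const_mul_of_ne_zero_of_ne_top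
          (ENNReal.ofReal_pos.2 (pow_pos (ht i) n)).ne' ENNReal.ofReal_ne_top]
        exact mul_le_mul_right (liminf_le_liminf_comp_div (ht i) fun ε => minmax W ε (p i) (Ω' i)) _
    _ ≤ liminf (fun ε => ∑ i ∈ s, ENNReal.ofReal (t i ^ n) * minmax W (ε / t i) (p i) (Ω' i))
          (𝓝[>] 0) := sum_liminf_le s _
    _ ≤ limMinmax W (∑ i ∈ s, p i) Ω := liminf_le_liminf (Eventually.of_forall fun ε =>
        sum_minmax_le hW hWe ε s Ω' hΩ' hfin a t ht hmap hdisj p)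

theorem limMinmax_mono {d : ℕ} (W : ℝ → ℝ) {p q : ℕ} (hpq : p ≤ q) (Ω : Set (Euc d)) :
    limMinmax W p Ω ≤ limMinmax W q Ω :=
  liminf_le_liminf (Eventually.of_forall fun ε => minmax_mono W ε hpq Ω)

theorem limMinmax_empty {d : ℕ} (W : ℝ → ℝ) (p : ℕ) : limMinmax W p (∅ : Set (Euc d)) = 0 := by
  have : ∀ ε, minmax W ε p (∅ : Set (Euc d)) = 0 := fun ε =>
    nonpos_iff_eq_zero.1 ((minmax_le_energy_zero W ε p ∅).trans (by simp [energy_zero]))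
  simp only [limMinmax, this]
  exact liminf_const 0

/-- The vertices of the grid of mesh `t`. -/
def gridPoint {d : ℕ} (t : ℝ) (z : Fin d → ℤ) : Euc d := WithLp.toLp 2 fun i => t * z i

theorem floor_gridPoint {d : ℕ} {t : ℝ} (ht : 0 < t) (z : Fin d → ℤ) {x : Euc d}
    (hx : x ∈ similarity (gridPoint t z) ht '' unitCube d) (i : Fin d) : ⌊x i / t⌋ = z i := by
  obtain ⟨y, hy, rfl⟩ := hx
  have h1 : similarity (gridPoint t z) ht y i = t * (z i + y i) := by
    simp [similarity_apply, gridPoint, mul_add]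
  rw [h1, mul_div_cancel_left₀ _ ht.ne', Int.floor_eq_iff]
  exact ⟨by linarith [(hy i).1], by linarith [(hy i).2]⟩

theorem disjoint_gridCubes {d : ℕ} {t : ℝ} (ht : 0 < t) {z w : Fin d → ℤ} (h : z ≠ w) :
    Disjoint (similarity (gridPoint t z) ht '' unitCube d)
      (similarity (gridPoint t w) ht '' unitCube d) :=
  Set.disjoint_left.2 fun _ hx hx' =>
    h (funext fun i => (floor_gridPoint ht z hx i).symm.trans (floor_gridPoint ht w hx' i))

theorem volume_image_similarity {d : ℕ} (a : Euc d) {t : ℝ} (ht : 0 < t) (S : Set (Euc d)) :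
    volume (similarity a ht '' S) = ENNReal.ofReal (t ^ d) * volume S := by
  have h := lintegral_comp_similarity a ht S fun _ => 1
  simp only [lintegral_const, Measure.restrict_apply_univ, one_mul] at h
  rw [h, ← mul_assoc, ← ENNReal.ofReal_mul (by positivity), mul_inv_cancel₀ (by positivity),
    ENNReal.ofReal_one, one_mul]

/-- Superadditivity for a similar copy of `U` and finitely many disjoint grid cubes in `V`. -/
theorem limMinmax_add_card_mul_le (hW : Continuous W) (hWe : ∀ x, W (-x) = W x)
    {U V : Set (Euc (n + 1))} (hU : IsOpen U) (hUfin : volume U ≠ ⊤) (a : Euc (n + 1)) {s : ℝ}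
    (hs : 0 < s) (hUV : MapsTo (similarity a hs) U V) {t : ℝ} (ht : 0 < t)
    (Z : Finset (Fin (n + 1) → ℤ))
    (hZ : ∀ z ∈ Z, similarity (gridPoint t z) ht '' unitCube (n + 1) ⊆ V \ similarity a hs '' U)
    (p q : ℕ) :
    ENNReal.ofReal (s ^ n) * limMinmax W p U +
      Z.card * (ENNReal.ofReal (t ^ n) * limMinmax W q (unitCube (n + 1))) ≤
      limMinmax W (p + Z.card * q) V := by
  have hT : ∀ i : Option Z, 0 < i.elim s fun _ => t := fun i => by cases i <;> assumption
  have key := sum_limMinmax_le hW hWe (Finset.univ : Finset (Option Z)) (Ω := V)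
    (fun i => i.elim U fun _ => unitCube (n + 1))
    (fun i => by cases i; exacts [hU, isOpen_unitCube])
    (fun i => by
      cases i
      · exact hUfin
      · simp [volume_unitCube])
    (fun i => i.elim a fun z => gridPoint t z) (fun i => i.elim s fun _ => t) hT
    (fun i => by
      cases i with
      | none => exact hUV
      | some z => exact fun x hx => (hZ z z.2 (mem_image_of_mem _ hx)).1)
    (by
      rintro (_ | z) - (_ | w) - hne
      · exact absurd rfl hne
      · exact (Set.disjoint_left.2 fun x hx => (hZ w w.2 hx).2).symm
      · exact Set.disjoint_left.2 fun x hx => (hZ z z.2 hx).2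
      · exact disjoint_gridCubes ht fun h => hne (congrArg some (Subtype.ext h)))
    (fun i => i.elim p fun _ => q)
  rw [Fintype.sum_option, Fintype.sum_option] at key
  simpa using key

theorem card_mul_limMinmax_le (hW : Continuous W) (hWe : ∀ x, W (-x) = W x)
    {V : Set (Euc (n + 1))} {t : ℝ} (ht : 0 < t) (Z : Finset (Fin (n + 1) → ℤ))
    (hZ : ∀ z ∈ Z, similarity (gridPoint t z) ht '' unitCube (n + 1) ⊆ V) (q : ℕ) :
    Z.card * (ENNReal.ofReal (t ^ n) * limMinmax W q (unitCube (n + 1))) ≤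
      limMinmax W (Z.card * q) V := by
  have h := limMinmax_add_card_mul_le hW hWe (V := V) isOpen_empty (by simp) 0 one_pos
    (mapsTo_empty _ _) ht Z (fun z hz => by simpa using hZ z hz) 0 q
  rw [zero_add] at h
  exact le_add_self.trans h

/-- The unit cube consists of `k ^ (n + 1)` cubes of side `1 / k`. -/
theorem mul_limMinmax_unitCube_le (hW : Continuous W) (hWe : ∀ x, W (-x) = W x) {k : ℕ}
    (hk : 0 < k) (p : ℕ) : k * limMinmax W p (unitCube (n + 1)) ≤
      limMinmax W (k ^ (n + 1) * p) (unitCube (n + 1)) := by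
  have hk' : (0 : ℝ) < k := by exact_mod_cast hk
  have h := card_mul_limMinmax_le (n := n) (V := unitCube (n + 1)) hW hWe
    (t := 1 / k) (by positivity) (Fintype.piFinset fun _ => Finset.Ico (0 : ℤ) k) (fun z hz => by
      rintro _ ⟨y, hy, rfl⟩ i
      have h1 := Finset.mem_Ico.1 (Fintype.mem_piFinset.1 hz i)
      have h2 : (0 : ℝ) ≤ z i := by exact_mod_cast h1.1
      have h3 : (z i : ℝ) + 1 ≤ k := by exact_mod_cast h1.2
      have h4 : similarity (gridPoint (1 / k) z) (by positivity : (0 : ℝ) < 1 / k) y i =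
          (z i + y i) / k := by
        simp [similarity_apply, gridPoint]
        ring
      rw [h4]
      refine ⟨div_pos (by linarith [(hy i).1]) hk', ?_⟩
      rw [div_lt_one hk']
      linarith [(hy i).2]) p
  have hc : (Fintype.piFinset fun _ : Fin (n + 1) => Finset.Ico (0 : ℤ) k).card = k ^ (n + 1) := by
    simp
  rw [hc] at h
  refine le_trans (le_of_eq ?_) h
  rw [← mul_assoc]
  congr 1
  rw [← ENNReal.ofReal_natCast, ← ENNReal.ofReal_natCast, ← ENNReal.ofReal_mul (by positivity)]
  congr 1
  push_cast
  rw [one_div, inv_pow, pow_succ]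
  field_simp

theorem limMinmax_unitCube_ne_top (hW : IsDoubleWell W) (p : ℕ) :
    limMinmax W p (unitCube (n + 1)) ≠ ⊤ := by
  obtain ⟨K, -, hK⟩ := exists_minmax_unitCube_le n hW.contDiff.continuous hW.zero_right hW.zero_left
  have h1 : p ≤ (p + 1) ^ (n + 1) := (Nat.le_succ p).trans (Nat.le_self_pow (by omega) _)
  refine ne_top_of_le_ne_top ENNReal.ofReal_ne_top ((limMinmax_mono W h1 _).trans
    (liminf_le_of_frequently_le' (Eventually.frequently ?_)) : _ ≤ ENNReal.ofReal (K * (p + 1 : ℕ)))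
  filter_upwards [Ioc_mem_nhdsGT (show (0 : ℝ) < 1 / 4 by norm_num)] with ε hε
  exact hK (p + 1) (Nat.succ_pos p) ε hε.1 hε.2

end Superadditivity

/-! ### Filling open sets with cubes -/

section Filling

variable {d : ℕ}

theorem norm_le_of_forall_abs_le {x : Euc d} {t : ℝ} (ht : 0 ≤ t) (h : ∀ i, |x i| ≤ t) :
    ‖x‖ ≤ d * t := by
  rw [EuclideanSpace.norm_eq]
  refine Real.sqrt_le_iff.2 ⟨by positivity, ?_⟩
  calc ∑ i, ‖x i‖ ^ 2 ≤ ∑ _i : Fin d, t ^ 2 := by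
        refine Finset.sum_le_sum fun i _ => ?_
        exact pow_le_pow_left₀ (norm_nonneg _) (h i) 2
    _ = d * t ^ 2 := by simp
    _ ≤ (d * t) ^ 2 := by
        rw [mul_pow]
        refine mul_le_mul_of_nonneg_right ?_ (sq_nonneg t)
        rcases Nat.eq_zero_or_pos d with rfl | hd
        · simp
        · have : (1 : ℝ) ≤ d := by exact_mod_cast hd
          nlinarith

theorem sum_volume_gridCubes {t : ℝ} (ht : 0 < t) (Z : Finset (Fin d → ℤ)) {U : Set (Euc d)}
    (hfin : volume U ≠ ⊤)
    (hZ : ∀ z ∈ Z, similarity (gridPoint t z) ht '' unitCube d ⊆ U) :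
    Z.card * t ^ d ≤ volume.real U := by
  have h1 : volume (⋃ z ∈ Z, similarity (gridPoint t z) ht '' unitCube d) ≤ volume U :=
    measure_mono (iUnion₂_subset hZ)
  rw [measure_biUnion_finset (fun z _ w _ h => disjoint_gridCubes ht h) fun z _ =>
    ((similarity _ ht).isOpenMap _ isOpen_unitCube).measurableSet] at h1
  simp only [volume_image_similarity, volume_unitCube, mul_one, Finset.sum_const] at h1
  have h2 := ENNReal.toReal_mono hfin h1
  rw [← ENNReal.ofReal_nsmul, ENNReal.toReal_ofReal (by positivity), nsmul_eq_mul] at h2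
  exact h2

/-- An open set of finite measure can be filled by grid cubes up to a set of small measure. -/
theorem exists_gridCubes {U : Set (Euc d)} (hU : IsOpen U) (hfin : volume U ≠ ⊤) {η : ℝ}
    (hη : 0 < η) : ∃ (t : ℝ) (ht : 0 < t) (Z : Finset (Fin d → ℤ)),
      (∀ z ∈ Z, similarity (gridPoint t z) ht '' unitCube d ⊆ U) ∧
      volume.real U - η ≤ Z.card * t ^ d := by
  obtain ⟨K, hKU, hK, hKη⟩ : ∃ K ⊆ U, IsCompact K ∧ volume.real U - η ≤ volume.real K := by
    rcases le_or_gt (volume.real U) η with h | h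
    · exact ⟨∅, empty_subset _, isCompact_empty, by simpa using h⟩
    · obtain ⟨K, hKU, hK, h1⟩ := hU.exists_lt_isCompact (μ := volume)
        (r := ENNReal.ofReal (volume.real U - η)) (by
          rw [← ofReal_measureReal hfin]
          exact (ENNReal.ofReal_lt_ofReal_iff (by linarith)).2 (by linarith))
      exact ⟨K, hKU, hK, (ENNReal.ofReal_le_iff_le_toReal hK.measure_lt_top.ne).1 h1.le⟩
  obtain ⟨δ, hδ, hδU⟩ := hK.exists_thickening_subset_open hU hKU
  obtain ⟨R, hR⟩ := hK.isBounded.subset_closedBall (0 : Euc d)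
  -- the diameter of a cube is at most `d * t`, so that grid cubes meeting `K` lie in `U`
  set t := δ / (d + 1) with ht
  have ht0 : 0 < t := by positivity
  set idx : Euc d → Fin d → ℤ := fun x i => ⌊x i / t⌋ with hidx
  have hfinite : (idx '' K).Finite := by
    refine (Set.Finite.pi' fun _ : Fin d => Set.finite_Icc ⌊-R / t⌋ ⌊R / t⌋).subset ?_
    rintro _ ⟨x, hx, rfl⟩ i
    have h1 : |x i| ≤ R := (PiLp.norm_apply_le x i).trans (mem_closedBall_zero_iff.1 (hR hx))
    obtain ⟨h2, h3⟩ := abs_le.1 h1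
    exact ⟨Int.floor_le_floor (by gcongr), Int.floor_le_floor (by gcongr)⟩
  refine ⟨t, ht0, hfinite.toFinset, fun z hz => ?_, hKη.trans ?_⟩
  · obtain ⟨x, hx, rfl⟩ := hfinite.mem_toFinset.1 hz
    intro y hy
    refine hδU (Metric.mem_thickening_iff.2 ⟨x, hx, ?_⟩)
    rw [dist_eq_norm]
    have h1 : ‖y - x‖ ≤ d * t := by
      refine norm_le_of_forall_abs_le ht0.le fun i => ?_
      have h2 := floor_gridPoint ht0 _ hy i
      have h3 := Int.abs_sub_lt_one_of_floor_eq_floor h2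
      rw [← sub_div, abs_div, abs_of_pos ht0, div_lt_one ht0] at h3
      exact h3.le
    have h4 : (d + 1) * t = δ := by
      rw [ht]
      field_simp
    linarith
  · have h1 : volume K ≤ ∑ z ∈ hfinite.toFinset, ENNReal.ofReal (t ^ d) := by
      refine (measure_mono (fun x hx => mem_iUnion₂.2 ⟨idx x,
        hfinite.mem_toFinset.2 (mem_image_of_mem _ hx), ?_⟩)).trans
        ((measure_biUnion_finset_le hfinite.toFinset fun z => {x : Euc d | ∀ i, x i ∈
          Ico (t * z i) (t * (z i + 1))}).trans (Finset.sum_le_sum fun z _ => le_of_eq ?_))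
      · intro i
        have h2 := Int.floor_le (x i / t)
        have h3 := Int.lt_floor_add_one (x i / t)
        rw [le_div_iff₀ ht0] at h2
        rw [div_lt_iff₀ ht0] at h3
        exact ⟨by rw [mul_comm]; exact h2, by rw [mul_comm]; exact h3⟩
      · rw [volume_setOf_forall_mem fun i => Ico (t * (z i : ℝ)) (t * (z i + 1))]
        have : ∀ i, volume (Ico (t * (z i : ℝ)) (t * (z i + 1))) = ENNReal.ofReal t := fun i => by
          rw [Real.volume_Ico]
          congr 1
          ring
        rw [Finset.prod_congr rfl fun i _ => this i, Finset.prod_const, Finset.card_univ,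
          Fintype.card_fin, ENNReal.ofReal_pow ht0.le]
    rw [Finset.sum_const, ← ENNReal.ofReal_nsmul, nsmul_eq_mul] at h1
    have h2 := ENNReal.toReal_mono ENNReal.ofReal_ne_top h1
    rwa [ENNReal.toReal_ofReal (by positivity)] at h2

end Filling

/-! ### Boundaries of Lipschitz domains -/

section Boundary

variable {d : ℕ}

open scoped Pointwise in
/-- The graph of a function over a hyperplane is a null set: its vertical translates are
disjoint. -/
theorem volume_graph_inter_closedBall {v : Euc d} (hv : ‖v‖ = 1) {h : Euc d → ℝ}
    (hh : Continuous h) (x : Euc d) :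
    volume ({y | h (y - inner ℝ v y • v) = inner ℝ v y} ∩ Metric.closedBall x 1) = 0 := by
  have hc : Continuous fun y : Euc d => inner ℝ v y := continuous_const.inner continuous_id
  have hvv : inner ℝ v v = (1 : ℝ) := by rw [real_inner_self_eq_norm_sq, hv, one_pow]
  -- infinitely many disjoint translates fit into a bounded set
  refine Measure.addHaar_eq_zero_of_disjoint_translates volume
    (fun m : ℕ => (1 / ((m : ℝ) + 1)) • v) ?_ ?_ ?_
  · refine (Metric.isBounded_closedBall (x := (0 : Euc d)) (r := 1)).subset ?_
    rintro _ ⟨m, rfl⟩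
    rw [mem_closedBall_zero_iff, norm_smul, hv, mul_one, Real.norm_of_nonneg (by positivity),
      div_le_one (by positivity)]
    linarith [m.cast_nonneg (α := ℝ)]
  · intro m k hmk
    refine Set.disjoint_left.2 fun y hy hy' => hmk ?_
    have key : ∀ s : ℝ, y ∈ ({s • v} : Set (Euc d)) + ({y | h (y - inner ℝ v y • v) = inner ℝ v y} ∩
        Metric.closedBall x 1) → s = inner ℝ v y - h (y - inner ℝ v y • v) := by
      rintro s hs
      rw [singleton_add] at hs
      obtain ⟨w, ⟨hw, -⟩, rfl⟩ := hs
      have e1 : inner ℝ v (s • v + w) = s + inner ℝ v w := by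
        rw [inner_add_right, inner_smul_right, hvv, mul_one]
      have e2 : s • v + w - (s + inner ℝ v w) • v = w - inner ℝ v w • v := by
        rw [add_smul]
        abel
      have hw' : h (w - inner ℝ v w • v) = inner ℝ v w := hw
      simp only [e1, e2, hw']
      ring
    have h1 := (key _ hy).trans (key _ hy').symm
    have h2 : (m : ℝ) + 1 = k + 1 := by simpa using h1
    exact_mod_cast add_right_cancel h2
  · exact ((isClosed_eq (hh.comp (continuous_id.sub (hc.smul continuous_const))) hc).inter
      Metric.isClosed_closedBall).measurableSet

/-- The boundary of a Lipschitz domain is a null set, as it is locally a graph. -/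
theorem IsLipschitzDomain.volume_frontier {Ω : Set (Euc d)} (hΩ : IsLipschitzDomain Ω) :
    volume (frontier Ω) = 0 := by
  refine measure_null_of_locally_null _ fun x hx => ?_
  obtain ⟨v, K, h, hv, hh, hiff⟩ := hΩ.boundary x hx
  have hc : Continuous fun y : Euc d => inner ℝ v y := continuous_const.inner continuous_id
  have hhc : Continuous fun y : Euc d => h (y - inner ℝ v y • v) :=
    hh.continuous.comp (continuous_id.sub (hc.smul continuous_const))
  refine ⟨_, ?_, volume_graph_inter_closedBall hv hh.continuous x⟩
  have h1 := eventually_eventually_nhds.2 hiff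
  filter_upwards [nhdsWithin_le_nhds h1, self_mem_nhdsWithin,
    nhdsWithin_le_nhds (Metric.closedBall_mem_nhds x one_pos)] with y hy hyf hyb
  refine ⟨?_, hyb⟩
  rcases lt_trichotomy (h (y - inner ℝ v y • v)) (inner ℝ v y) with hlt | heq | hgt
  · have h2 : y ∈ Ω := hy.self_of_nhds.2 hlt
    exact absurd (hΩ.isOpen.interior_eq.symm ▸ h2) hyf.2
  · exact heq
  · have h2 : ∀ᶠ z in 𝓝 y, z ∉ Ω := by
      filter_upwards [hy, hc.continuousAt.eventually_lt hhc.continuousAt hgt] with z hz hz'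
      exact fun hzΩ => absurd (hz.1 hzΩ) (not_lt.2 hz'.le)
    obtain ⟨z, hz, hz'⟩ := ((mem_closure_iff_frequently.1 hyf.1).and_eventually h2).exists
    exact absurd hz hz'

end Boundary

/-! ### Asymptotics of superadditive sequences -/

section Asymptotics

variable {n : ℕ} {f g : ℕ → ℝ} {τ : ℝ}

theorem rpow_one_div_pow (n : ℕ) {x : ℝ} (hx : 0 ≤ x) :
    (x ^ (1 / ((n : ℝ) + 1))) ^ (n + 1) = x := by
  rw [← Real.rpow_natCast, ← Real.rpow_mul hx]
  push_cast
  rw [one_div_mul_cancel (by positivity), Real.rpow_one]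

theorem pow_rpow_one_div (n : ℕ) {x : ℝ} (hx : 0 ≤ x) :
    (x ^ (n + 1)) ^ (1 / ((n : ℝ) + 1)) = x := by
  rw [← Real.rpow_natCast, ← Real.rpow_mul hx]
  push_cast
  rw [mul_one_div_cancel (by positivity), Real.rpow_one]

theorem tendsto_rpow_neg_natCast (n : ℕ) :
    Tendsto (fun p : ℕ => (p : ℝ) ^ (-(1 / ((n : ℝ) + 1)))) atTop (𝓝 0) :=
  (tendsto_rpow_neg_atTop (by positivity)).comp tendsto_natCast_atTop_atTop

/-- A monotone sequence which is superadditive under subdivision of the cube into `k ^ (n + 1)`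
cubes grows exactly like `p ^ (1 / (n + 1))`. -/
theorem exists_tendsto_of_mul_le (hmono : Monotone f) (h0 : ∀ p, 0 ≤ f p)
    (hsup : ∀ k : ℕ, 0 < k → ∀ p, k * f p ≤ f (k ^ (n + 1) * p)) {K : ℝ}
    (hK : ∀ k : ℕ, 0 < k → f (k ^ (n + 1)) ≤ K * k) :
    ∃ τ : ℝ, f 1 ≤ τ ∧ (∀ p : ℕ, 0 < p → f p ≤ τ * (p : ℝ) ^ (1 / ((n : ℝ) + 1))) ∧
      Tendsto (fun p : ℕ => (p : ℝ) ^ (-(1 / ((n : ℝ) + 1))) * f p) atTop (𝓝 τ) := by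
  set a : ℝ := 1 / ((n : ℝ) + 1) with ha
  have ha0 : 0 < a := by positivity
  have hK0 : 0 ≤ K := by
    have := (h0 _).trans (hK 1 one_pos)
    simpa using this
  have hbdd : BddAbove (range fun p : ℕ => ((p + 1 : ℕ) : ℝ) ^ (-a) * f (p + 1)) := by
    refine ⟨2 * K, ?_⟩
    rintro _ ⟨p, rfl⟩
    set q := p + 1 with hq
    have hq1 : (1 : ℝ) ≤ q := by
      rw [hq]
      push_cast
      linarith [p.cast_nonneg (α := ℝ)]
    have hqa : 1 ≤ (q : ℝ) ^ a := Real.one_le_rpow hq1 ha0.le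
    have h1 : q ≤ ⌈(q : ℝ) ^ a⌉₊ ^ (n + 1) := by
      have : (q : ℝ) ≤ (⌈(q : ℝ) ^ a⌉₊ : ℝ) ^ (n + 1) := by
        calc (q : ℝ) = ((q : ℝ) ^ a) ^ (n + 1) := (rpow_one_div_pow n (by positivity)).symm
          _ ≤ _ := pow_le_pow_left₀ (by positivity) (Nat.le_ceil _) _
      exact_mod_cast this
    have h2 : f q ≤ K * (2 * (q : ℝ) ^ a) := by
      refine (hmono h1).trans ((hK _ (Nat.ceil_pos.2 (by positivity))).trans ?_)
      refine mul_le_mul_of_nonneg_left ?_ hK0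
      linarith [(Nat.ceil_lt_add_one (show 0 ≤ (q : ℝ) ^ a by positivity)).le]
    calc (q : ℝ) ^ (-a) * f q ≤ (q : ℝ) ^ (-a) * (K * (2 * (q : ℝ) ^ a)) := by gcongr
      _ = ((q : ℝ) ^ (-a) * (q : ℝ) ^ a) * (2 * K) := by ring
      _ = 2 * K := by rw [← Real.rpow_add (by positivity), neg_add_cancel, Real.rpow_zero, one_mul]
  -- the limit is the supremum of the sequence, as for the lemma of Fekete
  set τ := ⨆ p : ℕ, ((p + 1 : ℕ) : ℝ) ^ (-a) * f (p + 1) with hτ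
  have hle : ∀ p : ℕ, 0 < p → (p : ℝ) ^ (-a) * f p ≤ τ := by
    intro p hp
    obtain ⟨p, rfl⟩ := Nat.exists_eq_succ_of_ne_zero hp.ne'
    exact le_ciSup hbdd p
  refine ⟨τ, ?_, ?_, ?_⟩
  · simpa using hle 1 one_pos
  · intro p hp
    have hp' : (0 : ℝ) < p := by exact_mod_cast hp
    have h1 := hle p hp
    rw [Real.rpow_neg hp'.le, inv_mul_le_iff₀ (by positivity)] at h1
    linarith
  · refine tendsto_order.2 ⟨fun b hb => ?_, fun b hb => ?_⟩
    · obtain ⟨p₀, hp₀⟩ := exists_lt_of_lt_ciSup hb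
      set q := p₀ + 1 with hq
      have hq0 : (0 : ℝ) < q := by
        rw [hq]
        positivity
      have hlim : Tendsto (fun p : ℕ => (q : ℝ) ^ (-a) * f q - (p : ℝ) ^ (-a) * f q) atTop
          (𝓝 ((q : ℝ) ^ (-a) * f q - 0 * f q)) :=
        ((tendsto_rpow_neg_natCast n).mul_const _).const_sub _
      rw [zero_mul, sub_zero] at hlim
      filter_upwards [hlim.eventually (eventually_gt_nhds hp₀), eventually_gt_atTop 0] with p hp hp1
      refine hp.trans_le ?_
      have hp0 : (0 : ℝ) < p := by exact_mod_cast hp1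
      -- the largest `k` with `k ^ (n + 1) * q ≤ p`
      set k := ⌊((p : ℝ) / q) ^ a⌋₊ with hk
      have h1 : k * f q ≤ f p := by
        rcases Nat.eq_zero_or_pos k with hk0 | hk0
        · rw [hk0, Nat.cast_zero, zero_mul]
          exact h0 p
        · refine (hsup k hk0 q).trans (hmono ?_)
          have : ((k ^ (n + 1) * q : ℕ) : ℝ) ≤ p := by
            push_cast
            rw [← le_div_iff₀ hq0]
            calc (k : ℝ) ^ (n + 1) ≤ (((p : ℝ) / q) ^ a) ^ (n + 1) :=
                  pow_le_pow_left₀ (by positivity) (Nat.floor_le (by positivity)) _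
              _ = p / q := rpow_one_div_pow n (by positivity)
          exact_mod_cast this
      have h2 : ((p : ℝ) / q) ^ a - 1 ≤ k := (Nat.sub_one_lt_floor _).le
      calc (q : ℝ) ^ (-a) * f q - (p : ℝ) ^ (-a) * f q
          = (p : ℝ) ^ (-a) * ((((p : ℝ) / q) ^ a - 1) * f q) := by
            rw [Real.div_rpow hp0.le hq0.le, Real.rpow_neg hq0.le, Real.rpow_neg hp0.le]
            have : (p : ℝ) ^ a ≠ 0 := by positivity
            field_simp
        _ ≤ (p : ℝ) ^ (-a) * (k * f q) := by
            gcongr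
            exact h0 q
        _ ≤ (p : ℝ) ^ (-a) * f p := by gcongr
    · filter_upwards [eventually_gt_atTop 0] with p hp using (hle p hp).trans_lt hb

theorem tendsto_floor_mul (hf : Tendsto (fun p : ℕ => (p : ℝ) ^ (-(1 / ((n : ℝ) + 1))) * f p) atTop
    (𝓝 τ)) {θ : ℝ} (hθ : 0 < θ) :
    Tendsto (fun p : ℕ => (p : ℝ) ^ (-(1 / ((n : ℝ) + 1))) * f ⌊θ * p⌋₊) atTop
      (𝓝 (θ ^ (1 / ((n : ℝ) + 1)) * τ)) := by
  have hq : Tendsto (fun p : ℕ => ⌊θ * (p : ℝ)⌋₊) atTop atTop :=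
    tendsto_nat_floor_atTop.comp (tendsto_natCast_atTop_atTop.const_mul_atTop hθ)
  have h1 : Tendsto (fun p : ℕ => (⌊θ * (p : ℝ)⌋₊ : ℝ) / p) atTop (𝓝 θ) :=
    (tendsto_nat_floor_mul_div_atTop hθ.le).comp tendsto_natCast_atTop_atTop
  have h2 := (h1.rpow_const (p := 1 / ((n : ℝ) + 1)) (Or.inr (by positivity))).mul (hf.comp hq)
  refine h2.congr' ?_
  filter_upwards [eventually_gt_atTop 0, hq.eventually_gt_atTop 0] with p hp hqp
  have hp0 : (0 : ℝ) < p := by exact_mod_cast hp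
  have hq0 : (0 : ℝ) < ⌊θ * (p : ℝ)⌋₊ := by exact_mod_cast hqp
  simp only [Function.comp]
  rw [Real.div_rpow hq0.le hp0.le, Real.rpow_neg hq0.le, Real.rpow_neg hp0.le]
  have : (⌊θ * (p : ℝ)⌋₊ : ℝ) ^ (1 / ((n : ℝ) + 1)) ≠ 0 := by positivity
  field_simp

/-- A lower bound for the growth of `g` from a packing by `M` cubes of side `t`. -/
theorem eventually_lt_of_card_mul_le (hf : Tendsto (fun p : ℕ => (p : ℝ) ^ (-(1 / ((n : ℝ) + 1))) *
    f p) atTop (𝓝 τ)) (hg : Monotone g) {M : ℕ} (hM : 0 < M) {t : ℝ} (ht : 0 < t)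
    (h : ∀ q, M * (t ^ n * f q) ≤ g (M * q)) {b : ℝ}
    (hb : b < τ * ((M * t ^ (n + 1)) ^ ((n : ℝ) / (n + 1)))) :
    ∀ᶠ p : ℕ in atTop, b < (p : ℝ) ^ (-(1 / ((n : ℝ) + 1))) * g p := by
  have hM0 : (0 : ℝ) < M := by exact_mod_cast hM
  -- each cube is assigned `⌊p / M⌋` of the `p` parameters
  have h1 := (tendsto_floor_mul hf (one_div_pos.2 hM0)).const_mul (M * t ^ n)
  have e1 : M * t ^ n * ((1 / (M : ℝ)) ^ (1 / ((n : ℝ) + 1)) * τ) =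
      τ * ((M * t ^ (n + 1)) ^ ((n : ℝ) / (n + 1))) := by
    have e2 : (n : ℝ) / (n + 1) = 1 - 1 / ((n : ℝ) + 1) := by
      field_simp
      ring
    rw [e2, Real.rpow_sub (by positivity), Real.rpow_one,
      Real.mul_rpow hM0.le (by positivity), pow_rpow_one_div n ht.le,
      Real.div_rpow zero_le_one hM0.le, Real.one_rpow]
    have : (M : ℝ) ^ (1 / ((n : ℝ) + 1)) ≠ 0 := by positivity
    field_simp
    ring
  rw [e1] at h1
  filter_upwards [h1.eventually (eventually_gt_nhds hb)] with p hp
  refine hp.trans_le ?_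
  have h2 : M * ⌊1 / (M : ℝ) * p⌋₊ ≤ p := by
    have : (M : ℝ) * ⌊1 / (M : ℝ) * p⌋₊ ≤ p := by
      calc (M : ℝ) * ⌊1 / (M : ℝ) * p⌋₊ ≤ M * (1 / (M : ℝ) * p) := by
            gcongr
            exact Nat.floor_le (by positivity)
        _ = p := by field_simp
    exact_mod_cast this
  calc M * t ^ n * ((p : ℝ) ^ (-(1 / ((n : ℝ) + 1))) * f ⌊1 / (M : ℝ) * p⌋₊)
      = (p : ℝ) ^ (-(1 / ((n : ℝ) + 1))) * (M * (t ^ n * f ⌊1 / (M : ℝ) * p⌋₊)) := by ring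
    _ ≤ (p : ℝ) ^ (-(1 / ((n : ℝ) + 1))) * g p := by
        gcongr
        exact (h _).trans (hg h2)

/-- An upper bound for the growth of `g`, from a set of volume `u` which together with `M` cubes of
side `t` almost fills the unit cube. -/
theorem eventually_lt_of_add_card_mul_le (hf : Tendsto (fun p : ℕ =>
    (p : ℝ) ^ (-(1 / ((n : ℝ) + 1))) * f p) atTop (𝓝 τ)) (hτ : 0 ≤ τ)
    (hfle : ∀ p : ℕ, 0 < p → f p ≤ τ * (p : ℝ) ^ (1 / ((n : ℝ) + 1))) {M : ℕ} {t s u η : ℝ}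
    (ht : 0 < t) (hu : 0 < u) (h1 : u + M * t ^ (n + 1) ≤ 1)
    (h2 : 1 - u - η ≤ M * t ^ (n + 1))
    (h : ∀ p q, s ^ n * g p + M * (t ^ n * f q) ≤ f (p + M * q)) {b : ℝ}
    (hb : τ * (u ^ (-(1 / ((n : ℝ) + 1))) * (u + η)) < s ^ n * b) :
    ∀ᶠ p : ℕ in atTop, s ^ n * ((p : ℝ) ^ (-(1 / ((n : ℝ) + 1))) * g p) < s ^ n * b := by
  set a : ℝ := 1 / ((n : ℝ) + 1) with ha
  have ha0 : 0 < a := by positivity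
  -- for `p` parameters in the set of volume `u`, each cube is assigned `⌊θ * p⌋` parameters, which
  -- is the number proportional to its volume
  set θ := t ^ (n + 1) / u with hθ
  have hθ0 : 0 < θ := by positivity
  have hlim := ((tendsto_floor_mul hf hθ0).const_mul (M * t ^ n)).const_sub (τ * (1 + M * θ) ^ a)
  have hua : 0 < u ^ a := by positivity
  have hlt : τ * (1 + M * θ) ^ a - M * t ^ n * (θ ^ a * τ) < s ^ n * b := by
    refine lt_of_le_of_lt ?_ hb
    have e1 : 1 + M * θ = (u + M * t ^ (n + 1)) / u := by
      rw [hθ]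
      field_simp
    have e2 : (1 + M * θ) ^ a ≤ 1 / u ^ a := by
      rw [e1, Real.div_rpow (by positivity) hu.le]
      gcongr
      exact Real.rpow_le_one (by positivity) h1 ha0.le
    have e3 : θ ^ a = t / u ^ a := by
      rw [hθ, Real.div_rpow (by positivity) hu.le, pow_rpow_one_div n ht.le]
    calc τ * (1 + M * θ) ^ a - M * t ^ n * (θ ^ a * τ)
        ≤ τ * (1 / u ^ a) - M * t ^ n * (t / u ^ a * τ) := by
          rw [e3]
          gcongr
      _ = τ * (u ^ (-a) * (1 - M * t ^ (n + 1))) := by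
          rw [Real.rpow_neg hu.le, pow_succ]
          field_simp
      _ ≤ τ * (u ^ (-a) * (u + η)) := by
          gcongr
          linarith
  filter_upwards [hlim.eventually (eventually_lt_nhds hlt), eventually_gt_atTop 0] with p hp hp1
  refine lt_of_le_of_lt ?_ hp
  have hp0 : (0 : ℝ) < p := by exact_mod_cast hp1
  have e4 : ((p + M * ⌊θ * p⌋₊ : ℕ) : ℝ) ≤ p * (1 + M * θ) := by
    push_cast
    have : (⌊θ * (p : ℝ)⌋₊ : ℝ) ≤ θ * p := Nat.floor_le (by positivity)
    nlinarith [M.cast_nonneg (α := ℝ)]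
  have e5 : f (p + M * ⌊θ * p⌋₊) ≤ τ * ((p : ℝ) ^ a * (1 + M * θ) ^ a) := by
    refine (hfle _ (by omega)).trans ?_
    rw [← Real.mul_rpow hp0.le (by positivity)]
    gcongr
  have e6 : (p : ℝ) ^ (-a) * (p : ℝ) ^ a = 1 := by
    rw [← Real.rpow_add hp0, neg_add_cancel, Real.rpow_zero]
  have e7 : s ^ n * g p ≤ τ * ((p : ℝ) ^ a * (1 + M * θ) ^ a) - M * (t ^ n * f ⌊θ * p⌋₊) := by
    linarith [h p ⌊θ * p⌋₊]
  calc s ^ n * ((p : ℝ) ^ (-a) * g p) = (p : ℝ) ^ (-a) * (s ^ n * g p) := by ring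
    _ ≤ (p : ℝ) ^ (-a) * (τ * ((p : ℝ) ^ a * (1 + M * θ) ^ a) - M * (t ^ n * f ⌊θ * p⌋₊)) := by
        gcongr
    _ = τ * ((p : ℝ) ^ (-a) * (p : ℝ) ^ a) * (1 + M * θ) ^ a -
          M * t ^ n * ((p : ℝ) ^ (-a) * f ⌊θ * p⌋₊) := by ring
    _ = _ := by rw [e6, mul_one]

end Asymptotics

/-! ### The Weyl law -/

section Weyl

variable {n : ℕ} {W : ℝ → ℝ} {Ω : Set (Euc (n + 1))}

/-- A bounded set can be moved by a similarity to have its closure in the unit cube. -/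
theorem exists_similarity_closure_subset (hΩ : Bornology.IsBounded Ω) :
    ∃ (a : Euc (n + 1)) (s : ℝ) (hs : 0 < s),
      closure (similarity a hs '' Ω) ⊆ unitCube (n + 1) := by
  obtain ⟨R, hR0, hR⟩ := hΩ.subset_closedBall_lt 0 0
  have hs : 0 < 1 / (4 * R) := by positivity
  refine ⟨WithLp.toLp 2 fun _ => 1 / 2, 1 / (4 * R), hs, ?_⟩
  have h1 : similarity (WithLp.toLp 2 fun _ => 1 / 2 : Euc (n + 1)) hs '' Ω ⊆
      Metric.closedBall (WithLp.toLp 2 fun _ => 1 / 2 : Euc (n + 1)) (1 / 4) := by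
    rintro _ ⟨x, hx, rfl⟩
    rw [Metric.mem_closedBall, dist_eq_norm, similarity_apply, add_sub_cancel_left, norm_smul,
      Real.norm_of_nonneg hs.le]
    have h2 : ‖x‖ ≤ R := mem_closedBall_zero_iff.1 (hR hx)
    calc 1 / (4 * R) * ‖x‖ ≤ 1 / (4 * R) * R := by gcongr
      _ = 1 / 4 := by field_simp
  intro x hx i
  have h2 := closure_minimal h1 Metric.isClosed_closedBall hx
  rw [Metric.mem_closedBall, dist_eq_norm] at h2
  have h3 := abs_le.1 ((PiLp.norm_apply_le _ i).trans h2)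
  simp only [PiLp.sub_apply] at h3
  exact ⟨by linarith [h3.1], by linarith [h3.2]⟩

/-- The volume of the complement of a similar copy in the unit cube. -/
theorem volume_unitCube_diff_closure {a : Euc (n + 1)} {s : ℝ} {hs : 0 < s}
    (hcl : closure (similarity a hs '' Ω) ⊆ unitCube (n + 1))
    (hfr : volume (frontier Ω) = 0) :
    volume.real (unitCube (n + 1) \ closure (similarity a hs '' Ω)) =
      1 - s ^ (n + 1) * volume.real Ω := by
  have h1 : volume (closure (similarity a hs '' Ω)) = ENNReal.ofReal (s ^ (n + 1)) * volume Ω := by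
    rw [← (similarity a hs).image_closure, volume_image_similarity]
    congr 1
    refine le_antisymm ?_ (measure_mono subset_closure)
    rw [closure_eq_self_union_frontier]
    exact (measure_union_le _ _).trans (by rw [hfr, add_zero])
  rw [measureReal_sdiff hcl isClosed_closure.measurableSet (by simp [volume_unitCube])]
  simp [measureReal_def, volume_unitCube, h1, ENNReal.toReal_mul, hs.le]

theorem limMinmax_ne_top (hW : IsDoubleWell W) (hΩ : IsOpen Ω) (hb : Bornology.IsBounded Ω)
    (p : ℕ) : limMinmax W p Ω ≠ ⊤ := by
  obtain ⟨a, s, hs, hcl⟩ := exists_similarity_closure_subset hb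
  have h := limMinmax_add_card_mul_le hW.contDiff.continuous hW.even (V := unitCube (n + 1))
    hΩ hb.measure_lt_top.ne a hs
    (fun x hx => hcl (subset_closure (mem_image_of_mem _ hx))) one_pos ∅ (by simp) p 0
  simp only [Finset.card_empty, Nat.cast_zero, zero_mul, add_zero] at h
  intro htop
  rw [htop, ENNReal.mul_top (ENNReal.ofReal_pos.2 (pow_pos hs n)).ne', top_le_iff] at h
  exact limMinmax_unitCube_ne_top hW p h

/-- The Weyl law for the unnormalized spectrum. -/
theorem exists_tendsto_limMinmax (hn : n ≠ 0) (hW : IsDoubleWell W) : ∃ τ : ℝ, 0 < τ ∧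
    ∀ Ω : Set (Euc (n + 1)), IsLipschitzDomain Ω → Tendsto
      (fun p : ℕ => (p : ℝ) ^ (-(1 / ((n : ℝ) + 1))) * (limMinmax W p Ω).toReal) atTop
      (𝓝 (τ * volume.real Ω ^ ((n : ℝ) / (n + 1)))) := by
  have hWc := hW.contDiff.continuous
  set f : ℕ → ℝ := fun p => (limMinmax W p (unitCube (n + 1))).toReal with hf
  have hftop : ∀ p, limMinmax W p (unitCube (n + 1)) ≠ ⊤ := limMinmax_unitCube_ne_top hW
  have hfcast : ∀ p, ENNReal.ofReal (f p) = limMinmax W p (unitCube (n + 1)) := fun p =>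
    ENNReal.ofReal_toReal (hftop p)
  have hf0 : ∀ p, 0 ≤ f p := fun p => ENNReal.toReal_nonneg
  have hfmono : Monotone f := fun p q hpq =>
    ENNReal.toReal_mono (hftop q) (limMinmax_mono W hpq _)
  have hfsup : ∀ k : ℕ, 0 < k → ∀ p, k * f p ≤ f (k ^ (n + 1) * p) := by
    intro k hk p
    have h := ENNReal.toReal_mono (hftop _) (mul_limMinmax_unitCube_le hWc hW.even hk p)
    rwa [ENNReal.toReal_mul, ENNReal.toReal_natCast] at h
  obtain ⟨K, hK0, hK⟩ := exists_minmax_unitCube_le n hWc hW.zero_right hW.zero_left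
  have hfK : ∀ k : ℕ, 0 < k → f (k ^ (n + 1)) ≤ K * k := by
    intro k hk
    refine ENNReal.toReal_le_of_le_ofReal (by positivity)
      (liminf_le_of_frequently_le' (Eventually.frequently ?_))
    filter_upwards [Ioc_mem_nhdsGT (show (0 : ℝ) < 1 / 4 by norm_num)] with ε hε
    exact hK k hk ε hε.1 hε.2
  obtain ⟨κ, hκ, hκf⟩ := exists_le_minmax_unitCube (d := n + 1) hW
  have hf1 : κ ≤ f 1 := by
    refine (ENNReal.ofReal_le_iff_le_toReal (hftop 1)).1
      (le_liminf_of_le (by isBoundedDefault) ?_)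
    filter_upwards [Ioc_mem_nhdsGT (show (0 : ℝ) < 1 by norm_num)] with ε hε
    exact hκf ε hε.1 hε.2
  -- the constant is the one of the unit cube
  obtain ⟨τ, hfτ, hfle, hlim⟩ := exists_tendsto_of_mul_le hfmono hf0 hfsup hfK
  have hτ : 0 < τ := hκ.trans_le (hf1.trans hfτ)
  refine ⟨τ, hτ, fun Ω hΩ => ?_⟩
  have hΩfin : volume Ω ≠ ⊤ := hΩ.isBounded.measure_lt_top.ne
  rcases eq_empty_or_nonempty Ω with rfl | hne
  · have hn' : (n : ℝ) ≠ 0 := by exact_mod_cast hn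
    simp only [limMinmax_empty, ENNReal.toReal_zero, mul_zero, measureReal_empty]
    rw [Real.zero_rpow (by positivity), mul_zero]
    exact tendsto_const_nhds
  set g : ℕ → ℝ := fun p => (limMinmax W p Ω).toReal with hg
  have hgtop : ∀ p, limMinmax W p Ω ≠ ⊤ := limMinmax_ne_top hW hΩ.isOpen hΩ.isBounded
  have hgcast : ∀ p, ENNReal.ofReal (g p) = limMinmax W p Ω := fun p =>
    ENNReal.ofReal_toReal (hgtop p)
  have hg0 : ∀ p, 0 ≤ g p := fun p => ENNReal.toReal_nonneg
  have hgmono : Monotone g := fun p q hpq =>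
    ENNReal.toReal_mono (hgtop q) (limMinmax_mono W hpq _)
  set u := volume.real Ω with hu
  have hu0 : 0 < u := ENNReal.toReal_pos (hΩ.isOpen.measure_pos volume hne).ne' hΩfin
  refine tendsto_order.2 ⟨fun b hb => ?_, fun b hb => ?_⟩
  -- the lower bound: fill `Ω` with cubes up to volume `η`
  · obtain ⟨η, hbη, hη0, hηu⟩ : ∃ η : ℝ, b < τ * (u - η) ^ ((n : ℝ) / (n + 1)) ∧ 0 < η ∧ η < u := by
      have hc : Tendsto (fun η : ℝ => τ * (u - η) ^ ((n : ℝ) / (n + 1))) (𝓝 0)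
          (𝓝 (τ * (u - 0) ^ ((n : ℝ) / (n + 1)))) :=
        ((tendsto_id.const_sub u).rpow_const (Or.inr (by positivity))).const_mul τ
      rw [sub_zero] at hc
      have h1 : ∀ᶠ η in 𝓝[>] (0 : ℝ), b < τ * (u - η) ^ ((n : ℝ) / (n + 1)) :=
        nhdsWithin_le_nhds (hc.eventually (eventually_gt_nhds hb))
      obtain ⟨η, h2, h3⟩ := (h1.and (Ioo_mem_nhdsGT hu0)).exists
      exact ⟨η, h2, h3.1, h3.2⟩
    obtain ⟨t, ht, Z, hZ, hZη⟩ := exists_gridCubes hΩ.isOpen hΩfin hη0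
    have hZ0 : 0 < Z.card := by
      refine Nat.pos_of_ne_zero fun h => ?_
      rw [h, Nat.cast_zero, zero_mul] at hZη
      linarith
    refine eventually_lt_of_card_mul_le hlim hgmono hZ0 ht (fun q => ?_) (hbη.trans_le ?_)
    · have h := ENNReal.toReal_mono (hgtop _) (card_mul_limMinmax_le hWc hW.even ht Z hZ q)
      rwa [ENNReal.toReal_mul, ENNReal.toReal_natCast, ENNReal.toReal_mul,
        ENNReal.toReal_ofReal (by positivity)] at h
    · have : 0 ≤ u - η := by linarith
      gcongr
  -- the upper bound: fill the complement of a similar copy of `Ω` in the unit cube with cubes up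
  -- to volume `η`
  · obtain ⟨a, s, hs, hcl⟩ := exists_similarity_closure_subset hΩ.isBounded
    set u' := s ^ (n + 1) * u with hu'
    have hu'0 : 0 < u' := by positivity
    have hsb : τ * (u' ^ (-(1 / ((n : ℝ) + 1))) * u') < s ^ n * b := by
      have e1 : u' ^ (-(1 / ((n : ℝ) + 1))) * u' = s ^ n * u ^ ((n : ℝ) / (n + 1)) := by
        have e2 : (n : ℝ) / (n + 1) = 1 - 1 / ((n : ℝ) + 1) := by
          field_simp
          ring
        rw [Real.rpow_neg hu'0.le, hu', Real.mul_rpow (by positivity) hu0.le,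
          pow_rpow_one_div n hs.le, e2, Real.rpow_sub hu0, Real.rpow_one, pow_succ]
        field_simp
      rw [e1, mul_left_comm]
      gcongr
    obtain ⟨η, hbη, hη0⟩ : ∃ η : ℝ,
        τ * (u' ^ (-(1 / ((n : ℝ) + 1))) * (u' + η)) < s ^ n * b ∧ 0 < η := by
      have hc : Tendsto (fun η : ℝ => τ * (u' ^ (-(1 / ((n : ℝ) + 1))) * (u' + η))) (𝓝 0)
          (𝓝 (τ * (u' ^ (-(1 / ((n : ℝ) + 1))) * (u' + 0)))) :=
        ((tendsto_id.const_add u').const_mul _).const_mul τ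
      rw [add_zero] at hc
      have h1 : ∀ᶠ η in 𝓝[>] (0 : ℝ),
          τ * (u' ^ (-(1 / ((n : ℝ) + 1))) * (u' + η)) < s ^ n * b :=
        nhdsWithin_le_nhds (hc.eventually (eventually_lt_nhds hsb))
      exact (h1.and self_mem_nhdsWithin).exists
    have hVo : IsOpen (unitCube (n + 1) \ closure (similarity a hs '' Ω)) :=
      isOpen_unitCube.sdiff isClosed_closure
    have hVfin : volume (unitCube (n + 1) \ closure (similarity a hs '' Ω)) ≠ ⊤ :=
      measure_ne_top_of_subset sdiff_subset (by simp [volume_unitCube])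
    have hVvol := volume_unitCube_diff_closure hcl hΩ.volume_frontier
    obtain ⟨t, ht, Z, hZ, hZη⟩ := exists_gridCubes hVo hVfin hη0
    have hZle := sum_volume_gridCubes ht Z hVfin hZ
    rw [hVvol] at hZη hZle
    have key := eventually_lt_of_add_card_mul_le (g := g) (M := Z.card) (t := t) (s := s) (u := u')
      (η := η) hlim hτ.le hfle ht hu'0 (by linarith) (by linarith) (fun p q => ?_) hbη
    · filter_upwards [key] with p hp
      exact lt_of_mul_lt_mul_left hp (by positivity)
    · have h := ENNReal.toReal_mono (hftop _) (limMinmax_add_card_mul_le hWc hW.even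
        (V := unitCube (n + 1)) hΩ.isOpen hΩfin a hs
        (fun x hx => hcl (subset_closure (mem_image_of_mem _ hx))) ht Z
        (fun z hz => (hZ z hz).trans (sdiff_subset_sdiff_right subset_closure)) p q)
      rw [← hgcast, ← hfcast, ← ENNReal.ofReal_mul (by positivity),
        ← ENNReal.ofReal_mul (by positivity), ← ENNReal.ofReal_natCast,
        ← ENNReal.ofReal_mul (by positivity),
        ← ENNReal.ofReal_add (mul_nonneg (by positivity) (hg0 p))
          (mul_nonneg (by positivity) (mul_nonneg (by positivity) (hf0 q))),
        ENNReal.toReal_ofReal (add_nonneg (mul_nonneg (by positivity) (hg0 p))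
          (mul_nonneg (by positivity) (mul_nonneg (by positivity) (hf0 q))))] at h
      exact h

end Weyl

end

end AllenCahn

theorem mainTheorem2 (n : ℕ) (hn : 2 ≤ n) (W : ℝ → ℝ) (hW : AllenCahn.IsDoubleWell W) :
    ∃ τ : ℝ, 0 < τ ∧
      ∀ Ω : Set (AllenCahn.Euc (n + 1)), AllenCahn.IsLipschitzDomain Ω →
        Tendsto
          (fun p : ℕ =>
            ENNReal.ofReal ((p : ℝ) ^ (-(1 : ℝ) / (n + 1))) * AllenCahn.spectrum W p Ω)
          atTop
          (𝓝 (ENNReal.ofReal (τ * (volume.real Ω) ^ ((n : ℝ) / (n + 1))))) := by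
  obtain ⟨τ, hτ, h⟩ := AllenCahn.exists_tendsto_limMinmax (n := n) (by omega) hW
  have hσ := hW.sigma_pos
  refine ⟨τ / (2 * AllenCahn.sigma W), by positivity, fun Ω hΩ => ?_⟩
  have h1 := ENNReal.tendsto_ofReal ((h Ω hΩ).div_const (2 * AllenCahn.sigma W))
  rw [div_mul_eq_mul_div]
  refine h1.congr fun p => ?_
  rw [ENNReal.ofReal_div_of_pos (by positivity), ENNReal.ofReal_mul (by positivity),
    ENNReal.ofReal_toReal (AllenCahn.limMinmax_ne_top hW hΩ.isOpen hΩ.isBounded p), neg_div,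
    mul_div_assoc]
  rfl
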